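/- Notation and setting. Write $e(t)=\exp(2\pi i t)$, and use principal branches for square roots and complex powers. Let $L$ be an even lattice of signature $(b^+,b^-)$ with bilinear form $(\cdot,\cdot)$ and quadratic form $q(x)=\tfrac12(x,x)$; put $V=L\otimes\mathbb R$ and $x^2=(x,x)$. For a lattice $\Lambda$ let $\Lambda'$ be its dual, $D_\Lambda=\Lambda'/\Lambda$, and $(\mathfrak e_\sigma)_{\sigma\in D_\Lambda}$ the standard basis of $\mathbb C[D_\Lambda]$. Fix an isometry $g_0\colon V\to\mathbb R^{b^+,b^-}$, where $\mathbb R^{b^+,b^-}$ carries the bilinear form $\sum_{i\le b^+}x_iy_i-\sum_{i>b^+}x_iy_i$. For an isometry $g$ of $V$ let $z^\perp$ and $z$ be the preimages of $\mathbb R^{b^+,0}$ and $\mathbb R^{0,b^-}$ under $g_0\circ g$, and let $x\mapsto x_{z^\perp},x_z$ be the corresponding orthogonal projections. Let $P$ be a complex homogeneous polynomial of degree $k$ on $\mathbb R^{b^+,0}$, evaluated on $V$ through the positive coordinates of $g_0$, and let $\Delta$ be the Euclidean Laplacian. For $\eta\in L'$, $(\tau_1,\tau_2)\in\mathbb H\times\mathbb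 C$ with imaginary parts $y_1,y_2$, and $\alpha,\beta\in V$, the Jacobi theta function is $\Theta_{L,\eta}(\tau_1,\tau_2,\alpha,\beta,g,P)=\sum_{\sigma\in D_L}\theta^\sigma\,\mathfrak e_\sigma$ with $$\theta^\sigma=y_1^{b^- /2}e^{4\pi q(\eta_z)y_2^2/y_1}\sum_{\lambda\in\sigma+L}\exp\Big(-\frac{\Delta}{8\pi y_1}\Big)(P)\Big(g\big(\lambda+\tfrac{y_2}{y_1}\eta+\beta\big)\Big)\, e\Big(q((\lambda+\beta)_{z^\perp})\tau_1+q((\lambda+\beta)_z)\bar\tau_1+\tau_2(\lambda+\beta,\eta_{z^\perp})+\bar\tau_2(\lambda+\beta,\eta_z)-(\lambda+\tfrac{\beta}{2},\alpha)\Big);$$ $\alpha,\beta$ are omitted from the notation if both are $0$. Let $\rho_L$ be the Weil representation of $\mathrm{Mp}_2(\mathbb Z)$ on $\mathbb C[D_L]$, i.e. the representation with $\rho_L\big(\left(\begin{smallmatrix}1&1\\0&1\end{smallmatrix}\right),1\big)\mathfrak e_\sigma=e(q(\sigma))\mathfrak e_\sigma$ and $\rho_L\big(\left(\begin{smallmatrix}0&-1\\1&0\end{smallmatrix}\right),\sqrt{\tau_1}\big)\mathfrak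 e_\sigma=\frac{\sqrt i^{\,b^--b^+}}{\sqrt{|D_L|}}\sum_{\sigma'\in D_L}e(-(\sigma,\sigma'))\mathfrak e_{\sigma'}$. For $\gamma=\left(\begin{smallmatrix}a&b\\c&d\end{smallmatrix}\right)\in\mathrm{SL}_2(\mathbb Z)$ let $\tilde\gamma=(\gamma,\sqrt{c\tau_1+d})\in\mathrm{Mp}_2(\mathbb Z)$, $\gamma\tau_1=\frac{a\tau_1+b}{c\tau_1+d}$ and $\gamma\tau_2=\frac{\tau_2}{c\tau_1+d}$, and let $\Gamma_\infty=\{\left(\begin{smallmatrix}1&r\\0&1\end{smallmatrix}\right):r\in\mathbb Z\}$. Let $u\in L$ be primitive isotropic with $(u,L)=N\mathbb Z$, $N\geq 1$, let $u'\in L'$ with $(u,u')=1$, and let $M$ be the orthogonal complement of $u,u'$ in $L$, of signature $(b^+-1,b^--1)$. Let $w^\perp$ and $w$ be the orthogonal complements of $u_{z^\perp}$ in $z^\perp$ and of $u_z$ in $z$. Put $g_M(x)=g(x_{w^\perp}+x_w)$ and $$\mu=-u'+\frac{u_{z^\perp}}{2u_{z^\perp}^2}+\frac{u_z}{2u_z^2},$$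 and define polynomials $P_{g_M,h}$, $0\le h\le k$, of degree $k-h$ on the Euclidean space $g_0g(w^\perp)$ by $P(g(x))=\sum_h (x,u_{z^\perp})^hP_{g_M,h}(g_M(x))$. The function $\Theta_{M,\eta}(\tau_1,\tau_2,\alpha,\beta,g_M,P_{g_M,h})$, with values in $\mathbb C[D_M]$, is given by the same formula as above with $L,b^-,z^\perp,z,g,P$ replaced by $M,b^--1,w^\perp,w,g_M,P_{g_M,h}$ (and the Laplacian of the Euclidean space $g_0g(w^\perp)$). For $n\in\mathbb Z$ let $v\mapsto v\otimes E_n$ be the linear map $\mathbb C[D_M]\to\mathbb C[D_L]$ with $$\mathfrak e_\sigma\otimes E_n=\sum_{t\in\mathbb R/\mathbb Z,\ \sigma+tu\in L'}e(-nt)\,\mathfrak e_{\sigma+tu}\qquad(\sigma\in D_M).$$ If $\sigma\in L'$, the $t$ in this sum are the classes of $m/N$, so that $\mathfrak e_\sigma\otimes E_n=\sum_{m\in\mathbb Z/N\mathbb Z}e(-mn/N)\,\mathfrak e_{\sigma+mu/N}$; in other words $E_n$ stands for $\sum_{m\in\mathbb Z/N\mathbb Z}\mathfrak e_{mu/N}(-mn/N)$,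 where $\mathfrak e_\sigma(s)=e(s)\mathfrak e_\sigma$. Theorem. If $(\eta,u)=0$, then for all $(\tau_1,\tau_2)\in\mathbb H\times\mathbb C$ \begin{align*} \Theta_{L,\eta}(\tau_1,\tau_2,g,P)={}&\frac{1}{\sqrt{2u_{z^\perp}^2}}\,\Theta_{M,\eta}(\tau_1,\tau_2,g_M,P_{g_M,0})\otimes E_0\\ &+\frac{1}{\sqrt{2u_{z^\perp}^2}}\sum_{\gamma\in\Gamma_\infty\backslash\mathrm{SL}_2(\mathbb Z)}\ \sum_{n\ge1}\ \sum_{h=0}^{k}e\Big(-\frac{q(\eta)c\tau_2^2}{c\tau_1+d}\Big)\frac{n^h(c\tau_1+d)^{-k+(b^--b^+)/2}}{(-2i\,\Im(\gamma\tau_1))^h}\\ &\quad\times e\Big(-\frac{n^2+4in\,\Im(\gamma\tau_2)(\eta,u_{z^\perp})}{4i\,\Im(\gamma\tau_1)\,u_{z^\perp}^2}\Big)\,\rho_L(\tilde\gamma)^{-1}\Big(\Theta_{M,\eta}(\gamma\tau_1,\gamma\tau_2,n\mu,0,g_M,P_{g_M,h})\otimes E_n\Big), \end{align*} where the sum over pairs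 $(\gamma,n)$ converges absolutely and may be taken over any system of representatives $\gamma=\left(\begin{smallmatrix}a&b\\c&d\end{smallmatrix}\right)$ of $\Gamma_\infty\backslash\mathrm{SL}_2(\mathbb Z)$. -/

import Mathlib

open scoped MatrixGroups

noncomputable section

namespace JacobiTheta

open UpperHalfPlane

/-! ### The metaplectic group `Mp₂(ℤ)` -/

/-- The automorphy factor `cτ + d`. -/
def autFactor (γ : SL(2, ℤ)) (τ : ℍ) : ℂ := ((γ 1 0 : ℤ) : ℂ) * (τ : ℂ) + ((γ 1 1 : ℤ) : ℂ)

theorem autFactor_eq_denom (γ : SL(2, ℤ)) (τ : ℍ) :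
    autFactor γ τ = denom (γ : GL (Fin 2) ℝ) (τ : ℂ) := by
  simp [autFactor, denom]

theorem autFactor_mul (γ δ : SL(2, ℤ)) (τ : ℍ) :
    autFactor (γ * δ) τ = autFactor γ (δ • τ) * autFactor δ τ := by
  have h := denom_cocycle_σ (γ : GL (Fin 2) ℝ) (δ : GL (Fin 2) ℝ) τ
  rw [autFactor_eq_denom, autFactor_eq_denom, autFactor_eq_denom, map_mul, map_mul, h]
  simp [UpperHalfPlane.σ, ModularGroup.sl_moeb]

theorem autFactor_ne_zero (γ : SL(2, ℤ)) (τ : ℍ) : autFactor γ τ ≠ 0 := by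
  rw [autFactor_eq_denom]
  exact denom_ne_zero _ τ

theorem autFactor_one (τ : ℍ) : autFactor 1 τ = 1 := by
  simp [autFactor]

/-- `Mp₂(ℤ)`: pairs of a matrix in `SL₂(ℤ)` and a holomorphic square root of `cτ + d`
on the upper half-plane. -/
@[ext]
structure Mp2Z where
  mat : SL(2, ℤ)
  root : ℍ → ℂ
  holo : MDifferentiable (modelWithCornersSelf ℂ ℂ) (modelWithCornersSelf ℂ ℂ) root
  sq : ∀ τ, root τ ^ 2 = autFactor mat τ

namespace Mp2Z

theorem root_ne_zero (x : Mp2Z) (τ : ℍ) : x.root τ ≠ 0 := by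
  intro h
  have h2 := x.sq τ
  rw [h] at h2
  exact autFactor_ne_zero x.mat τ (by simpa using h2.symm)

theorem holo_comp (x : Mp2Z) (γ : SL(2, ℤ)) :
    MDifferentiable (modelWithCornersSelf ℂ ℂ) (modelWithCornersSelf ℂ ℂ)
      (fun τ => x.root (γ • τ)) := by
  have h : MDifferentiable (modelWithCornersSelf ℂ ℂ) (modelWithCornersSelf ℂ ℂ)
      (fun τ : ℍ => γ • τ) :=
    mdifferentiable_smul (g := (γ : GL (Fin 2) ℝ)) (by simp)
  exact x.holo.comp h

theorem holo_inv (f : ℍ → ℂ)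
    (hf : MDifferentiable (modelWithCornersSelf ℂ ℂ) (modelWithCornersSelf ℂ ℂ) f)
    (h0 : ∀ τ, f τ ≠ 0) :
    MDifferentiable (modelWithCornersSelf ℂ ℂ) (modelWithCornersSelf ℂ ℂ)
      (fun τ => (f τ)⁻¹) := by
  rw [mdifferentiable_iff] at hf ⊢
  exact hf.inv (fun z _ => h0 _)

/-- `(M, f) (N, g) = (M N, f(N τ) g(τ))`. -/
instance : Mul Mp2Z where
  mul x y :=
    { mat := x.mat * y.mat
      root := fun τ => x.root (y.mat • τ) * y.root τ
      holo := (x.holo_comp y.mat).mul y.holo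
      sq := fun τ => by rw [mul_pow, x.sq, y.sq, autFactor_mul] }

instance : One Mp2Z where
  one :=
    { mat := 1
      root := fun _ => 1
      holo := mdifferentiable_const
      sq := fun τ => by rw [autFactor_one, one_pow] }

instance : Inv Mp2Z where
  inv x :=
    { mat := x.mat⁻¹
      root := fun τ => (x.root (x.mat⁻¹ • τ))⁻¹
      holo := holo_inv _ (x.holo_comp x.mat⁻¹) (fun _ => x.root_ne_zero _)
      sq := fun τ => by
        have h := autFactor_mul x.mat x.mat⁻¹ τ
        rw [mul_inv_cancel, autFactor_one] at h
        rw [inv_pow, x.sq]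
        exact inv_eq_of_mul_eq_one_right h.symm }

theorem mul_mat (x y : Mp2Z) : (x * y).mat = x.mat * y.mat := rfl
theorem mul_root (x y : Mp2Z) (τ : ℍ) : (x * y).root τ = x.root (y.mat • τ) * y.root τ := rfl
theorem one_mat : (1 : Mp2Z).mat = 1 := rfl
theorem one_root (τ : ℍ) : (1 : Mp2Z).root τ = 1 := rfl
theorem inv_mat (x : Mp2Z) : (x⁻¹).mat = x.mat⁻¹ := rfl
theorem inv_root (x : Mp2Z) (τ : ℍ) : (x⁻¹).root τ = (x.root (x.mat⁻¹ • τ))⁻¹ := rfl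

instance : Group Mp2Z :=
  Group.ofLeftAxioms
    (fun x y z => by
      ext1
      · simp only [mul_mat, mul_assoc]
      · funext τ
        simp only [mul_mat, mul_root, mul_smul, mul_assoc])
    (fun x => by
      ext1
      · simp only [mul_mat, one_mat, one_mul]
      · funext τ
        simp only [mul_root, one_root, one_mul])
    (fun x => by
      ext1
      · simp only [mul_mat, one_mat, inv_mat, inv_mul_cancel]
      · funext τ
        simp only [mul_root, one_root, inv_root, inv_smul_smul]
        exact inv_mul_cancel₀ (x.root_ne_zero τ))

theorem holo_sqrt (γ : SL(2, ℤ)) :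
    MDifferentiable (modelWithCornersSelf ℂ ℂ) (modelWithCornersSelf ℂ ℂ)
      (fun τ => autFactor γ τ ^ (1 / 2 : ℂ)) := by
  rw [mdifferentiable_iff]
  have key : DifferentiableOn ℂ
      (fun z : ℂ => (((γ 1 0 : ℤ) : ℂ) * z + ((γ 1 1 : ℤ) : ℂ)) ^ (1 / 2 : ℂ))
      {z | 0 < z.im} := by
    by_cases hc : γ 1 0 = 0
    · simp only [hc, Int.cast_zero, zero_mul, zero_add]
      exact differentiableOn_const _
    · refine DifferentiableOn.cpow (by fun_prop) (by fun_prop) ?_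
      intro z hz
      rw [Complex.mem_slitPlane_iff]
      right
      have hz' : z.im ≠ 0 := (show (0 : ℝ) < z.im from hz).ne'
      simpa using ⟨hc, hz'⟩
  refine key.congr ?_
  intro z hz
  simp only [Function.comp_apply, autFactor, ofComplex_apply_of_im_pos hz]

/-- The standard preimage `(γ, √(cτ + d))` of `γ`, with the principal branch of the square root. -/
def stdLift (γ : SL(2, ℤ)) : Mp2Z where
  mat := γ
  root := fun τ => autFactor γ τ ^ (1 / 2 : ℂ)
  holo := holo_sqrt γ
  sq := fun τ => by
    rw [← Complex.cpow_nat_mul]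
    norm_num

end Mp2Z

/-! ### Lattices, discriminant groups, Weil representation -/

/-- `e(t) = exp(2πit)`. -/
def e (t : ℂ) : ℂ := Complex.exp (2 * Real.pi * Complex.I * t)

section Lattice

variable {V : Type*} [AddCommGroup V] [Module ℝ V]

/-- The quadratic form `q(x) = (x, x) / 2`. -/
def quad (B : LinearMap.BilinForm ℝ V) (x : V) : ℝ := B x x / 2

/-- A full lattice in `V`: the `ℤ`-span of an `ℝ`-basis of `V`. -/
def IsFullLattice (L : Submodule ℤ V) : Prop :=
  ∃ (n : ℕ) (b : Module.Basis (Fin n) ℝ V), L = Submodule.span ℤ (Set.range b)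

/-- The lattice is even: `q` takes integral values on it. -/
def IsEvenLattice (B : LinearMap.BilinForm ℝ V) (L : Submodule ℤ V) : Prop :=
  ∀ x ∈ L, ∃ m : ℤ, quad B x = m

/-- The dual lattice `Λ' ⊆ Λ ⊗ ℝ`, where `Λ ⊗ ℝ` is the real span of `Λ` in `V`. -/
def dualLattice (B : LinearMap.BilinForm ℝ V) (Λ : Submodule ℤ V) : Submodule ℤ V where
  carrier := {x | x ∈ Submodule.span ℝ (Λ : Set V) ∧ ∀ y ∈ Λ, ∃ m : ℤ, B x y = m}
  zero_mem' := ⟨Submodule.zero_mem _, fun y _ => ⟨0, by simp⟩⟩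
  add_mem' := by
    rintro a b ⟨ha, ha'⟩ ⟨hb, hb'⟩
    refine ⟨Submodule.add_mem _ ha hb, fun y hy => ?_⟩
    obtain ⟨m, hm⟩ := ha' y hy
    obtain ⟨n, hn⟩ := hb' y hy
    exact ⟨m + n, by simp [hm, hn]⟩
  smul_mem' := by
    rintro c x ⟨hx, hx'⟩
    refine ⟨?_, fun y hy => ?_⟩
    · rw [← Int.cast_smul_eq_zsmul ℝ c x]
      exact Submodule.smul_mem _ _ hx
    · obtain ⟨m, hm⟩ := hx' y hy
      exact ⟨c * m, by rw [← Int.cast_smul_eq_zsmul ℝ c x]; simp [hm]⟩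

/-- The discriminant group `D_Λ = Λ' / Λ`. -/
abbrev Disc (B : LinearMap.BilinForm ℝ V) (Λ : Submodule ℤ V) : Type _ :=
  dualLattice B Λ ⧸ Λ.comap (dualLattice B Λ).subtype

/-- `x ∈ V` lies in `Λ'` and its class in `D_Λ` is `σ`, i.e. `x ∈ σ + Λ`. -/
def InClass (B : LinearMap.BilinForm ℝ V) (Λ : Submodule ℤ V) (σ : Disc B Λ) (x : V) : Prop :=
  ∃ h : x ∈ dualLattice B Λ, (Submodule.Quotient.mk ⟨x, h⟩ : Disc B Λ) = σ

/-- A representative in `Λ'` of a class in `D_Λ`. -/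
def repr (B : LinearMap.BilinForm ℝ V) (Λ : Submodule ℤ V) (σ : Disc B Λ) : V :=
  ((Quotient.out σ : dualLattice B Λ) : V)

open Classical in
/-- The basis vector `𝔢_σ` of the group algebra `ℂ[D_Λ]`, whose elements `∑ v_σ 𝔢_σ` are
written as functions `v : D_Λ → ℂ`. -/
def basisVec (B : LinearMap.BilinForm ℝ V) (Λ : Submodule ℤ V) (σ : Disc B Λ) : Disc B Λ → ℂ :=
  Pi.single σ 1

/-- `ρ` is the Weil representation attached to an even lattice `L` of signature `(p, n)`:
`ρ(T) 𝔢_σ = e(q(σ)) 𝔢_σ` and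
`ρ(S) 𝔢_σ = √i ^ (n - p) / √|D_L| ∑_{σ'} e(-(σ, σ')) 𝔢_{σ'}`
for the standard generators `T = ((1 1; 0 1), 1)` and `S = ((0 -1; 1 0), √τ)` of `Mp₂(ℤ)`. -/
def IsWeilRep (B : LinearMap.BilinForm ℝ V) (L : Submodule ℤ V) (p n : ℕ)
    (ρ : Mp2Z →* Module.End ℂ (Disc B L → ℂ)) : Prop :=
  (∀ (σ : Disc B L) (x : V), InClass B L σ x →
    ρ (Mp2Z.stdLift ModularGroup.T) (basisVec B L σ) = e (quad B x) • basisVec B L σ) ∧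
  (∀ (σ σ' : Disc B L) (x x' : V), InClass B L σ x → InClass B L σ' x' →
    ρ (Mp2Z.stdLift ModularGroup.S) (basisVec B L σ) σ' =
      (Complex.I ^ (1 / 2 : ℂ)) ^ ((n : ℤ) - (p : ℤ)) / (Real.sqrt (Nat.card (Disc B L)) : ℂ)
        * e (-(B x x' : ℝ)))

open Classical in
/-- The Weil representation of `Mp₂(ℤ)` on `ℂ[D_L]`: the representation with the above values on
the standard generators. (It exists for every even lattice of signature `(p, n)`, and is unique
since `S` and `T` generate `Mp₂(ℤ)`.) -/
def weilRep (B : LinearMap.BilinForm ℝ V) (L : Submodule ℤ V) (p n : ℕ) :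
    Mp2Z →* Module.End ℂ (Disc B L → ℂ) :=
  if h : ∃ ρ, IsWeilRep B L p n ρ then h.choose else 1

/-! ### Polynomials -/

/-- The Laplacian `∑ ∂²/∂x_i²` on polynomials on `ℝ^p`. -/
def laplacian {p : ℕ} (P : MvPolynomial (Fin p) ℂ) : MvPolynomial (Fin p) ℂ :=
  ∑ i, MvPolynomial.pderiv i (MvPolynomial.pderiv i P)

/-- `exp(-Δ / 8πy)(P) = ∑_m (1 / m!) (-1 / 8πy)^m Δ^m P`; the terms with `m > deg P` vanish. -/
def heatPoly {p : ℕ} (y : ℝ) (P : MvPolynomial (Fin p) ℂ) : MvPolynomial (Fin p) ℂ :=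
  ∑ m ∈ Finset.range (P.totalDegree + 1),
    (((m.factorial : ℂ)⁻¹ * (-1 / (8 * Real.pi * y) : ℂ) ^ m) • (laplacian^[m] P))

/-- The value of a complex polynomial at a real point. -/
def evalReal {p : ℕ} (P : MvPolynomial (Fin p) ℂ) (x : Fin p → ℝ) : ℂ :=
  MvPolynomial.eval (fun i => (x i : ℂ)) P

/-- For `v ∈ ℝ^p` nonzero, the coefficient of `s^h` in `P(x' + (s / |v|²) v)`, where `x'` is the
orthogonal projection of `x` to the orthogonal complement of `v`. So
`P(x) = ∑_h ⟨x, v⟩^h P_h(x')`. As a polynomial on `ℝ^p`, it is constant in the direction of `v`;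
hence the Laplacian of `ℝ^p` acts on it as the Laplacian of the Euclidean space `v^⊥`. -/
def subPoly {p : ℕ} (P : MvPolynomial (Fin p) ℂ) (v : Fin p → ℝ) (h : ℕ) :
    MvPolynomial (Fin p) ℂ :=
  Polynomial.coeff
    (MvPolynomial.aeval
      (fun i : Fin p =>
        (Polynomial.C (MvPolynomial.X i
            - MvPolynomial.C ((v i / (v ⬝ᵥ v) : ℝ) : ℂ)
              * ∑ j, MvPolynomial.C ((v j : ℝ) : ℂ) * MvPolynomial.X j)
          + Polynomial.C (MvPolynomial.C ((v i / (v ⬝ᵥ v) : ℝ) : ℂ)) * Polynomial.X :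
          Polynomial (MvPolynomial (Fin p) ℂ))) P) h

/-! ### Projections attached to isometries -/

variable {p n : ℕ}

/-- `g₀ : V → ℝ^{p,n}` is an isometry, where `ℝ^{p,n}` carries the bilinear form
`∑ x_i y_i - ∑ x_j y_j`. -/
def IsIsometryToStd (B : LinearMap.BilinForm ℝ V)
    (g₀ : V ≃ₗ[ℝ] (Fin p → ℝ) × (Fin n → ℝ)) : Prop :=
  ∀ x y, B x y = ∑ i, (g₀ x).1 i * (g₀ y).1 i - ∑ j, (g₀ x).2 j * (g₀ y).2 j

/-- The projection `x ↦ x_{z^⊥}` to the positive definite subspace `z^⊥ = g⁻¹(g₀⁻¹(ℝ^{p,0}))`. -/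
def posProj (g₀ : V ≃ₗ[ℝ] (Fin p → ℝ) × (Fin n → ℝ)) (g : V ≃ₗ[ℝ] V) : V →ₗ[ℝ] V :=
  g.symm.toLinearMap ∘ₗ g₀.symm.toLinearMap ∘ₗ
    LinearMap.inl ℝ (Fin p → ℝ) (Fin n → ℝ) ∘ₗ LinearMap.fst ℝ (Fin p → ℝ) (Fin n → ℝ) ∘ₗ
    g₀.toLinearMap ∘ₗ g.toLinearMap

/-- The projection `x ↦ x_z` to the negative definite subspace `z = g⁻¹(g₀⁻¹(ℝ^{0,n}))`. -/
def negProj (g₀ : V ≃ₗ[ℝ] (Fin p → ℝ) × (Fin n → ℝ)) (g : V ≃ₗ[ℝ] V) : V →ₗ[ℝ] V :=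
  g.symm.toLinearMap ∘ₗ g₀.symm.toLinearMap ∘ₗ
    LinearMap.inr ℝ (Fin p → ℝ) (Fin n → ℝ) ∘ₗ LinearMap.snd ℝ (Fin p → ℝ) (Fin n → ℝ) ∘ₗ
    g₀.toLinearMap ∘ₗ g.toLinearMap

/-- If `π` is the orthogonal projection to a definite subspace, then this is the orthogonal
projection to the orthogonal complement of `π u` in that subspace. -/
def projPerp (B : LinearMap.BilinForm ℝ V) (π : V →ₗ[ℝ] V) (u : V) : V →ₗ[ℝ] V :=
  π - ((B (π u) (π u))⁻¹ • (B (π u) ∘ₗ π)).smulRight (π u)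

/-- The projection `x ↦ x_{w^⊥}` to the orthogonal complement `w^⊥` of `u_{z^⊥}` in `z^⊥`. -/
def wPosProj (B : LinearMap.BilinForm ℝ V) (g₀ : V ≃ₗ[ℝ] (Fin p → ℝ) × (Fin n → ℝ))
    (g : V ≃ₗ[ℝ] V) (u : V) : V →ₗ[ℝ] V :=
  projPerp B (posProj g₀ g) u

/-- The projection `x ↦ x_w` to the orthogonal complement `w` of `u_z` in `z`. -/
def wNegProj (B : LinearMap.BilinForm ℝ V) (g₀ : V ≃ₗ[ℝ] (Fin p → ℝ) × (Fin n → ℝ))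
    (g : V ≃ₗ[ℝ] V) (u : V) : V →ₗ[ℝ] V :=
  projPerp B (negProj g₀ g) u

/-- The linear map `g_M : x ↦ g(x_{w^⊥} + x_w)`. -/
def subIsometry (B : LinearMap.BilinForm ℝ V) (g₀ : V ≃ₗ[ℝ] (Fin p → ℝ) × (Fin n → ℝ))
    (g : V ≃ₗ[ℝ] V) (u : V) : V →ₗ[ℝ] V :=
  g.toLinearMap ∘ₗ (wPosProj B g₀ g u + wNegProj B g₀ g u)

/-- The polynomial `P_{g_M,h}`, determined by
`P(g(x)) = ∑_h (x, u_{z^⊥})^h P_{g_M,h}(g_M(x))`. -/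
def subIsometryPoly (g₀ : V ≃ₗ[ℝ] (Fin p → ℝ) × (Fin n → ℝ))
    (g : V ≃ₗ[ℝ] V) (u : V) (P : MvPolynomial (Fin p) ℂ) (h : ℕ) : MvPolynomial (Fin p) ℂ :=
  subPoly P (g₀ (g (posProj g₀ g u))).1 h

/-- The vector `μ = -u' + u_{z^⊥} / (2 u_{z^⊥}²) + u_z / (2 u_z²)`. -/
def muVec (B : LinearMap.BilinForm ℝ V) (g₀ : V ≃ₗ[ℝ] (Fin p → ℝ) × (Fin n → ℝ))
    (g : V ≃ₗ[ℝ] V) (u u' : V) : V :=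
  -u' + (2 * B (posProj g₀ g u) (posProj g₀ g u))⁻¹ • posProj g₀ g u
    + (2 * B (negProj g₀ g u) (negProj g₀ g u))⁻¹ • negProj g₀ g u

/-- The sublattice `M` of `L` orthogonal to `u` and `u'`. -/
def subLattice (B : LinearMap.BilinForm ℝ V) (L : Submodule ℤ V) (u u' : V) : Submodule ℤ V where
  carrier := {x | x ∈ L ∧ B x u = 0 ∧ B x u' = 0}
  zero_mem' := ⟨L.zero_mem, by simp, by simp⟩
  add_mem' := by
    rintro a b ⟨ha, ha1, ha2⟩ ⟨hb, hb1, hb2⟩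
    exact ⟨L.add_mem ha hb, by simp [ha1, hb1], by simp [ha2, hb2]⟩
  smul_mem' := by
    rintro c x ⟨hx, hx1, hx2⟩
    exact ⟨L.smul_mem c hx, by simp [hx1], by simp [hx2]⟩

/-! ### Jacobi theta functions -/

/-- The Jacobi theta function of the lattice `Λ` with index `η`, as a function of
`(τ, z) ∈ ℍ × ℂ` with values in `ℂ[D_Λ]`. Here `πp`, `πn` are the projections to the positive and
negative definite subspaces attached to the map `g`, `m` is the dimension of the negative definite
one, and `P` is evaluated in the coordinates given by `g₀`. -/
def theta (B : LinearMap.BilinForm ℝ V) (Λ : Submodule ℤ V)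
    (g₀ : V ≃ₗ[ℝ] (Fin p → ℝ) × (Fin n → ℝ)) (g πp πn : V →ₗ[ℝ] V) (m : ℕ)
    (P : MvPolynomial (Fin p) ℂ) (η : V) (τ : ℍ) (z : ℂ) (α β : V) : Disc B Λ → ℂ :=
  fun σ =>
    ((τ.im ^ ((m : ℝ) / 2) : ℝ) : ℂ)
      * Real.exp (4 * Real.pi * quad B (πn η) * z.im ^ 2 / τ.im)
      * ∑' l : {x : V // InClass B Λ σ x},
          evalReal (heatPoly τ.im P) (g₀ (g (l.1 + (z.im / τ.im) • η + β))).1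
          * e ((quad B (πp (l.1 + β)) : ℂ) * τ
              + (quad B (πn (l.1 + β)) : ℂ) * (starRingEnd ℂ) (τ : ℂ)
              + z * (B (l.1 + β) (πp η) : ℂ)
              + (starRingEnd ℂ) z * (B (l.1 + β) (πn η) : ℂ)
              - (B (l.1 + (1 / 2 : ℝ) • β) α : ℂ))

/-- `Θ_{L,η}(τ, z, α, β, g, P)` for an isometry `g` of `V = L ⊗ ℝ`, of signature `(p, n)`. -/
def thetaL (B : LinearMap.BilinForm ℝ V) (L : Submodule ℤ V)
    (g₀ : V ≃ₗ[ℝ] (Fin p → ℝ) × (Fin n → ℝ)) (g : V ≃ₗ[ℝ] V)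
    (P : MvPolynomial (Fin p) ℂ) (η : V) (τ : ℍ) (z : ℂ) (α β : V) : Disc B L → ℂ :=
  theta B L g₀ g.toLinearMap (posProj g₀ g) (negProj g₀ g) n P η τ z α β

/-- `Θ_{M,η}(τ, z, α, β, g_M, P)` for the sublattice `M` orthogonal to `u` and `u'`,
of signature `(p - 1, n - 1)`. -/
def thetaM (B : LinearMap.BilinForm ℝ V) (L : Submodule ℤ V)
    (g₀ : V ≃ₗ[ℝ] (Fin p → ℝ) × (Fin n → ℝ)) (g : V ≃ₗ[ℝ] V) (u u' : V)
    (P : MvPolynomial (Fin p) ℂ) (η : V) (τ : ℍ) (z : ℂ) (α β : V) :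
    Disc B (subLattice B L u u') → ℂ :=
  theta B (subLattice B L u u') g₀ (subIsometry B g₀ g u)
    (wPosProj B g₀ g u) (wNegProj B g₀ g u) (n - 1) P η τ z α β

/-- The product `v ⊗ ∑_t 𝔢_{tu}(-kt)` of `v = ∑_σ v_σ 𝔢_σ ∈ ℂ[D_M]` in `ℂ[D_L]`, that is,
`∑_σ v_σ ∑_t e(-kt) 𝔢_{σ+tu}`, where `σ` runs over `D_M` and `t` over the elements of `ℝ/ℤ` with
`σ + tu ∈ L'`. If `σ ∈ L'` and `(u, L) = Nℤ`, these `t` are the `m / N`, `m ∈ ℤ/Nℤ`. -/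
def inflate (B : LinearMap.BilinForm ℝ V) (L M : Submodule ℤ V) (u : V) (k : ℤ)
    (v : Disc B M → ℂ) : Disc B L → ℂ :=
  fun δ => ∑ᶠ (σ : Disc B M) (t : ℝ)
    (_ : t ∈ Set.Ico (0 : ℝ) 1 ∧ InClass B L δ (repr B M σ + t • u)),
      v σ * e (-(k * t))

/-- The subgroup `Γ_∞ = {(1 n; 0 1)}` of `SL₂(ℤ)`. -/
def GammaInfty : Subgroup SL(2, ℤ) := Subgroup.zpowers ModularGroup.T

/-- The summand of the Poincaré series for `γ = (a b; c d)` and `k ≥ 1` (without the factor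
`1 / √(2 u_{z^⊥}²)`); here `deg` is the degree of `P`, and `γz = z / (cτ + d)`. -/
def poincareSummand (B : LinearMap.BilinForm ℝ V) (L : Submodule ℤ V)
    (g₀ : V ≃ₗ[ℝ] (Fin p → ℝ) × (Fin n → ℝ)) (g : V ≃ₗ[ℝ] V) (u u' : V) (deg : ℕ)
    (P : MvPolynomial (Fin p) ℂ) (η : V) (τ : ℍ) (z : ℂ) (γ : SL(2, ℤ)) (k : ℕ) :
    Disc B L → ℂ :=
  ∑ h ∈ Finset.range (deg + 1),
    (e (-((quad B η : ℂ) * ((γ 1 0 : ℤ) : ℂ) * z ^ 2 / autFactor γ τ))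
      * ((k : ℂ) ^ h * autFactor γ τ ^ (-(deg : ℂ) + ((n : ℂ) - (p : ℂ)) / 2)
          / (-2 * Complex.I * ((γ • τ).im : ℂ)) ^ h)
      * e (-(((k : ℂ) ^ 2
              + 4 * Complex.I * k * ((z / autFactor γ τ).im : ℂ) * (B η (posProj g₀ g u) : ℂ))
            / (4 * Complex.I * ((γ • τ).im : ℂ)
                * (B (posProj g₀ g u) (posProj g₀ g u) : ℂ))))) •
      weilRep B L p n (Mp2Z.stdLift γ)⁻¹
        (inflate B L (subLattice B L u u') u k
          (thetaM B L g₀ g u u' (subIsometryPoly g₀ g u P h) η (γ • τ) (z / autFactor γ τ)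
            ((k : ℝ) • muVec B g₀ g u u') 0))

end Lattice

end JacobiTheta

end

noncomputable section

namespace JacobiTheta

open UpperHalfPlane

/-! ### Exponential sums over lattices -/

section Summability

variable {E : Type*} [NormedAddCommGroup E] [NormedSpace ℝ E] [FiniteDimensional ℝ E]

/-! Regard Θ_L(τ₁, τ₂, ru, su) as a function of (r, s) ∈ ℝ². Since u is isotropic and orthogonal to
η, Poisson summation along the lines x + ℤu of lattice points turns it into a Fourier series ∑ e(-rc
+ sd) A_{(c,d)}(τ₁, τ₂), where c = (x, u) and d is dual to the position on the line
(`hasSum_dualCoeff`). The theta function transforms under Mp₂(ℤ) through ρ_L, with the group acting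
linearly on (α, β). Coefficients of absolutely convergent Fourier series are unique, so a modular
substitution in (τ₁, τ₂) permutes the A_m up to an automorphy factor and ρ_L (`dualCoeff_smul`).
Every nonzero integral point is (kc, -kd) for exactly one k ≥ 1 and one coset of Γ_∞ in SL₂(ℤ), with
(c, d) the bottom row of that coset (`bijective_bottomRowPoint`). Hence all coefficients with m ≠ 0
come from the A_{(0,-k)}. Only vectors orthogonal to u enter those, and their terms are the terms of
the theta function of M (`dualCoeff_eq_inflate`). At r = s = 0 this is the theorem, and A_0 is the
summand outside the Poincaré series.

The transformation law is checked on the generators S and T; for S it is Poisson summation of a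
Gaussian over L. Polynomials are handled by generating functions. Homogeneous polynomials are
spanned by powers of linear forms, and exp(-Δ/8πy) sends ⟨w, x⟩^k to k! times the coefficient of t^k
in exp(-⟨w, w⟩t²/8πy + t⟨w, x⟩). So both uses of Poisson summation are carried out for Gaussians
with an additional linear term in t, and Taylor coefficients in t are compared
(`tsum_hermiteCoeff_eq`).

The existence of ρ_L is also proved by theta functions. Their values are killed by no nonzero
endomorphism, so every relation between S and T in Mp₂(ℤ) holds for the matrices through which the
theta functions transform (`exists_rep_of_transforms`). -/

theorem summable_exp_neg_norm_span {ι : Type*} [Finite ι] (b : Module.Basis ι ℝ E)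
    {a : ℝ} (ha : 0 < a) :
    Summable fun x : Submodule.span ℤ (Set.range b) => Real.exp (-a * ‖(x : E)‖) := by
  have : Fintype ι := Fintype.ofFinite ι
  set L := Submodule.span ℤ (Set.range b)
  set N : ℕ := Module.finrank ℤ L + 1
  have h1 : Summable fun z : L => ‖z‖ ^ (-(N : ℝ)) :=
    ZLattice.summable_norm_rpow L _ (by simp [N])
  refine Summable.of_norm_bounded_eventually (h1.mul_left ((N.factorial : ℝ) / a ^ N)) ?_
  -- The comparison with an inverse power of the norm can fail only at the zero vector. The power is
  -- the rank plus one, which makes the comparison series converge.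
  refine (Set.finite_singleton (0 : L)).subset ?_
  intro t ht
  by_contra h0
  apply ht
  have hpos : 0 < ‖t‖ := norm_pos_iff.mpr h0
  have h2 := Real.pow_div_factorial_le_exp (a * ‖t‖) (by positivity) N
  have hN : (0 : ℝ) < N.factorial := by positivity
  change ‖Real.exp (-a * ‖t‖)‖ ≤ N.factorial / a ^ N * ‖t‖ ^ (-(N : ℝ))
  rw [Real.norm_eq_abs, Real.abs_exp, Real.rpow_neg hpos.le, Real.rpow_natCast, neg_mul,
    Real.exp_neg]
  calc (Real.exp (a * ‖t‖))⁻¹ ≤ ((a * ‖t‖) ^ N / N.factorial)⁻¹ :=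
        inv_anti₀ (by positivity) h2
    _ = _ := by rw [mul_pow]; field_simp

theorem summable_exp_neg_norm_int (ι : Type*) [Fintype ι] {a : ℝ} (ha : 0 < a) :
    Summable fun k : ι → ℤ => Real.exp (-a * ‖fun i => (k i : ℝ)‖) := by
  have h := summable_exp_neg_norm_span (Pi.basisFun ℝ ι) ha
  have hmem : ∀ k : ι → ℤ, (fun i => (k i : ℝ)) ∈
      Submodule.span ℤ (Set.range (Pi.basisFun ℝ ι)) := by
    intro k
    have : (fun i => (k i : ℝ)) = ∑ i, k i • (Pi.basisFun ℝ ι i) := by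
      classical
      ext j
      simp [Finset.sum_apply, Pi.single_apply]
    rw [this]
    exact Submodule.sum_mem _ fun i _ => Submodule.smul_mem _ _ (Submodule.subset_span ⟨i, rfl⟩)
  have hf : Function.Injective fun k : ι → ℤ =>
      (⟨_, hmem k⟩ : Submodule.span ℤ (Set.range (Pi.basisFun ℝ ι))) := by
    intro k l hkl
    ext i
    have := congrFun (Subtype.mk.inj hkl) i
    exact_mod_cast this
  simpa only [Function.comp_def] using h.comp_injective hf

/-- A Gaussian beats an exponential. -/
theorem exists_gaussian_le_exp {ε : ℝ} (hε : 0 < ε) (K : ℝ) :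
    ∃ C : ℝ, 0 < C ∧ ∀ r : ℝ, Real.exp (-ε * r ^ 2 + K * r) ≤ C * Real.exp (-r) := by
  -- The constant is the exponential of the maximum of -εr² + (K + 1)r, found by completing the
  -- square.
  refine ⟨Real.exp ((K + 1) ^ 2 / (4 * ε)), Real.exp_pos _, fun r => ?_⟩
  rw [← Real.exp_add]
  apply Real.exp_le_exp.mpr
  have : (K + 1) ^ 2 / (4 * ε) - (-ε * r ^ 2 + (K + 1) * r)
      = (K + 1 - 2 * ε * r) ^ 2 / (4 * ε) := by
    field_simp; ring
  have h2 : 0 ≤ (K + 1 - 2 * ε * r) ^ 2 / (4 * ε) := by positivity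
  linarith

/-- Gaussians times exponentials are summable over translates of lattices, in terms of any
injective linear parametrization. -/
theorem summable_gaussian_span {V ι : Type*} [AddCommGroup V] [Module ℝ V] [Finite ι]
    (b : Module.Basis ι ℝ V) (Φ : V →ₗ[ℝ] E) (hΦ : Function.Injective Φ) (v : E)
    {ε : ℝ} (hε : 0 < ε) (K : ℝ) :
    Summable fun x : Submodule.span ℤ (Set.range b) =>
      Real.exp (-ε * ‖Φ x + v‖ ^ 2 + K * ‖Φ x + v‖) := by
  have : Fintype ι := Fintype.ofFinite ι
  obtain ⟨C, hC, hCe⟩ := exists_gaussian_le_exp hε K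
  -- restrict to the range of `Φ`
  let F : Submodule ℝ E := LinearMap.range Φ
  let e : V ≃ₗ[ℝ] F := LinearEquiv.ofInjective Φ hΦ
  have h1 := summable_exp_neg_norm_span (b.map e) one_pos
  let f : Submodule.span ℤ (Set.range b) → Submodule.span ℤ (Set.range (b.map e)) := fun x =>
    ⟨e x, by
      have hx := x.2
      have : Submodule.span ℤ (Set.range (b.map e))
          = (Submodule.span ℤ (Set.range b)).map (e.toLinearMap.restrictScalars ℤ) := by
        rw [Submodule.map_span, ← Set.range_comp]
        rfl
      rw [this]
      exact ⟨x, hx, rfl⟩⟩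
  have hf : Function.Injective f := fun x y hxy => by
    have := congrArg Subtype.val hxy
    exact Subtype.ext (e.injective this)
  refine Summable.of_nonneg_of_le (fun _ => (Real.exp_pos _).le) (fun x => ?_)
    ((h1.comp_injective hf).mul_left (C * Real.exp ‖v‖))
  refine (hCe _).trans ?_
  rw [mul_assoc]
  refine mul_le_mul_of_nonneg_left ?_ hC.le
  rw [Function.comp_apply, ← Real.exp_add]
  apply Real.exp_le_exp.mpr
  have h3 : ‖((f x : F))‖ = ‖Φ x‖ := rfl
  rw [h3]
  have h2 := norm_sub_norm_le (Φ x) (-v)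
  rw [sub_neg_eq_add, norm_neg] at h2
  linarith

end Summability

/-! ### Fourier series on tori -/

section Torus

open MeasureTheory

/-- The normalized measure on the circle. -/
@[reducible] def circleMeasureSpace : MeasureSpace UnitAddCircle := ⟨AddCircle.haarAddCircle⟩

attribute [local instance] circleMeasureSpace

theorem circle_isProb : IsProbabilityMeasure (volume : Measure UnitAddCircle) :=
  inferInstanceAs (IsProbabilityMeasure AddCircle.haarAddCircle)

attribute [local instance] circle_isProb

variable {ι : Type*} [Fintype ι]

theorem mFourier_coe (m : ι → ℤ) (x : ι → ℝ) :
    UnitAddTorus.mFourier m (fun i => (x i : UnitAddCircle))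
      = Complex.exp (2 * Real.pi * Complex.I * ∑ i, (m i : ℂ) * x i) := by
  simp only [UnitAddTorus.mFourier, ContinuousMap.coe_mk, fourier_coe_apply, Finset.mul_sum,
    Complex.exp_sum]
  refine Finset.prod_congr rfl fun i _ => ?_
  congr 1
  push_cast
  ring

/-- The coefficients of an absolutely convergent multiple Fourier series are determined by its
values. -/
theorem fourier_series_unique {a b : (ι → ℤ) → ℂ} (ha : Summable fun m => ‖a m‖)
    (hb : Summable fun m => ‖b m‖)
    (h : ∀ x : ι → ℝ, ∑' m, a m * Complex.exp (2 * Real.pi * Complex.I * ∑ i, (m i : ℂ) * x i)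
      = ∑' m, b m * Complex.exp (2 * Real.pi * Complex.I * ∑ i, (m i : ℂ) * x i)) : a = b := by
  have key : ∀ c : (ι → ℤ) → ℂ, Summable (fun m => ‖c m‖) →
      Summable (fun m => c m • (UnitAddTorus.mFourier m : C(UnitAddTorus ι, ℂ))) := by
    intro c hc
    refine Summable.of_norm ?_
    simpa only [norm_smul, UnitAddTorus.mFourier_norm, mul_one] using hc
  have hab : (∑' m, a m • (UnitAddTorus.mFourier m : C(UnitAddTorus ι, ℂ)))
      = ∑' m, b m • (UnitAddTorus.mFourier m : C(UnitAddTorus ι, ℂ)) := by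
    ext x
    have hx : ∃ y : ι → ℝ, (fun i => (y i : UnitAddCircle)) = x := by
      choose y hy using fun i => QuotientAddGroup.mk_surjective (x i)
      exact ⟨y, funext hy⟩
    obtain ⟨y, rfl⟩ := hx
    have e1 := ((ContinuousMap.evalCLM ℂ (fun i => (y i : UnitAddCircle))).hasSum
      (key a ha).hasSum).tsum_eq
    have e2 := ((ContinuousMap.evalCLM ℂ (fun i => (y i : UnitAddCircle))).hasSum
      (key b hb).hasSum).tsum_eq
    have e3 := h y
    simp only [← mFourier_coe] at e3
    change ∑' m, a m • UnitAddTorus.mFourier m (fun i => (y i : UnitAddCircle)) = _ at e1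
    change ∑' m, b m • UnitAddTorus.mFourier m (fun i => (y i : UnitAddCircle)) = _ at e2
    simp only [smul_eq_mul] at e1 e2
    rw [e1, e2] at e3
    exact e3
  -- The series converges uniformly, hence in L², so pairing with the n-th vector of the orthonormal
  -- system of characters isolates the n-th coefficient.
  have coeff : ∀ c : (ι → ℤ) → ℂ, Summable (fun m => ‖c m‖) → ∀ n,
      inner ℂ (UnitAddTorus.mFourierLp 2 n) (ContinuousMap.toLp (E := ℂ) 2 volume ℂ
        (∑' m, c m • (UnitAddTorus.mFourier m : C(UnitAddTorus ι, ℂ)))) = c n := by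
    intro c hc n
    have h1 := (innerSL ℂ (UnitAddTorus.mFourierLp (d := ι) 2 n)).hasSum
      ((ContinuousMap.toLp (E := ℂ) 2 (volume : Measure (UnitAddTorus ι)) ℂ).hasSum
        (key c hc).hasSum)
    have h2 : HasSum (fun m => if m = n then c m else 0) (c n) := hasSum_ite_eq n (c n) |>.congr_fun
      (fun m => by by_cases hm : m = n <;> simp [hm])
    refine h1.unique (h2.congr_fun fun m => ?_)
    have h3 := orthonormal_iff_ite.mp (UnitAddTorus.orthonormal_mFourier (d := ι)) n m
    simp only [innerSL_apply_apply, map_smul, h3, smul_eq_mul]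
    by_cases hm : m = n
    · simp [hm]
    · simp [hm, Ne.symm hm]
  funext n
  rw [← coeff a ha n, ← coeff b hb n, hab]


/-- The integral of an integrable function as a sum of integrals over the unit cube. -/
theorem hasSum_integral_unit_cube {h : (ι → ℝ) → ℂ} (hh : Integrable h) :
    HasSum (fun k : ι → ℤ => ∫ x in {x : ι → ℝ | ∀ i, x i ∈ Set.Ioc (0 : ℝ) (0 + 1)},
      h (x + fun i => (k i : ℝ))) (∫ x, h x) := by
  let S : (ι → ℤ) → Set (ι → ℝ) := fun k => {x | ∀ i, x i ∈ Set.Ioc (k i : ℝ) (k i + 1)}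
  have hS : ∀ k, MeasurableSet (S k) := fun k =>
    MeasurableSet.univ_pi' fun i => measurableSet_Ioc
  have hd : Pairwise (Function.onFun Disjoint S) := by
    intro k l hkl
    refine Set.disjoint_left.mpr fun x hx hy => hkl ?_
    ext i
    have h1 := hx i
    have h2 := hy i
    have e1 : ⌈x i⌉ = k i + 1 := by
      rw [Int.ceil_eq_iff]; push_cast; constructor <;> linarith [h1.1, h1.2]
    have e2 : ⌈x i⌉ = l i + 1 := by
      rw [Int.ceil_eq_iff]; push_cast; constructor <;> linarith [h2.1, h2.2]
    omega
  have hU : (⋃ k, S k) = Set.univ := by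
    refine Set.eq_univ_of_forall fun x => Set.mem_iUnion.mpr ⟨fun i => ⌈x i⌉ - 1, fun i => ?_⟩
    push_cast
    constructor
    · linarith [Int.ceil_lt_add_one (x i)]
    · linarith [Int.le_ceil (x i)]
  have := hasSum_integral_iUnion hS hd (f := h) (μ := volume) (by rw [hU]; exact hh.integrableOn)
  rw [hU, setIntegral_univ] at this
  refine this.congr_fun fun k => ?_
  have e1 := (measurePreserving_add_right (volume : Measure (ι → ℝ))
    (fun i => (k i : ℝ))).setIntegral_preimage_emb
      (MeasurableEquiv.addRight _).measurableEmbedding h (S k)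
  rw [← e1]
  congr 1
  congr 1
  ext x
  simp only [S, Set.mem_preimage, Set.mem_ofPred_eq, Pi.add_apply, Set.mem_Ioc]
  refine forall_congr' fun i => ?_
  constructor <;> rintro ⟨h1, h2⟩ <;> constructor <;> linarith

/-- Poisson summation for continuous functions of exponential decay. -/
theorem poisson_summation_int {f : (ι → ℝ) → ℂ} (hf : Continuous f) {C a : ℝ} (ha : 0 < a)
    (hC : ∀ x, ‖f x‖ ≤ C * Real.exp (-a * ‖x‖)) (hfi : Integrable f)
    (hs : Summable fun m : ι → ℤ =>
      ∫ x : ι → ℝ, Complex.exp (-(2 * Real.pi * Complex.I * ∑ i, (m i : ℂ) * x i)) * f x) :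
    ∑' k : ι → ℤ, f (fun i => (k i : ℝ))
      = ∑' m : ι → ℤ,
        ∫ x : ι → ℝ, Complex.exp (-(2 * Real.pi * Complex.I * ∑ i, (m i : ℂ) * x i)) * f x := by
  have hC0 : 0 ≤ C := by
    have := (norm_nonneg _).trans (hC 0)
    simpa using this
  let c : (ι → ℤ) → ι → ℝ := fun k i => (k i : ℝ)
  have hsum := summable_exp_neg_norm_int ι ha
  have hbound : ∀ R : ℝ, ∀ x : ι → ℝ, ‖x‖ ≤ R → ∀ k,
      ‖f (x + c k)‖ ≤ C * Real.exp (a * R) * Real.exp (-a * ‖c k‖) := by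
    intro R x hx k
    refine (hC _).trans ?_
    rw [mul_assoc, ← Real.exp_add]
    refine mul_le_mul_of_nonneg_left (Real.exp_le_exp.mpr ?_) hC0
    have h2 := norm_sub_norm_le (c k) (-x)
    rw [sub_neg_eq_add, norm_neg, add_comm (c k)] at h2
    nlinarith
  have hsx : ∀ x, Summable fun k => f (x + c k) := fun x =>
    Summable.of_norm_bounded (hsum.mul_left _) (hbound _ x le_rfl)
  let F : (ι → ℝ) → ℂ := fun x => ∑' k, f (x + c k)
  -- The translates are bounded by a common summable sequence on each ball, so the periodization is
  -- a locally uniform limit.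
  have hF : Continuous F := by
    rw [continuous_iff_continuousAt]
    intro x
    have h1 : ContinuousOn F (Metric.ball 0 (‖x‖ + 1)) :=
      continuousOn_tsum (fun k => (hf.comp (continuous_id.add continuous_const)).continuousOn)
        (hsum.mul_left (C * Real.exp (a * (‖x‖ + 1))))
        (fun k y hy => hbound _ y (by simpa using (Metric.mem_ball.mp hy).le) k)
    exact h1.continuousAt (Metric.isOpen_ball.mem_nhds (by simp))
  have hper : ∀ x (k : ι → ℤ), F (x + c k) = F x := by
    intro x k
    change ∑' l, f (x + c k + c l) = ∑' l, f (x + c l)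
    rw [← (Equiv.addLeft k).tsum_eq (fun l => f (x + c l))]
    refine tsum_congr fun l => ?_
    congr 1
    ext i
    simp [c, add_assoc]
  let q : (ι → ℝ) → UnitAddTorus ι := fun x i => (x i : UnitAddCircle)
  have hq : IsOpenQuotientMap q :=
    IsOpenQuotientMap.piMap (f := fun (_ : ι) (t : ℝ) => (t : UnitAddCircle))
      fun _ => QuotientAddGroup.isOpenQuotientMap_mk
  have hqF : ∀ x y, q x = q y → F x = F y := by
    intro x y hxy
    have h1 : ∀ i, ∃ m : ℤ, x i = y i + m := by
      intro i
      have h2 := congrFun hxy i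
      obtain ⟨m, hm⟩ := (QuotientAddGroup.eq_iff_sub_mem.mp h2)
      refine ⟨m, ?_⟩
      simp only [zsmul_eq_mul, mul_one] at hm
      linarith
    choose m hm using h1
    have : x = y + c m := by ext i; simp [c, hm i]
    rw [this, hper]
  let qc : C(ι → ℝ, UnitAddTorus ι) := ⟨q, hq.continuous⟩
  have hqc : Topology.IsQuotientMap qc := hq.isQuotientMap
  let G : C(UnitAddTorus ι, ℂ) := hqc.lift ⟨F, hF⟩ (fun x y h => hqF x y h)
  have hG : ∀ x, G (q x) = F x := fun x =>
    ContinuousMap.congr_fun (hqc.lift_comp ⟨F, hF⟩ (fun x y h => hqF x y h)) x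
  -- Unfolding: the character is invariant under integral translations, so the cube integral of the
  -- periodization is a sum of integrals over all translated cubes, that is, the integral over the
  -- whole space.
  have hcoeff : ∀ m : ι → ℤ, UnitAddTorus.mFourierCoeff G m
      = ∫ x : ι → ℝ, Complex.exp (-(2 * Real.pi * Complex.I * ∑ i, (m i : ℂ) * x i)) * f x := by
    intro m
    rw [UnitAddTorus.mFourierCoeff_eq_integral G m 0]
    let ch : (ι → ℝ) → ℂ := fun x =>
      Complex.exp (-(2 * Real.pi * Complex.I * ∑ i, (m i : ℂ) * x i))
    have hch : Continuous ch := by fun_prop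
    have hch1 : ∀ x, ‖ch x‖ = 1 := by
      intro x
      have : -(2 * Real.pi * Complex.I * ∑ i, (m i : ℂ) * x i)
          = ((-(2 * Real.pi * ∑ i, (m i : ℝ) * x i) : ℝ) : ℂ) * Complex.I := by
        push_cast; ring
      simp only [ch, this, Complex.norm_exp_ofReal_mul_I]
    have hchp : ∀ x k, ch (x + c k) = ch x := by
      intro x k
      simp only [ch]
      rw [Complex.exp_eq_exp_iff_exists_int]
      refine ⟨-∑ i, m i * k i, ?_⟩
      simp only [c, Pi.add_apply, Complex.ofReal_add, mul_add, Finset.sum_add_distrib,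
        Complex.ofReal_intCast]
      push_cast
      ring
    have hint : Integrable (fun x => ch x * f x) :=
      hfi.bdd_mul (c := 1) hch.aestronglyMeasurable (Filter.Eventually.of_forall fun x => (hch1 x).le)
    have h1 := (hasSum_integral_unit_cube hint).tsum_eq
    change _ = ∫ x, ch x * f x
    rw [← h1]
    have hvol : volume {x : ι → ℝ | ∀ i, x i ∈ Set.Ioc (0 : ℝ) (0 + 1)} < ⊤ := by
      have : {x : ι → ℝ | ∀ i, x i ∈ Set.Ioc (0 : ℝ) (0 + 1)}
          = Set.univ.pi fun _ => Set.Ioc (0 : ℝ) (0 + 1) := by ext; simp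
      rw [this, Real.volume_pi_Ioc]
      exact ENNReal.prod_lt_top fun i _ => ENNReal.ofReal_lt_top
    have hmeas : MeasurableSet {x : ι → ℝ | ∀ i, x i ∈ Set.Ioc (0 : ℝ) (0 + 1)} :=
      MeasurableSet.univ_pi' fun i => measurableSet_Ioc
    have hcube : ∀ x ∈ {x : ι → ℝ | ∀ i, x i ∈ Set.Ioc (0 : ℝ) (0 + 1)}, ‖x‖ ≤ 1 := by
      intro x hx
      refine (pi_norm_le_iff_of_nonneg zero_le_one).mpr fun i => ?_
      have := hx i
      rw [Real.norm_eq_abs, abs_le]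
      constructor <;> linarith [this.1, this.2]
    have hb : ∀ k, ∀ x ∈ {x : ι → ℝ | ∀ i, x i ∈ Set.Ioc (0 : ℝ) (0 + 1)},
        ‖ch (x + c k) * f (x + c k)‖ ≤ C * Real.exp (a * 1) * Real.exp (-a * ‖c k‖) := by
      intro k x hx
      rw [norm_mul, hch1, one_mul]
      exact hbound 1 x (hcube x hx) k
    have hii : ∀ k, IntegrableOn (fun x => ch (x + c k) * f (x + c k))
        {x : ι → ℝ | ∀ i, x i ∈ Set.Ioc (0 : ℝ) (0 + 1)} := fun k =>
      (hint.comp_add_right (c k)).integrableOn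
    refine Eq.trans ?_ (integral_tsum_of_summable_integral_norm hii ?_).symm
    · refine setIntegral_congr_fun hmeas fun x _ => ?_
      simp only [hchp]
      rw [tsum_mul_left]
      change UnitAddTorus.mFourier (-m) (q x) • G (q x) = ch x * F x
      rw [hG, smul_eq_mul]
      congr 1
      rw [mFourier_coe]
      simp [ch, Finset.sum_neg_distrib]
    · refine Summable.of_nonneg_of_le (fun k => integral_nonneg fun x => norm_nonneg _)
        (fun k => ?_) ((hsum.mul_left (C * Real.exp (a * 1))).mul_right
          (volume.real {x : ι → ℝ | ∀ i, x i ∈ Set.Ioc (0 : ℝ) (0 + 1)}))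
      have h2 := norm_setIntegral_le_of_norm_le_const (μ := volume)
        (f := fun x => (‖ch (x + c k) * f (x + c k)‖ : ℝ)) hvol
        (fun x hx => by rw [norm_norm]; exact hb k x hx)
      exact (le_abs_self _).trans h2
  -- Summable coefficients make the Fourier series converge to the periodization at every point; the
  -- formula is its value at 0.
  have h1 := UnitAddTorus.hasSum_mFourier_series_apply_of_summable (f := G)
    (hs.congr fun m => (hcoeff m).symm) (q 0)
  rw [hG] at h1
  have h2 := h1.tsum_eq
  have h3 : F 0 = ∑' k : ι → ℤ, f (fun i => (k i : ℝ)) := by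
    simp only [F, zero_add, c]
  rw [← h3, ← h2]
  refine tsum_congr fun m => ?_
  rw [← hcoeff, mFourier_coe]
  simp

end Torus
end JacobiTheta
end

noncomputable section

namespace JacobiTheta

open UpperHalfPlane

/-! ### Hermite coefficients -/

section Hermite

open Finset

/-- A power series is determined by its values on the unit disc. -/
theorem power_series_unique {a b : ℕ → ℂ} {Ca Cb : ℝ} (ha : ∀ k, ‖a k‖ ≤ Ca)
    (hb : ∀ k, ‖b k‖ ≤ Cb)
    (h : ∀ t : ℂ, ‖t‖ < 1 → ∑' k, a k * t ^ k = ∑' k, b k * t ^ k) : a = b := by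
  have key : ∀ (c : ℕ → ℂ) (C : ℝ), (∀ k, ‖c k‖ ≤ C) →
      HasFPowerSeriesOnBall (fun t => ∑' k, c k * t ^ k)
        (FormalMultilinearSeries.ofScalars ℂ c) 0 1 := by
    intro c C hc
    -- Bounded coefficients give radius of convergence at least 1.
    refine ⟨?_, one_pos, fun {y} hy => ?_⟩
    · rw [← ENNReal.coe_one]
      refine FormalMultilinearSeries.le_radius_of_bound _ C fun n => ?_
      rw [FormalMultilinearSeries.ofScalars_norm]
      simpa using hc n
    · have hy' : ‖y‖ < 1 := by
        have : edist y 0 < 1 := hy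
        rw [edist_zero_right, ← ofReal_norm, ENNReal.ofReal_lt_one] at this
        exact this
      have hs : Summable fun k => c k * y ^ k := by
        refine Summable.of_norm_bounded ((summable_geometric_of_lt_one (norm_nonneg y) hy').mul_left C)
          fun k => ?_
        rw [norm_mul, norm_pow]
        exact mul_le_mul_of_nonneg_right (hc k) (by positivity)
      simp only [zero_add, FormalMultilinearSeries.ofScalars_apply_eq, smul_eq_mul]
      exact hs.hasSum
  have h1 := (key a Ca ha).hasFPowerSeriesAt
  have h2 := (key b Cb hb).hasFPowerSeriesAt
  have h3 : FormalMultilinearSeries.ofScalars ℂ a = FormalMultilinearSeries.ofScalars ℂ b := by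
    refine h1.eq_formalMultilinearSeries_of_eventually h2 ?_
    filter_upwards [Metric.ball_mem_nhds (0 : ℂ) one_pos] with t ht
    exact h t (by simpa using ht)
  exact FormalMultilinearSeries.ofScalars_series_injective ℂ ℂ h3

/-- The coefficient of `t ^ i` in `exp (-a t²)`. -/
def gaussCoeff (a : ℂ) (i : ℕ) : ℂ :=
  if Even i then (-a) ^ (i / 2) / (i / 2).factorial else 0

/-- The coefficient of `t ^ k` in `exp (-a t² + s t)`. -/
def hermiteCoeff (k : ℕ) (a s : ℂ) : ℂ :=
  ∑ ij ∈ antidiagonal k, gaussCoeff a ij.1 * (s ^ ij.2 / ij.2.factorial)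

theorem hasSum_gaussCoeff (a : ℂ) : HasSum (gaussCoeff a) (Complex.exp (-a)) := by
  have hinj : Function.Injective fun m : ℕ => 2 * m := fun x y h => by simpa using h
  rw [← hinj.hasSum_iff]
  · have := NormedSpace.expSeries_div_hasSum_exp (-a)
    rw [← Complex.exp_eq_exp_ℂ] at this
    refine this.congr_fun fun m => ?_
    simp [gaussCoeff]
  · intro i hi
    rw [gaussCoeff, if_neg]
    rintro ⟨m, rfl⟩
    exact hi ⟨m, by ring⟩

/-- With -‖a‖ in place of a all coefficients are nonnegative, so a sum of norms is again a value of
the exponential series. -/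
theorem norm_gaussCoeff (a : ℂ) (i : ℕ) : ‖gaussCoeff a i‖ = ‖gaussCoeff (-‖a‖ : ℂ) i‖ := by
  rw [gaussCoeff, gaussCoeff]
  split_ifs <;> simp

theorem summable_norm_gaussCoeff (a : ℂ) : Summable fun i => ‖gaussCoeff a i‖ := by
  simp_rw [norm_gaussCoeff a]
  have := (hasSum_gaussCoeff (-‖a‖ : ℂ)).summable.norm
  exact this

theorem tsum_norm_gaussCoeff (a : ℂ) : ∑' i, ‖gaussCoeff a i‖ = Real.exp ‖a‖ := by
  have h1 := hasSum_gaussCoeff (-‖a‖ : ℂ)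
  have h2 : HasSum (fun i => (‖gaussCoeff a i‖ : ℂ)) ((Real.exp ‖a‖ : ℝ) : ℂ) := by
    rw [Complex.ofReal_exp]
    convert! h1 using 2 with i
    · rw [norm_gaussCoeff, gaussCoeff]
      split_ifs <;> simp
    · simp
  exact (Complex.hasSum_ofReal.mp h2).tsum_eq

/-- The bound is independent of k. This lets sums over a lattice be interchanged with the power
series in t, and bounds the Taylor coefficients of such sums. -/
theorem norm_hermiteCoeff_le (k : ℕ) (a s : ℂ) :
    ‖hermiteCoeff k a s‖ ≤ Real.exp (‖a‖ + ‖s‖) := by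
  have h1 := summable_norm_gaussCoeff a
  have h2 : Summable fun j : ℕ => ‖s ^ j / (j.factorial : ℂ)‖ := by
    simpa using Real.summable_pow_div_factorial ‖s‖
  have h3 : ∑' j : ℕ, ‖s ^ j / (j.factorial : ℂ)‖ = Real.exp ‖s‖ := by
    have := (NormedSpace.expSeries_div_hasSum_exp ‖s‖).tsum_eq
    rw [← Real.exp_eq_exp_ℝ] at this
    simpa using this
  rw [Real.exp_add, ← tsum_norm_gaussCoeff, ← h3]
  have hn1 : Summable fun i => ‖(‖gaussCoeff a i‖ : ℝ)‖ := by simpa using h1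
  have hn2 : Summable fun j : ℕ => ‖(‖s ^ j / (j.factorial : ℂ)‖ : ℝ)‖ := by simpa using h2
  rw [tsum_mul_tsum_eq_tsum_sum_antidiagonal_of_summable_norm hn1 hn2]
  have h4 := (summable_norm_sum_mul_antidiagonal_of_summable_norm hn1 hn2)
  have h5 : Summable fun n => ∑ kl ∈ antidiagonal n, ‖gaussCoeff a kl.1‖
      * ‖s ^ kl.2 / (kl.2.factorial : ℂ)‖ := h4.of_norm
  refine le_trans ?_ (h5.le_tsum k fun n _ => Finset.sum_nonneg fun _ _ => by positivity)
  refine (norm_sum_le _ _).trans (le_of_eq ?_)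
  exact Finset.sum_congr rfl fun _ _ => norm_mul _ _

theorem gaussCoeff_mul_pow (a t : ℂ) (i : ℕ) : gaussCoeff (a * t ^ 2) i = gaussCoeff a i * t ^ i := by
  rw [gaussCoeff, gaussCoeff]
  split_ifs with h
  · obtain ⟨m, rfl⟩ := h
    have : (m + m) / 2 = m := by omega
    rw [this, neg_mul_eq_neg_mul, mul_pow, ← pow_mul]
    ring
  · simp

/-- Each product of terms in the sum has degree k in t. Taken at t = τ, this is the source of the
factor τ^k in the inversion formula. -/
theorem hermiteCoeff_scale (k : ℕ) (a s t : ℂ) :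
    hermiteCoeff k (a * t ^ 2) (s * t) = hermiteCoeff k a s * t ^ k := by
  rw [hermiteCoeff, hermiteCoeff, Finset.sum_mul]
  refine Finset.sum_congr rfl fun ij hij => ?_
  rw [gaussCoeff_mul_pow, ← mem_antidiagonal.mp hij, pow_add]
  ring

theorem hasSum_hermiteCoeff (a s t : ℂ) :
    HasSum (fun k => hermiteCoeff k a s * t ^ k) (Complex.exp (-a * t ^ 2 + s * t)) := by
  simp_rw [← hermiteCoeff_scale]
  have h1 := summable_norm_gaussCoeff (a * t ^ 2)
  have h2 : Summable fun j : ℕ => ‖(s * t) ^ j / (j.factorial : ℂ)‖ := by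
    simpa using Real.summable_pow_div_factorial (‖s‖ * ‖t‖)
  have h3 : ∑' j : ℕ, (s * t) ^ j / (j.factorial : ℂ) = Complex.exp (s * t) := by
    have := (NormedSpace.expSeries_div_hasSum_exp (s * t)).tsum_eq
    rwa [← Complex.exp_eq_exp_ℂ] at this
  rw [Complex.exp_add, neg_mul, ← (hasSum_gaussCoeff (a * t ^ 2)).tsum_eq, ← h3,
    tsum_mul_tsum_eq_tsum_sum_antidiagonal_of_summable_norm h1 h2]
  exact (summable_norm_sum_mul_antidiagonal_of_summable_norm h1 h2).of_norm.hasSum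

/-- The generating function factors as exp(-at² + st) · exp(rt). With r the part of a linear form in
the direction of u, this is the decomposition of P into its components P_{g_M,h}. -/
theorem hermiteCoeff_add (k : ℕ) (a s r : ℂ) :
    hermiteCoeff k a (s + r)
      = ∑ h ∈ range (k + 1), hermiteCoeff (k - h) a s * (r ^ h / h.factorial) := by
  have e1 : ∀ (k : ℕ) (x : ℂ), hermiteCoeff k a x = PowerSeries.coeff k
      (PowerSeries.mk (gaussCoeff a) * PowerSeries.rescale x (PowerSeries.exp ℂ)) := by
    intro k x
    rw [PowerSeries.coeff_mul, hermiteCoeff]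
    refine Finset.sum_congr rfl fun ij _ => ?_
    simp [PowerSeries.coeff_exp, div_eq_mul_inv]
  rw [e1, ← PowerSeries.exp_mul_exp_eq_exp_add, ← mul_assoc, PowerSeries.coeff_mul,
    Finset.Nat.sum_antidiagonal_swap.symm, Finset.Nat.sum_antidiagonal_eq_sum_range_succ_mk]
  refine Finset.sum_congr rfl fun h _ => ?_
  rw [e1]
  simp [PowerSeries.coeff_exp, div_eq_mul_inv]

/-- Only even powers of t come from exp(-at²). The free cutoff N matches truncations of the heat
operator of any sufficient length. -/
theorem hermiteCoeff_eq_sum (k : ℕ) (a s : ℂ) {N : ℕ} (hN : k < 2 * N) :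
    hermiteCoeff k a s = ∑ m ∈ range N, if 2 * m ≤ k then
      ((-a) ^ m / m.factorial) * (s ^ (k - 2 * m) / (k - 2 * m).factorial) else 0 := by
  rw [hermiteCoeff, Finset.Nat.sum_antidiagonal_eq_sum_range_succ_mk, ← Finset.sum_filter]
  symm
  refine Finset.sum_of_injOn (fun m => 2 * m) ?_ ?_ ?_ ?_
  · intro x _ y _ h
    simpa using h
  · intro m hm
    simp only [coe_filter, mem_range, Set.mem_ofPred_eq] at hm
    simp only [coe_range, Set.mem_Iio]
    omega
  · intro i hi hi2
    have : ¬ Even i := by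
      rintro ⟨m, rfl⟩
      refine hi2 ⟨m, ?_, by simp; ring⟩
      simp only [coe_filter, mem_range, Set.mem_ofPred_eq] at hi ⊢
      omega
    simp [gaussCoeff, this]
  · intro m _
    simp [gaussCoeff]

/-- The double series is dominated by a summable family times the geometric series in ‖t‖, by the
bound on `hermiteCoeff` that is uniform in k; so the sums may be exchanged. -/
theorem tsum_exp_eq_tsum_hermiteCoeff {X : Type*} {A s : X → ℂ} (a : ℂ)
    (h : Summable fun x => ‖A x‖ * Real.exp ‖s x‖) {t : ℂ} (ht : ‖t‖ < 1) :
    ∑' x, A x * Complex.exp (-a * t ^ 2 + s x * t)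
      = ∑' k, (∑' x, A x * hermiteCoeff k a (s x)) * t ^ k := by
  have h1 : Summable fun z : X × ℕ => A z.1 * hermiteCoeff z.2 a (s z.1) * t ^ z.2 := by
    have h2 : Summable fun z : X × ℕ => (‖A z.1‖ * Real.exp ‖s z.1‖) * ‖t‖ ^ z.2 :=
      h.mul_of_nonneg (summable_geometric_of_lt_one (norm_nonneg t) ht)
        (fun _ => by positivity) (fun _ => by positivity)
    refine Summable.of_norm_bounded (h2.mul_left (Real.exp ‖a‖)) fun z => ?_
    rw [norm_mul, norm_mul, norm_pow, ← mul_assoc]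
    refine mul_le_mul_of_nonneg_right ?_ (by positivity)
    refine (mul_le_mul_of_nonneg_left (norm_hermiteCoeff_le z.2 a (s z.1)) (norm_nonneg _)).trans
      (le_of_eq ?_)
    rw [Real.exp_add]; ring
  calc ∑' x, A x * Complex.exp (-a * t ^ 2 + s x * t)
      = ∑' x, ∑' k, A x * hermiteCoeff k a (s x) * t ^ k := by
        refine tsum_congr fun x => ?_
        rw [← (hasSum_hermiteCoeff a (s x) t).tsum_eq, ← tsum_mul_left]
        exact tsum_congr fun k => by ring
    _ = ∑' k, ∑' x, A x * hermiteCoeff k a (s x) * t ^ k :=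
        (Summable.tsum_comm (f := fun x k => A x * hermiteCoeff k a (s x) * t ^ k) h1).symm
    _ = _ := tsum_congr fun k => tsum_mul_right

theorem norm_tsum_mul_hermiteCoeff_le {X : Type*} {A s : X → ℂ} (a : ℂ)
    (h : Summable fun x => ‖A x‖ * Real.exp ‖s x‖) (k : ℕ) :
    ‖∑' x, A x * hermiteCoeff k a (s x)‖ ≤ Real.exp ‖a‖ * ∑' x, ‖A x‖ * Real.exp ‖s x‖ := by
  rw [← tsum_mul_left]
  refine tsum_of_norm_bounded (h.mul_left (Real.exp ‖a‖)).hasSum fun x => ?_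
  rw [norm_mul]
  refine (mul_le_mul_of_nonneg_left (norm_hermiteCoeff_le k a (s x)) (norm_nonneg _)).trans
    (le_of_eq ?_)
  rw [Real.exp_add]; ring

/-- Comparison of the Taylor coefficients of two sums of exponentials. -/
theorem tsum_hermiteCoeff_eq {X Y : Type*} {A s : X → ℂ} {A' s' : Y → ℂ} {a a' : ℂ}
    (h : Summable fun x => ‖A x‖ * Real.exp ‖s x‖)
    (h' : Summable fun y => ‖A' y‖ * Real.exp ‖s' y‖)
    (heq : ∀ t : ℂ, ‖t‖ < 1 → ∑' x, A x * Complex.exp (-a * t ^ 2 + s x * t)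
      = ∑' y, A' y * Complex.exp (-a' * t ^ 2 + s' y * t)) (k : ℕ) :
    ∑' x, A x * hermiteCoeff k a (s x) = ∑' y, A' y * hermiteCoeff k a' (s' y) := by
  have := power_series_unique (norm_tsum_mul_hermiteCoeff_le a h)
    (norm_tsum_mul_hermiteCoeff_le a' h') fun t ht => by
    rw [← tsum_exp_eq_tsum_hermiteCoeff a h ht, ← tsum_exp_eq_tsum_hermiteCoeff a' h' ht]
    exact heq t ht
  exact congrFun this k

end Hermite
end JacobiTheta
end

noncomputable section

namespace JacobiTheta

open UpperHalfPlane

/-! ### Polynomials -/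

section Polynomials

open MvPolynomial

variable {p : ℕ}

/-- The linear form `∑ w_i x_i`. -/
def linForm (w : Fin p → ℂ) : MvPolynomial (Fin p) ℂ := ∑ i, C (w i) * X i

theorem evalReal_linForm (w : Fin p → ℂ) (x : Fin p → ℝ) :
    evalReal (linForm w) x = ∑ i, w i * x i := by
  simp [evalReal, linForm]

theorem evalReal_linForm_pow (w : Fin p → ℂ) (k : ℕ) (x : Fin p → ℝ) :
    evalReal (linForm w ^ k) x = (∑ i, w i * x i) ^ k := by
  rw [← evalReal_linForm, evalReal, evalReal, map_pow]

theorem linForm_isHomogeneous (w : Fin p → ℂ) (k : ℕ) : (linForm w ^ k).IsHomogeneous k := by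
  have h : (linForm w).IsHomogeneous 1 := by
    refine IsHomogeneous.sum _ _ _ fun i _ => ?_
    have := (isHomogeneous_C (Fin p) (w i)).mul (isHomogeneous_X ℂ i)
    simpa using this
  simpa using h.pow k

/-- Homogeneous polynomials are linear combinations of powers of linear forms. -/
theorem mem_span_linForm_pow {k : ℕ} {P : MvPolynomial (Fin p) ℂ} (hP : P.IsHomogeneous k) :
    P ∈ Submodule.span ℂ (Set.range fun w : Fin p → ℂ => linForm w ^ k) := by
  classical
  -- By duality, take a functional f that vanishes on all powers but not on P. Then f(⟨w, x⟩^k) is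
  -- the zero polynomial in w; its coefficients are multinomial coefficients times values of f on
  -- monomials of degree k, so f kills all these monomials and hence P.
  by_contra hn
  obtain ⟨f, hf, hle⟩ := Submodule.exists_le_ker_of_notMem hn
  have hw : ∀ w : Fin p → ℂ, f (linForm w ^ k) = 0 := fun w =>
    LinearMap.mem_ker.mp (hle (Submodule.subset_span ⟨w, rfl⟩))
  let mon : (Fin p → ℕ) → MvPolynomial (Fin p) ℂ := fun κ => ∏ i, X i ^ κ i
  let Q : MvPolynomial (Fin p) ℂ := ∑ κ ∈ Finset.piAntidiag Finset.univ k,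
    C ((Nat.multinomial Finset.univ κ : ℂ) * f (mon κ)) * mon κ
  have hQ : Q = 0 := by
    refine MvPolynomial.funext fun w => ?_
    rw [map_zero, ← hw w, linForm, Finset.sum_pow_eq_sum_piAntidiag, map_sum, map_sum]
    refine Finset.sum_congr rfl fun κ _ => ?_
    have h1 : (Nat.multinomial Finset.univ κ : MvPolynomial (Fin p) ℂ)
        * ∏ i, (C (w i) * X i) ^ κ i
        = ((Nat.multinomial Finset.univ κ : ℂ) * ∏ i, w i ^ κ i) • mon κ := by
      simp only [mul_pow, Finset.prod_mul_distrib, MvPolynomial.smul_eq_C_mul, mon, map_mul,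
        map_natCast, map_prod, map_pow]
      ring
    rw [h1, map_smul, smul_eq_mul]
    simp only [map_mul, eval_C, mon, map_prod, map_pow, eval_X]
    ring
  have hmon : ∀ κ : Fin p → ℕ, mon κ = monomial (Finsupp.equivFunOnFinite.symm κ) 1 := by
    intro κ
    rw [MvPolynomial.monomial_eq, C_1, one_mul, Finsupp.prod_fintype _ _ (by simp)]
    simp [mon]
  have hf0 : ∀ κ ∈ Finset.piAntidiag (Finset.univ : Finset (Fin p)) k, f (mon κ) = 0 := by
    intro κ hκ
    have h1 : coeff (Finsupp.equivFunOnFinite.symm κ) Q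
        = (Nat.multinomial Finset.univ κ : ℂ) * f (mon κ) := by
      simp only [Q, coeff_sum, coeff_C_mul, hmon, coeff_monomial, EmbeddingLike.apply_eq_iff_eq]
      rw [Finset.sum_eq_single κ]
      · simp
      · intro b _ hb
        simp [hb]
      · exact fun h => absurd hκ h
    rw [hQ, coeff_zero] at h1
    have h2 : (Nat.multinomial Finset.univ κ : ℂ) ≠ 0 := by
      exact_mod_cast (Nat.multinomial_pos _ _).ne'
    exact (mul_eq_zero.mp h1.symm).resolve_left h2
  apply hf
  rw [P.as_sum, map_sum]
  refine Finset.sum_eq_zero fun d hd => ?_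
  have hdeg : d.degree = k := by
    rw [Finsupp.degree_eq_weight_one]
    exact hP (mem_support_iff.mp hd)
  have h1 : monomial d (coeff d P) = coeff d P • mon d := by
    rw [hmon, smul_monomial, smul_eq_mul, mul_one]
    congr 1
    ext; simp
  rw [h1, map_smul, hf0, smul_zero]
  rw [Finset.mem_piAntidiag]
  refine ⟨?_, fun i _ => Finset.mem_univ i⟩
  rw [← hdeg, Finsupp.degree_eq_sum]

/-- The Laplacian as a linear map. -/
def laplacianLin : MvPolynomial (Fin p) ℂ →ₗ[ℂ] MvPolynomial (Fin p) ℂ :=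
  ∑ i, (pderiv i).toLinearMap ∘ₗ (pderiv i).toLinearMap

theorem laplacianLin_apply (P : MvPolynomial (Fin p) ℂ) : laplacianLin P = laplacian P := by
  simp [laplacianLin, laplacian]

theorem iterate_laplacian (m : ℕ) (P : MvPolynomial (Fin p) ℂ) :
    laplacian^[m] P = (laplacianLin ^ m) P := by
  rw [Module.End.pow_apply]
  congr 1
  funext Q
  exact (laplacianLin_apply Q).symm

theorem laplacian_linForm_pow (w : Fin p → ℂ) (k : ℕ) :
    laplacian (linForm w ^ k) = ((k : ℂ) * (k - 1 : ℕ) * ∑ i, w i ^ 2) • linForm w ^ (k - 2) := by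
  have h1 : ∀ i, pderiv i (linForm w) = C (w i) := by
    intro i
    simp [linForm, pderiv_X, Pi.single_apply]
  simp only [laplacian, pderiv_pow, h1]
  simp only [Derivation.leibniz, pderiv_pow, h1, pderiv_C, zero_add, smul_eq_mul,
    Derivation.map_natCast, mul_zero, add_zero]
  rw [MvPolynomial.smul_eq_C_mul, Finset.mul_sum, map_sum, Finset.sum_mul]
  refine Finset.sum_congr rfl fun i _ => ?_
  rw [show k - 1 - 1 = k - 2 by omega]
  simp only [map_mul, map_pow, map_natCast]
  ring

theorem iterate_laplacian_linForm_pow (w : Fin p → ℂ) (k m : ℕ) :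
    laplacian^[m] (linForm w ^ k)
      = ((k.descFactorial (2 * m) : ℂ) * (∑ i, w i ^ 2) ^ m) • linForm w ^ (k - 2 * m) := by
  induction m with
  | zero => simp
  | succ m ih =>
    rw [Function.iterate_succ_apply', ih, ← laplacianLin_apply, map_smul, laplacianLin_apply,
      laplacian_linForm_pow, smul_smul, show k - 2 * (m + 1) = k - 2 * m - 2 by omega,
      show 2 * (m + 1) = 2 * m + 1 + 1 by ring, Nat.descFactorial_succ, Nat.descFactorial_succ]
    congr 1
    rw [show k - (2 * m + 1) = k - 2 * m - 1 by omega]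
    push_cast
    ring

/-- The sum of the first terms of `exp(-Δ / 8πy)`. -/
def heatLin (k : ℕ) (y : ℝ) : MvPolynomial (Fin p) ℂ →ₗ[ℂ] MvPolynomial (Fin p) ℂ :=
  ∑ m ∈ Finset.range (k + 1),
    ((m.factorial : ℂ)⁻¹ * (-1 / (8 * Real.pi * y) : ℂ) ^ m) • laplacianLin ^ m

/-- The Laplacian multiplies exp(t⟨w, x⟩) by t²⟨w, w⟩, so exp(-Δ/8πy) multiplies it by exp(-t²⟨w,
w⟩/8πy); this is the coefficient of t^k. The truncation at N loses nothing, because Δ^m lowers the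
degree by 2m. -/
theorem heatLin_linForm_pow (k : ℕ) (y : ℝ) (w : Fin p → ℂ) (x : Fin p → ℝ) {N : ℕ}
    (hN : k < 2 * (N + 1)) :
    evalReal (heatLin N y (linForm w ^ k)) x
      = k.factorial * hermiteCoeff k ((∑ i, w i ^ 2) / (8 * Real.pi * y)) (∑ i, w i * x i) := by
  rw [hermiteCoeff_eq_sum k _ _ hN, heatLin, LinearMap.sum_apply, evalReal, map_sum,
    Finset.mul_sum]
  refine Finset.sum_congr rfl fun m _ => ?_
  rw [LinearMap.smul_apply, ← iterate_laplacian, iterate_laplacian_linForm_pow,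
    MvPolynomial.smul_eval, MvPolynomial.smul_eval]
  have h1 := evalReal_linForm_pow w (k - 2 * m) x
  rw [evalReal] at h1
  rw [h1]
  split_ifs with h
  · have h2 : (k.descFactorial (2 * m) : ℂ) = k.factorial / (k - 2 * m).factorial := by
      rw [eq_div_iff (Nat.cast_ne_zero.mpr (Nat.factorial_ne_zero _)), mul_comm]
      exact_mod_cast Nat.factorial_mul_descFactorial h
    have h3 : -((∑ i, w i ^ 2) / (8 * Real.pi * y : ℂ))
        = (-1 / (8 * Real.pi * y : ℂ)) * ∑ i, w i ^ 2 := by ring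
    rw [h2, h3, mul_pow]
    generalize (-1 / (8 * Real.pi * y : ℂ)) ^ m = c1
    generalize (∑ i, w i ^ 2) ^ m = c2
    field_simp
  · rw [Nat.descFactorial_eq_zero_iff_lt.mpr (by omega)]
    simp

theorem laplacian_pow_eq_zero {k m : ℕ} (hm : k < 2 * m) {P : MvPolynomial (Fin p) ℂ}
    (hP : P.IsHomogeneous k) : (laplacianLin ^ m) P = 0 := by
  have hle : Submodule.span ℂ (Set.range fun w : Fin p → ℂ => linForm w ^ k)
      ≤ LinearMap.ker (laplacianLin ^ m) := by
    rw [Submodule.span_le]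
    rintro _ ⟨w, rfl⟩
    change (laplacianLin ^ m) (linForm w ^ k) = 0
    rw [← iterate_laplacian, iterate_laplacian_linForm_pow,
      Nat.descFactorial_eq_zero_iff_lt.mpr hm]
    simp
  exact hle (mem_span_linForm_pow hP)

/-- The length of the sum in `heatPoly` depends on P, so linearity in P is not visible there. A
truncation of fixed length is linear, which arguments by linear span require. -/
theorem heatPoly_eq_heatLin {k : ℕ} (y : ℝ) {P : MvPolynomial (Fin p) ℂ} (hP : P.IsHomogeneous k) 
    {N : ℕ} (hN : k ≤ N) : heatPoly y P = heatLin N y P := by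
  rw [heatPoly, heatLin, LinearMap.sum_apply]
  simp only [iterate_laplacian, LinearMap.smul_apply]
  by_cases h0 : P = 0
  · simp [h0]
  rw [hP.totalDegree h0]
  refine Finset.sum_subset (Finset.range_mono (by omega)) fun m _ hm => ?_
  rw [laplacian_pow_eq_zero (by simp at hm; omega) hP, smul_zero]

/-- The map `P ↦ P_h` as a linear map. -/
def subPolyLin (v : Fin p → ℝ) (h : ℕ) : MvPolynomial (Fin p) ℂ →ₗ[ℂ] MvPolynomial (Fin p) ℂ where
  toFun P := subPoly P v h
  map_add' P Q := by simp [subPoly]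
  map_smul' c P := by simp [subPoly]

/-- With κ = ⟨w, v⟩/⟨v, v⟩, the substitution turns ⟨w, x⟩ into ⟨w - κv, x⟩ + κs, where s stands for
⟨x, v⟩; the binomial theorem gives the coefficient of s^h. -/
theorem subPoly_linForm_pow (w : Fin p → ℂ) (v : Fin p → ℝ) (k h : ℕ) :
    subPoly (linForm w ^ k) v h
      = ((k.choose h : ℂ) * ((∑ i, w i * v i) / (v ⬝ᵥ v : ℝ)) ^ h) •
        linForm (fun i => w i - (∑ i, w i * v i) / (v ⬝ᵥ v : ℝ) * v i) ^ (k - h) := by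
  set κ : ℂ := (∑ i, w i * v i) / (v ⬝ᵥ v : ℝ) with hκ
  have h1 : MvPolynomial.aeval
      (fun i : Fin p =>
        (Polynomial.C (MvPolynomial.X i
            - MvPolynomial.C ((v i / (v ⬝ᵥ v) : ℝ) : ℂ)
              * ∑ j, MvPolynomial.C ((v j : ℝ) : ℂ) * MvPolynomial.X j)
          + Polynomial.C (MvPolynomial.C ((v i / (v ⬝ᵥ v) : ℝ) : ℂ)) * Polynomial.X :
          Polynomial (MvPolynomial (Fin p) ℂ))) (linForm w)
      = Polynomial.C (linForm (fun i => w i - κ * v i)) + Polynomial.C (C κ) * Polynomial.X := by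
    have e2 : (C κ : MvPolynomial (Fin p) ℂ) = ∑ i, C (w i) * C ((v i / (v ⬝ᵥ v) : ℝ) : ℂ) := by
      simp only [← map_mul, ← map_sum]
      congr 1
      rw [hκ, Finset.sum_div]
      refine Finset.sum_congr rfl fun i _ => ?_
      push_cast
      ring
    have e3 : linForm (fun i => w i - κ * v i)
        = linForm w - C κ * ∑ j, MvPolynomial.C ((v j : ℝ) : ℂ) * MvPolynomial.X j := by
      simp only [linForm, Finset.mul_sum, ← Finset.sum_sub_distrib]
      refine Finset.sum_congr rfl fun i _ => ?_
      simp only [map_sub, map_mul]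
      ring
    have e1 : ∀ c : ℂ, algebraMap ℂ (Polynomial (MvPolynomial (Fin p) ℂ)) c
        = Polynomial.C (C c) := fun c => rfl
    rw [e3, e2]
    simp only [linForm, map_sum, map_mul, aeval_C, aeval_X, e1, map_sub, mul_add, mul_sub,
      Finset.sum_add_distrib, Finset.sum_sub_distrib, Finset.sum_mul, mul_assoc]
  rw [subPoly, map_pow, h1, add_pow, Polynomial.finsetSum_coeff]
  by_cases hh : h ≤ k
  · rw [Finset.sum_eq_single (k - h)]
    · rw [← Polynomial.C_pow, mul_pow, ← Polynomial.C_pow, show k - (k - h) = h by omega,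
        ← Polynomial.C_eq_natCast, mul_comm, ← mul_assoc, ← mul_assoc, ← Polynomial.C_mul,
        ← Polynomial.C_mul, Polynomial.coeff_C_mul, Polynomial.coeff_X_pow, if_pos rfl, mul_one,
        Nat.choose_symm hh, MvPolynomial.smul_eq_C_mul]
      simp only [map_mul, map_pow, map_natCast]
      ring
    · intro b hb hbne
      rw [← Polynomial.C_pow, mul_pow, ← Polynomial.C_pow, 
        ← Polynomial.C_eq_natCast, mul_comm, ← mul_assoc, ← mul_assoc, ← Polynomial.C_mul,
        ← Polynomial.C_mul, Polynomial.coeff_C_mul, Polynomial.coeff_X_pow, if_neg, mul_zero]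
      simp at hb
      omega
    · intro hn
      simp at hn
  · rw [Nat.choose_eq_zero_of_lt (by omega)]
    rw [Finset.sum_eq_zero]
    · simp
    · intro b hb
      rw [← Polynomial.C_pow, mul_pow, ← Polynomial.C_pow, 
        ← Polynomial.C_eq_natCast, mul_comm, ← mul_assoc, ← mul_assoc, ← Polynomial.C_mul,
        ← Polynomial.C_mul, Polynomial.coeff_C_mul, Polynomial.coeff_X_pow, if_neg, mul_zero]
      simp at hb
      omega

theorem subPoly_isHomogeneous {k : ℕ} {P : MvPolynomial (Fin p) ℂ} (hP : P.IsHomogeneous k)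
    (v : Fin p → ℝ) (h : ℕ) : (subPoly P v h).IsHomogeneous (k - h) := by
  have hle : Submodule.span ℂ (Set.range fun w : Fin p → ℂ => linForm w ^ k)
      ≤ (homogeneousSubmodule (Fin p) ℂ (k - h)).comap (subPolyLin v h) := by
    rw [Submodule.span_le]
    rintro _ ⟨w, rfl⟩
    change subPoly (linForm w ^ k) v h ∈ homogeneousSubmodule (Fin p) ℂ (k - h)
    rw [subPoly_linForm_pow]
    exact Submodule.smul_mem _ _ (linForm_isHomogeneous _ _)
  exact hle (mem_span_linForm_pow hP)

/-- Polynomials have at most exponential growth. -/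
theorem exists_norm_evalReal_le (Q : MvPolynomial (Fin p) ℂ) :
    ∃ C K : ℝ, 0 ≤ C ∧ 0 ≤ K ∧ ∀ x : Fin p → ℝ, ‖evalReal Q x‖ ≤ C * Real.exp (K * ‖x‖) := by
  induction Q using MvPolynomial.induction_on with
  | C c => exact ⟨‖c‖, 0, norm_nonneg _, le_rfl, fun x => by simp [evalReal]⟩
  | add P Q hP hQ =>
    obtain ⟨C1, K1, hC1, hK1, h1⟩ := hP
    obtain ⟨C2, K2, hC2, hK2, h2⟩ := hQ
    refine ⟨C1 + C2, K1 + K2, by positivity, by positivity, fun x => ?_⟩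
    rw [evalReal, map_add, add_mul]
    refine (norm_add_le _ _).trans (add_le_add ((h1 x).trans ?_) ((h2 x).trans ?_))
    · gcongr; linarith
    · gcongr; linarith
  | mul_X P i hP =>
    obtain ⟨C1, K1, hC1, hK1, h1⟩ := hP
    refine ⟨C1, K1 + 1, hC1, by positivity, fun x => ?_⟩
    rw [evalReal, map_mul, eval_X, norm_mul, add_mul, Real.exp_add, ← mul_assoc]
    refine mul_le_mul (h1 x) ?_ (norm_nonneg _) (by positivity)
    rw [Complex.norm_real, one_mul]
    exact (norm_le_pi_norm x i).trans ((by linarith [Real.add_one_le_exp ‖x‖]))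

end Polynomials
end JacobiTheta
end

noncomputable section

namespace JacobiTheta

open UpperHalfPlane

/-! ### Poisson summation for Gaussians -/

section Gaussian

open MeasureTheory

variable {ι : Type*} [Fintype ι]

/-- The function `exp(-∑ b_i v_i² + ∑ c_i v_i)`. -/
def gaussian (b c : ι → ℂ) (v : ι → ℝ) : ℂ :=
  Complex.exp (-∑ i, b i * (v i : ℂ) ^ 2 + ∑ i, c i * v i)

theorem continuous_gaussian (b c : ι → ℂ) : Continuous (gaussian b c) := by
  unfold gaussian; fun_prop

theorem sq_norm_le_sum (v : ι → ℝ) : ‖v‖ ^ 2 ≤ ∑ i, v i ^ 2 := by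
  have h0 : 0 ≤ ∑ i, v i ^ 2 := Finset.sum_nonneg fun i _ => sq_nonneg _
  rw [← Real.sqrt_le_sqrt_iff h0, Real.sqrt_sq (norm_nonneg _)]
  refine (pi_norm_le_iff_of_nonneg (Real.sqrt_nonneg _)).mpr fun i => ?_
  rw [Real.norm_eq_abs, ← Real.sqrt_sq_eq_abs]
  exact Real.sqrt_le_sqrt (Finset.single_le_sum (f := fun i => v i ^ 2)
    (fun i _ => sq_nonneg _) (Finset.mem_univ i))

theorem norm_gaussian_le {b : ι → ℂ} (hb : ∀ i, 0 < (b i).re) (c : ι → ℂ) :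
    ∃ ε K : ℝ, 0 < ε ∧ 0 ≤ K ∧ ∀ v, ‖gaussian b c v‖ ≤ Real.exp (-ε * ‖v‖ ^ 2 + K * ‖v‖) := by
  obtain ⟨ε, hε, hεb⟩ : ∃ ε : ℝ, 0 < ε ∧ ∀ i, ε ≤ (b i).re := by
    rcases isEmpty_or_nonempty ι with h | h
    · exact ⟨1, one_pos, fun i => h.elim i⟩
    · obtain ⟨i, hi⟩ := Finite.exists_min fun i => (b i).re
      exact ⟨(b i).re, hb i, hi⟩
  refine ⟨ε, ∑ i, ‖c i‖, hε, Finset.sum_nonneg fun _ _ => norm_nonneg _, fun v => ?_⟩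
  rw [gaussian, Complex.norm_exp]
  apply Real.exp_le_exp.mpr
  have h1 : (-∑ i, b i * (v i : ℂ) ^ 2 + ∑ i, c i * v i).re
      = -∑ i, (b i).re * v i ^ 2 + ∑ i, (c i).re * v i := by
    rw [Complex.add_re, Complex.neg_re, Complex.re_sum, Complex.re_sum]
    congr 2
    · refine Finset.sum_congr rfl fun i _ => ?_
      rw [← Complex.ofReal_pow, Complex.re_mul_ofReal]
    · funext i
      exact Complex.re_mul_ofReal _ _
  rw [h1]
  have h2 : ε * ‖v‖ ^ 2 ≤ ∑ i, (b i).re * v i ^ 2 := by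
    refine (mul_le_mul_of_nonneg_left (sq_norm_le_sum v) hε.le).trans ?_
    rw [Finset.mul_sum]
    exact Finset.sum_le_sum fun i _ => mul_le_mul_of_nonneg_right (hεb i) (sq_nonneg _)
  have h3 : ∑ i, (c i).re * v i ≤ (∑ i, ‖c i‖) * ‖v‖ := by
    rw [Finset.sum_mul]
    refine Finset.sum_le_sum fun i _ => (le_abs_self _).trans ?_
    rw [abs_mul]
    exact mul_le_mul (Complex.abs_re_le_norm _) (norm_le_pi_norm v i) (abs_nonneg _)
      (norm_nonneg _)
  linarith

theorem summable_gaussian_comp {b : ι → ℂ} (hb : ∀ i, 0 < (b i).re) (c : ι → ℂ)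
    (N : (ι → ℝ) →ₗ[ℝ] (ι → ℝ)) (hN : Function.Injective N) (v : ι → ℝ) :
    Summable fun k : ι → ℤ => ‖gaussian b c (N (fun i => (k i : ℝ)) + v)‖ := by
  obtain ⟨ε, K, hε, _, hle⟩ := norm_gaussian_le hb c
  have h := summable_gaussian_span (Pi.basisFun ℝ ι) N hN v hε K
  let e := ((Pi.basisFun ℝ ι).restrictScalars ℤ).equivFun.symm
  have he : ∀ k : ι → ℤ, ((e k : Submodule.span ℤ (Set.range (Pi.basisFun ℝ ι))) : ι → ℝ)
      = fun i => (k i : ℝ) := by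
    classical
    intro k
    simp only [e, Module.Basis.equivFun_symm_apply, Submodule.coe_sum, Submodule.coe_smul,
      Module.Basis.restrictScalars_apply]
    ext j
    simp [Finset.sum_apply, Pi.single_apply]
  have h2 := e.toEquiv.summable_iff.mpr h
  refine Summable.of_nonneg_of_le (fun _ => norm_nonneg _) (fun k => (hle _)) (h2.congr fun k => ?_)
  simp only [Function.comp_apply]
  change Real.exp (-ε * ‖N (e k : ι → ℝ) + v‖ ^ 2 + K * ‖N (e k : ι → ℝ) + v‖) = _
  rw [he]

/-- Poisson summation for a Gaussian over a translate of a lattice. -/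
theorem tsum_gaussian {b : ι → ℂ} (hb : ∀ i, 0 < (b i).re) (c : ι → ℂ)
    (M : (ι → ℝ) ≃ₗ[ℝ] (ι → ℝ)) (N : (ι → ℝ) →ₗ[ℝ] (ι → ℝ))
    (hMN : ∀ m x, ∑ i, N m i * M x i = ∑ i, m i * x i) (v : ι → ℝ) :
    ∑' k : ι → ℤ, gaussian b c (M (fun i => (k i : ℝ)) + v)
      = (|LinearMap.det (M : (ι → ℝ) →ₗ[ℝ] (ι → ℝ))|⁻¹ : ℝ) *
        ((∏ i, (Real.pi / b i) ^ (1 / 2 : ℂ)) *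
        ∑' m : ι → ℤ, Complex.exp (∑ i, (2 * Real.pi * Complex.I * (N (fun i => (m i : ℝ)) i) * v i
          + (c i - 2 * Real.pi * Complex.I * (N (fun i => (m i : ℝ)) i)) ^ 2 / (4 * b i)))) := by
  have hb0 : ∀ i, b i ≠ 0 := fun i h => by simpa [h] using hb i
  have hNinj : Function.Injective N := by
    rw [← LinearMap.ker_eq_bot, LinearMap.ker_eq_bot']
    intro m hm
    have := hMN m m
    rw [hm] at this
    simp only [Pi.zero_apply, zero_mul, Finset.sum_const_zero] at this
    have h2 := (Finset.sum_eq_zero_iff_of_nonneg fun i _ => mul_self_nonneg (m i)).mp this.symm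
    ext i
    simpa using h2 i (Finset.mem_univ i)
  let f : (ι → ℝ) → ℂ := fun x => gaussian b c (M x + v)
  have hMc : Continuous M := M.toLinearMap.continuous_of_finiteDimensional
  have hfc : Continuous f := (continuous_gaussian b c).comp (hMc.add continuous_const)
  -- change of variables
  have hcv : ∀ h : (ι → ℝ) → ℂ, ∫ x, h (M x + v)
      = (|LinearMap.det (M : (ι → ℝ) →ₗ[ℝ] (ι → ℝ))|⁻¹ : ℝ) * ∫ x, h x := by
    intro h
    have hdet : LinearMap.det (M : (ι → ℝ) →ₗ[ℝ] (ι → ℝ)) ≠ 0 :=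
      (LinearEquiv.isUnit_det' M).ne_zero
    have e1 := Real.map_linearMap_volume_pi_eq_smul_volume_pi hdet
    have e2 := (M.toContinuousLinearEquiv.toHomeomorph.measurableEmbedding).integral_map
      (μ := volume) (fun y => h (y + v))
    have e3 : Measure.map (M.toContinuousLinearEquiv.toHomeomorph) (volume : Measure (ι → ℝ))
        = ENNReal.ofReal |(LinearMap.det (M : (ι → ℝ) →ₗ[ℝ] (ι → ℝ)))⁻¹| • volume := e1
    rw [e3, integral_smul_measure, integral_add_right_eq_self, ENNReal.toReal_ofReal (abs_nonneg _),
      abs_inv] at e2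
    rw [← Complex.real_smul]
    exact e2.symm
  have hfi : Integrable f := by
    have h1 := GaussianFourier.integrable_cexp_neg_sum_mul_add hb c
    have h2 : Integrable (gaussian b c) := h1
    have hdet : LinearMap.det (M : (ι → ℝ) →ₗ[ℝ] (ι → ℝ)) ≠ 0 :=
      (LinearEquiv.isUnit_det' M).ne_zero
    have e1 := Real.map_linearMap_volume_pi_eq_smul_volume_pi hdet
    have e3 : Measure.map (M.toContinuousLinearEquiv.toHomeomorph) (volume : Measure (ι → ℝ))
        = ENNReal.ofReal |(LinearMap.det (M : (ι → ℝ) →ₗ[ℝ] (ι → ℝ)))⁻¹| • volume := e1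
    have e2 := (M.toContinuousLinearEquiv.toHomeomorph.measurableEmbedding).integrable_map_iff
      (μ := volume) (g := fun y => gaussian b c (y + v))
    rw [e3] at e2
    exact e2.mp ((h2.comp_add_right v).smul_measure ENNReal.ofReal_ne_top)
  obtain ⟨C, a, ha, hle⟩ : ∃ C a : ℝ, 0 < a ∧ ∀ x, ‖f x‖ ≤ C * Real.exp (-a * ‖x‖) := by
    obtain ⟨ε, K, hε, _, hle⟩ := norm_gaussian_le hb c
    obtain ⟨C, hC, hCe⟩ := exists_gaussian_le_exp hε K
    obtain ⟨κ, hκ, hanti⟩ : ∃ κ : ℝ, 0 < κ ∧ ∀ x, κ * ‖x‖ ≤ ‖M x‖ := by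
      obtain ⟨κ, hκ0, hκ⟩ := M.toContinuousLinearEquiv.symm.toContinuousLinearMap.isBoundedLinearMap.bound
      refine ⟨κ⁻¹, inv_pos.mpr hκ0, fun x => ?_⟩
      rw [inv_mul_le_iff₀ hκ0]
      simpa using hκ (M x)
    refine ⟨C * Real.exp ‖v‖, κ, hκ, fun x => ((hle _).trans (hCe _)).trans ?_⟩
    rw [mul_assoc, ← Real.exp_add]
    refine mul_le_mul_of_nonneg_left (Real.exp_le_exp.mpr ?_) hC.le
    have h2 := norm_sub_norm_le (M x) (-v)
    rw [sub_neg_eq_add, norm_neg] at h2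
    linarith [hanti x]
  -- Under the substitution y = Mx + v the character m becomes the character r = Nm, by duality of M
  -- and N. Only the linear coefficient of the Gaussian changes, to c - 2πir.
  have hcoeff : ∀ m : ι → ℤ,
      ∫ x : ι → ℝ, Complex.exp (-(2 * Real.pi * Complex.I * ∑ i, (m i : ℂ) * x i)) * f x
      = (|LinearMap.det (M : (ι → ℝ) →ₗ[ℝ] (ι → ℝ))|⁻¹ : ℝ) *
        ((∏ i, (Real.pi / b i) ^ (1 / 2 : ℂ)) *
        Complex.exp (∑ i, (2 * Real.pi * Complex.I * (N (fun i => (m i : ℝ)) i) * v i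
          + (c i - 2 * Real.pi * Complex.I * (N (fun i => (m i : ℝ)) i)) ^ 2 / (4 * b i)))) := by
    intro m
    set r : ι → ℝ := N (fun i => (m i : ℝ)) with hr
    have h1 : ∀ x : ι → ℝ,
        Complex.exp (-(2 * Real.pi * Complex.I * ∑ i, (m i : ℂ) * x i)) * f x
        = (fun y : ι → ℝ => Complex.exp (∑ i, 2 * Real.pi * Complex.I * r i * v i) *
          gaussian b (fun i => c i - 2 * Real.pi * Complex.I * r i) y) (M x + v) := by
      intro x
      have h2 : ∑ i, (m i : ℂ) * x i = ∑ i, (r i : ℂ) * (M x i : ℝ) := by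
        have := hMN (fun i => (m i : ℝ)) x
        exact_mod_cast this.symm
      simp only [f, gaussian, h2]
      rw [← Complex.exp_add, ← Complex.exp_add]
      congr 1
      simp only [Pi.add_apply, Complex.ofReal_add, Finset.mul_sum, ← Finset.sum_neg_distrib,
        ← Finset.sum_add_distrib]
      refine Finset.sum_congr rfl fun i _ => ?_
      ring
    refine (integral_congr_ae (Filter.Eventually.of_forall h1)).trans ((hcv
      (fun y : ι → ℝ => Complex.exp (∑ i, 2 * Real.pi * Complex.I * r i * v i) *
        gaussian b (fun i => c i - 2 * Real.pi * Complex.I * r i) y)).trans ?_)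
    rw [integral_const_mul]
    congr 1
    have h3 := GaussianFourier.integral_cexp_neg_sum_mul_add hb
      (fun i => c i - 2 * Real.pi * Complex.I * r i)
    change ∫ y, gaussian b (fun i => c i - 2 * Real.pi * Complex.I * r i) y = _ at h3
    rw [h3, Finset.prod_mul_distrib, ← Complex.exp_sum, Finset.sum_add_distrib, Complex.exp_add]
    ring
  have hs : Summable fun m : ι → ℤ =>
      ∫ x : ι → ℝ, Complex.exp (-(2 * Real.pi * Complex.I * ∑ i, (m i : ℂ) * x i)) * f x := by
    simp_rw [hcoeff]
    refine Summable.mul_left _ (Summable.mul_left _ ?_)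
    -- Up to a constant and a factor of absolute value 1, the dual terms are values of a Gaussian
    -- with quadratic coefficients π²/b_i, whose real parts are again positive.
    have hb' : ∀ i, 0 < (Real.pi ^ 2 / b i : ℂ).re := by
      intro i
      have : (Real.pi ^ 2 / b i : ℂ) = ((Real.pi ^ 2 : ℝ) : ℂ) * (b i)⁻¹ := by
        push_cast; rfl
      rw [this, Complex.re_ofReal_mul, Complex.inv_re]
      have := hb i
      have : 0 < Complex.normSq (b i) := Complex.normSq_pos.mpr (hb0 i)
      positivity
    have h1 := (summable_gaussian_comp hb' (fun i => -(Real.pi * Complex.I * c i / b i)) N hNinj 0)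
    refine Summable.of_norm ((h1.mul_left ‖Complex.exp (∑ i, c i ^ 2 / (4 * b i))‖).congr
      fun m => ?_)
    set r : ι → ℝ := N (fun i => (m i : ℝ)) with hr
    have h2 : ‖Complex.exp (∑ i, 2 * Real.pi * Complex.I * r i * v i)‖ = 1 := by
      have : ∑ i, 2 * Real.pi * Complex.I * r i * v i
          = ((∑ i, 2 * Real.pi * r i * v i : ℝ) : ℂ) * Complex.I := by
        push_cast
        rw [Finset.sum_mul]
        exact Finset.sum_congr rfl fun i _ => by ring
      rw [this, Complex.norm_exp_ofReal_mul_I]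
    rw [Finset.sum_add_distrib, Complex.exp_add, norm_mul, h2, one_mul, ← norm_mul, gaussian,
      ← Complex.exp_add]
    congr 2
    rw [← Finset.sum_neg_distrib, ← Finset.sum_add_distrib, ← Finset.sum_add_distrib]
    refine Finset.sum_congr rfl fun i _ => ?_
    simp only [add_zero]
    have := hb0 i
    field_simp
    ring_nf
    simp only [Complex.I_sq]
    ring
  have h := poisson_summation_int hfc ha hle hfi hs
  refine h.trans ?_
  simp_rw [hcoeff]
  rw [tsum_mul_left, tsum_mul_left]

end Gaussian
end JacobiTheta
end

noncomputable section

namespace JacobiTheta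

open UpperHalfPlane

/-! ### Lattices in coordinates -/

section Coordinates

variable {V : Type*} [AddCommGroup V] [Module ℝ V] {p n : ℕ}

/-- The signs of the standard form on `ℝ^{p,n}`. -/
def sgn : Fin p ⊕ Fin n → ℝ := Sum.elim (fun _ => 1) (fun _ => -1)

theorem sgn_mul_self (i : Fin p ⊕ Fin n) : sgn i * sgn i = 1 := by
  rcases i with i | i <;> simp [sgn]

/-- Coordinates on `V`, as a function on a single index set. -/
def coord (φ : V ≃ₗ[ℝ] (Fin p → ℝ) × (Fin n → ℝ)) : V ≃ₗ[ℝ] (Fin p ⊕ Fin n → ℝ) :=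
  φ.trans (LinearEquiv.sumArrowLequivProdArrow (Fin p) (Fin n) ℝ ℝ).symm

theorem coord_inl (φ : V ≃ₗ[ℝ] (Fin p → ℝ) × (Fin n → ℝ)) (x : V) (i : Fin p) :
    coord φ x (Sum.inl i) = (φ x).1 i := rfl

theorem coord_inr (φ : V ≃ₗ[ℝ] (Fin p → ℝ) × (Fin n → ℝ)) (x : V) (i : Fin n) :
    coord φ x (Sum.inr i) = (φ x).2 i := rfl

variable {B : LinearMap.BilinForm ℝ V} {φ : V ≃ₗ[ℝ] (Fin p → ℝ) × (Fin n → ℝ)}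

theorem bilin_eq_sum_coord (hB : IsIsometryToStd B φ) (x y : V) :
    B x y = ∑ i, sgn i * coord φ x i * coord φ y i := by
  rw [hB, Fintype.sum_sum_type]
  simp [sgn, coord_inl, coord_inr, sub_eq_add_neg]

theorem bilin_symm (hB : IsIsometryToStd B φ) (x y : V) : B x y = B y x := by
  simp only [bilin_eq_sum_coord hB]
  exact Finset.sum_congr rfl fun i _ => by ring

theorem bilin_nondegenerate (hB : IsIsometryToStd B φ) : B.Nondegenerate := by
  have h : ∀ x, (∀ y, B x y = 0) → x = 0 := by
    intro x hx
    apply (coord φ).injective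
    rw [map_zero]
    ext i
    have h := hx ((coord φ).symm (Pi.single i (sgn i)))
    rw [bilin_eq_sum_coord hB] at h
    simp only [LinearEquiv.apply_symm_apply, Pi.single_apply, mul_ite, mul_zero,
      Finset.sum_ite_eq', Finset.mem_univ, if_true] at h
    rw [mul_right_comm, sgn_mul_self, one_mul] at h
    exact h
  exact ⟨fun x hx => h x hx, fun x hx => h x fun y => by rw [bilin_symm hB]; exact hx y⟩

theorem exists_basis_of_isFullLattice (φ : V ≃ₗ[ℝ] (Fin p → ℝ) × (Fin n → ℝ))
    {L : Submodule ℤ V} (hL : IsFullLattice L) :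
    ∃ b : Module.Basis (Fin p ⊕ Fin n) ℝ V, L = Submodule.span ℤ (Set.range b) := by
  obtain ⟨m, b, rfl⟩ := hL
  let c : Module.Basis (Fin p ⊕ Fin n) ℝ V := Module.Basis.ofEquivFun (coord φ)
  let e := b.indexEquiv c
  exact ⟨b.reindex e, by rw [Module.Basis.range_reindex]⟩

theorem bilin_int_of_even (hB : IsIsometryToStd B φ) {L : Submodule ℤ V}
    (hL : IsEvenLattice B L) {x y : V} (hx : x ∈ L) (hy : y ∈ L) : ∃ m : ℤ, B x y = m := by
  obtain ⟨a, ha⟩ := hL _ (L.add_mem hx hy)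
  obtain ⟨b, hb⟩ := hL _ hx
  obtain ⟨c, hc⟩ := hL _ hy
  refine ⟨a - b - c, ?_⟩
  push_cast
  rw [← ha, ← hb, ← hc]
  simp only [quad, map_add, LinearMap.add_apply]
  rw [bilin_symm hB y x]
  ring

theorem mem_dualLattice_of_mem (hB : IsIsometryToStd B φ) {L : Submodule ℤ V}
    (hL : IsEvenLattice B L) {x : V} (hx : x ∈ L) : x ∈ dualLattice B L :=
  ⟨Submodule.subset_span hx, fun _ hy => bilin_int_of_even hB hL hx hy⟩

theorem dualLattice_eq_span (hB : IsIsometryToStd B φ) (b : Module.Basis (Fin p ⊕ Fin n) ℝ V) :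
    dualLattice B (Submodule.span ℤ (Set.range b))
      = Submodule.span ℤ (Set.range (B.dualBasis (bilin_nondegenerate hB) b)) := by
  rw [← LinearMap.BilinForm.dualSubmodule_span_of_basis]
  ext x
  have h : Submodule.span ℝ ((Submodule.span ℤ (Set.range b) : Submodule ℤ V) : Set V) = ⊤ := by
    rw [Submodule.span_span_of_tower, b.span_eq]
  change (x ∈ Submodule.span ℝ _ ∧ ∀ y ∈ _, ∃ m : ℤ, B x y = m) ↔ ∀ y ∈ _, _
  rw [h]
  simp only [Submodule.mem_top, true_and, Submodule.mem_one]
  refine forall₂_congr fun y _ => ?_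
  simp [eq_comm]

theorem bilin_dualBasis (hB : IsIsometryToStd B φ) (b : Module.Basis (Fin p ⊕ Fin n) ℝ V)
    (i j : Fin p ⊕ Fin n) :
    B (B.dualBasis (bilin_nondegenerate hB) b i) (b j) = if j = i then 1 else 0 :=
  LinearMap.BilinForm.apply_dualBasis_left _ _ _ _

theorem bilin_sum_dualBasis (hB : IsIsometryToStd B φ) (b : Module.Basis (Fin p ⊕ Fin n) ℝ V)
    (m : Fin p ⊕ Fin n → ℝ) (i : Fin p ⊕ Fin n) :
    B (∑ j, m j • B.dualBasis (bilin_nondegenerate hB) b j) (b i) = m i := by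
  rw [map_sum, LinearMap.sum_apply, Finset.sum_eq_single i]
  · rw [map_smul, LinearMap.smul_apply]
    have := bilin_dualBasis hB b i i
    rw [if_pos rfl] at this
    erw [this]
    simp
  · intro j _ hj
    rw [map_smul, LinearMap.smul_apply]
    have := bilin_dualBasis hB b j i
    rw [if_neg hj.symm] at this
    erw [this]
    simp
  · simp

/-- The coordinates of the real span of a lattice basis. -/
def basisCoord (φ : V ≃ₗ[ℝ] (Fin p → ℝ) × (Fin n → ℝ)) (b : Module.Basis (Fin p ⊕ Fin n) ℝ V) :
    (Fin p ⊕ Fin n → ℝ) ≃ₗ[ℝ] (Fin p ⊕ Fin n → ℝ) :=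
  b.equivFun.symm.trans (coord φ)

theorem basisCoord_apply (b : Module.Basis (Fin p ⊕ Fin n) ℝ V) (x : Fin p ⊕ Fin n → ℝ) :
    basisCoord φ b x = coord φ (∑ i, x i • b i) := by
  simp [basisCoord, Module.Basis.equivFun_symm_apply]

/-- The coordinates of the dual lattice, up to signs. -/
def dualCoord (hB : IsIsometryToStd B φ) (b : Module.Basis (Fin p ⊕ Fin n) ℝ V) :
    (Fin p ⊕ Fin n → ℝ) →ₗ[ℝ] (Fin p ⊕ Fin n → ℝ) :=
  LinearMap.pi fun i => sgn i • (LinearMap.proj i ∘ₗ (coord φ).toLinearMap ∘ₗ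
    (B.dualBasis (bilin_nondegenerate hB) b).equivFun.symm.toLinearMap)

theorem dualCoord_apply (hB : IsIsometryToStd B φ) (b : Module.Basis (Fin p ⊕ Fin n) ℝ V)
    (m : Fin p ⊕ Fin n → ℝ) (i : Fin p ⊕ Fin n) :
    dualCoord hB b m i
      = sgn i * coord φ (∑ j, m j • B.dualBasis (bilin_nondegenerate hB) b j) i := by
  simp [dualCoord, Module.Basis.equivFun_symm_apply]

/-- The signs in `dualCoord` convert the form B into the dot product of coordinates. This is the
duality between M and N that `tsum_gaussian` asks for. -/
theorem sum_dualCoord_mul_basisCoord (hB : IsIsometryToStd B φ)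
    (b : Module.Basis (Fin p ⊕ Fin n) ℝ V) (m x : Fin p ⊕ Fin n → ℝ) :
    ∑ i, dualCoord hB b m i * basisCoord φ b x i = ∑ i, m i * x i := by
  have h1 : ∑ i, dualCoord hB b m i * basisCoord φ b x i
      = B (∑ j, m j • B.dualBasis (bilin_nondegenerate hB) b j) (∑ i, x i • b i) := by
    rw [bilin_eq_sum_coord hB]
    exact Finset.sum_congr rfl fun i _ => by rw [dualCoord_apply, basisCoord_apply]
  rw [h1, map_sum]
  refine Finset.sum_congr rfl fun i _ => ?_
  rw [map_smul, bilin_sum_dualBasis hB, smul_eq_mul, mul_comm]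

/-- The order of the discriminant group is the square of the covolume. -/
theorem card_disc (hB : IsIsometryToStd B φ) (b : Module.Basis (Fin p ⊕ Fin n) ℝ V)
    (hL : IsEvenLattice B (Submodule.span ℤ (Set.range b))) :
    (Nat.card (Disc B (Submodule.span ℤ (Set.range b))) : ℝ)
      = |LinearMap.det (basisCoord φ b : (Fin p ⊕ Fin n → ℝ) →ₗ[ℝ] (Fin p ⊕ Fin n → ℝ))| ^ 2 := by
  classical
  set L := Submodule.span ℤ (Set.range b) with hLdef
  set b' := B.dualBasis (bilin_nondegenerate hB) b with hb'
  have hle : L ≤ dualLattice B L := fun x hx => mem_dualLattice_of_mem hB hL hx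
  let bD : Module.Basis (Fin p ⊕ Fin n) ℤ (dualLattice B L) :=
    (b'.restrictScalars ℤ).map (LinearEquiv.ofEq _ _ (dualLattice_eq_span hB b).symm)
  let bN : Module.Basis (Fin p ⊕ Fin n) ℤ (L.comap (dualLattice B L).subtype) :=
    (b.restrictScalars ℤ).map (Submodule.comapSubtypeEquivOfLe hle).symm
  have : Module.Free ℤ (dualLattice B L) := Module.Free.of_basis bD
  have : Module.Finite ℤ (dualLattice B L) := Module.Finite.of_basis bD
  -- The index of L in its dual is the determinant expressing b in the dual basis, which is the Gram
  -- determinant of b. The Gram matrix is Aᵀ · diag(signs) · A with A the coordinate matrix of b, so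
  -- its determinant is ± det(A)².
  have h1 := Submodule.natAbs_det_basis_change bD (L.comap (dualLattice B L).subtype) bN
  rw [← h1]
  have h2 : ((bD.det ((↑) ∘ bN) : ℤ) : ℝ) = b'.det b := by
    rw [Module.Basis.det_apply, Module.Basis.det_apply, Int.cast_det]
    congr 1
    ext i j
    simp only [Matrix.map_apply, Module.Basis.toMatrix_apply]
    have h3 : ((bN j : dualLattice B L) : V) = b j := by
      simp [bN]
    have h4 := bD.sum_repr (bN j : dualLattice B L)
    have h5 := congrArg (fun z : dualLattice B L => (z : V)) h4
    simp only [Submodule.coe_sum, Submodule.coe_smul] at h5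
    have h6 : ∀ i, ((bD i : dualLattice B L) : V) = b' i := by
      intro i
      simp [bD]
    rw [h3] at h5
    simp only [h6] at h5
    change _ = b'.repr (b j) i
    simp only [← Int.cast_smul_eq_zsmul ℝ] at h5
    have h8 := b'.repr_sum_self (fun k => ((bD.repr (bN j : dualLattice B L) k : ℤ) : ℝ))
    rw [h5] at h8
    exact (congrFun h8 i).symm
  have h7 : b'.det b = (∏ i : Fin p ⊕ Fin n, sgn i)
      * LinearMap.det (basisCoord φ b : (Fin p ⊕ Fin n → ℝ) →ₗ[ℝ] (Fin p ⊕ Fin n → ℝ)) ^ 2 := by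
    set A := LinearMap.toMatrix' (basisCoord φ b : (Fin p ⊕ Fin n → ℝ) →ₗ[ℝ] (Fin p ⊕ Fin n → ℝ))
    have hA : ∀ i j, A i j = coord φ (b j) i := by
      intro i j
      change (LinearMap.toMatrix' _) i j = _
      rw [LinearMap.toMatrix'_apply]
      change basisCoord φ b (Pi.single j 1) i = _
      rw [basisCoord_apply]
      simp [Pi.single_apply]
    have hG : b'.toMatrix b = A.transpose * Matrix.diagonal sgn * A := by
      ext i j
      rw [Module.Basis.toMatrix_apply]
      have e1 : b'.repr (b j) i = B (b j) (b i) := by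
        have := bilin_sum_dualBasis hB b (fun k => b'.repr (b j) k) i
        rw [← hb', b'.sum_repr] at this
        exact this.symm
      rw [e1, bilin_eq_sum_coord hB, Matrix.mul_apply]
      refine Finset.sum_congr rfl fun k _ => ?_
      rw [Matrix.mul_diagonal, Matrix.transpose_apply, hA, hA]
      ring
    rw [Module.Basis.det_apply, hG, Matrix.det_mul, Matrix.det_mul, Matrix.det_transpose,
      Matrix.det_diagonal, LinearMap.det_toMatrix']
    ring
  have h8 : |∏ i : Fin p ⊕ Fin n, sgn i| = 1 := by
    rw [Finset.abs_prod]
    refine Finset.prod_eq_one fun i _ => ?_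
    rcases i with i | i <;> simp [sgn]
  rw [Nat.cast_natAbs, Int.cast_abs, h2, h7, abs_mul, h8, one_mul, abs_pow]

theorem finite_disc (hB : IsIsometryToStd B φ) {L : Submodule ℤ V} (hL : IsFullLattice L)
    (hLe : IsEvenLattice B L) : Finite (Disc B L) := by
  obtain ⟨b, rfl⟩ := exists_basis_of_isFullLattice φ hL
  have h := card_disc hB b hLe
  refine Nat.finite_of_card_ne_zero fun h0 => ?_
  rw [h0, Nat.cast_zero] at h
  have h1 : LinearMap.det (basisCoord φ b : (Fin p ⊕ Fin n → ℝ) →ₗ[ℝ] (Fin p ⊕ Fin n → ℝ)) ≠ 0 :=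
    (LinearEquiv.isUnit_det' _).ne_zero
  have : 0 < |LinearMap.det
    (basisCoord φ b : (Fin p ⊕ Fin n → ℝ) →ₗ[ℝ] (Fin p ⊕ Fin n → ℝ))| ^ 2 := by positivity
  exact this.ne h

/-- Integral coordinates on the lattice spanned by a basis. -/
def latticeEquiv {ι : Type*} [Fintype ι] (b : Module.Basis ι ℝ V) :
    (ι → ℤ) ≃ Submodule.span ℤ (Set.range b) :=
  (b.restrictScalars ℤ).equivFun.symm.toEquiv

theorem latticeEquiv_coe {ι : Type*} [Fintype ι] (b : Module.Basis ι ℝ V) (k : ι → ℤ) :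
    (latticeEquiv b k : V) = ∑ i, (k i : ℝ) • b i := by
  change (((b.restrictScalars ℤ).equivFun.symm k : Submodule.span ℤ (Set.range b)) : V) = _
  rw [Module.Basis.equivFun_symm_apply]
  simp [Int.cast_smul_eq_zsmul]

/-- The class of an element of the dual lattice. -/
theorem inClass_iff_sub_mem {L : Submodule ℤ V} {σ : Disc B L} {x₀ : V} (h₀ : InClass B L σ x₀)
    {x : V} (hL : L ≤ dualLattice B L) : InClass B L σ x ↔ x - x₀ ∈ L := by
  obtain ⟨h0, rfl⟩ := h₀
  constructor
  · rintro ⟨hx, h⟩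
    have := (Submodule.Quotient.eq _).mp h
    simpa using this
  · intro h
    have hx : x ∈ dualLattice B L := by
      have := (dualLattice B L).add_mem h0 (hL h)
      simpa using this
    refine ⟨hx, (Submodule.Quotient.eq _).mpr ?_⟩
    simpa using h

theorem inClass_repr {L : Submodule ℤ V} (σ : Disc B L) : InClass B L σ (repr B L σ) :=
  ⟨(Quotient.out σ).2, Quotient.out_eq σ⟩

/-- The elements of a class in the discriminant group form a translate of the lattice. -/
def classEquiv {L : Submodule ℤ V} {σ : Disc B L} {x₀ : V} (h₀ : InClass B L σ x₀)
    (hL : L ≤ dualLattice B L) : L ≃ {x : V // InClass B L σ x} where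
  toFun l := ⟨l + x₀, (inClass_iff_sub_mem h₀ hL).mpr (by simp)⟩
  invFun x := ⟨x - x₀, (inClass_iff_sub_mem h₀ hL).mp x.2⟩
  left_inv l := by simp
  right_inv x := by simp

/-- The dual lattice is the disjoint union of the classes of the discriminant group. -/
def dualEquivSigma (B : LinearMap.BilinForm ℝ V) (L : Submodule ℤ V) :
    (Σ σ : Disc B L, {x : V // InClass B L σ x}) ≃ dualLattice B L where
  toFun z := ⟨z.2.1, z.2.2.1⟩
  invFun x := ⟨Submodule.Quotient.mk x, ⟨x, x.2, rfl⟩⟩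
  left_inv := by
    rintro ⟨σ, x, hx, rfl⟩
    rfl
  right_inv x := rfl

end Coordinates
end JacobiTheta
end

noncomputable section

namespace JacobiTheta

open UpperHalfPlane

/-! ### Terms of theta series -/

section ThetaTerms

variable {V : Type*} [AddCommGroup V] [Module ℝ V] {p n : ℕ}

/-- The family equal to `t` on positive and to `t̄` on negative coordinates. -/
def twist (t : ℂ) : Fin p ⊕ Fin n → ℂ := Sum.elim (fun _ => t) (fun _ => (starRingEnd ℂ) t)

theorem twist_im (t : ℂ) (i : Fin p ⊕ Fin n) : (twist t i).im = sgn i * t.im := by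
  rcases i with i | i <;> simp [twist, sgn]

theorem twist_ne_zero {t : ℂ} (ht : t ≠ 0) (i : Fin p ⊕ Fin n) : twist t i ≠ 0 := by
  rcases i with i | i <;> simp [twist, ht]

/-- Extension by zero of a family on the positive coordinates. -/
def extZero (w : Fin p → ℂ) : Fin p ⊕ Fin n → ℂ := Sum.elim w 0

variable (φ : V ≃ₗ[ℝ] (Fin p → ℝ) × (Fin n → ℝ)) (η : V) (τ : ℍ) (z : ℂ) (α β : V)

/-- The exponential factor in the terms of the theta series. -/
def gaussTerm (x : V) : ℂ :=
  Complex.exp (∑ i, Real.pi * Complex.I * sgn i * (twist (τ : ℂ) i * (coord φ (x + β) i) ^ 2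
    + 2 * twist z i * coord φ (x + β) i * coord φ η i
    - (2 * coord φ x i + coord φ β i) * coord φ α i))

/-- The terms of the theta series. -/
def thetaTerm (k : ℕ) (P : MvPolynomial (Fin p) ℂ) (x : V) : ℂ :=
  evalReal (heatLin k τ.im P) (φ (x + (z.im / τ.im) • η + β)).1 * gaussTerm φ η τ z α β x

theorem sum_extZero_mul (w : Fin p → ℂ) (x : V) :
    ∑ i, extZero w i * (coord φ x i : ℂ) = ∑ i, w i * ((φ x).1 i : ℂ) := by
  rw [Fintype.sum_sum_type]
  simp [extZero, coord_inl]

/-- Conjugation of τ on the negative coordinates cancels the sign of the form, so the modulus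
involves the positive definite majorant. The vector α only contributes a phase. -/
theorem norm_gaussTerm (x : V) :
    ‖gaussTerm φ η τ z α β x‖ = Real.exp (-Real.pi * τ.im * ∑ i, coord φ (x + β) i ^ 2
      - 2 * Real.pi * z.im * ∑ i, coord φ (x + β) i * coord φ η i) := by
  rw [gaussTerm, Complex.norm_exp, Complex.re_sum, Finset.mul_sum, Finset.mul_sum,
    ← Finset.sum_sub_distrib]
  congr 1
  refine Finset.sum_congr rfl fun i _ => ?_
  have h : (Real.pi * Complex.I * sgn i * (twist (τ : ℂ) i * (coord φ (x + β) i) ^ 2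
      + 2 * twist z i * coord φ (x + β) i * coord φ η i
      - (2 * coord φ x i + coord φ β i) * coord φ α i) : ℂ)
      = Complex.I * ((Real.pi * sgn i * coord φ (x + β) i ^ 2 : ℝ) * twist (τ : ℂ) i
        + (2 * Real.pi * sgn i * coord φ (x + β) i * coord φ η i : ℝ) * twist z i
        - (Real.pi * sgn i * (2 * coord φ x i + coord φ β i) * coord φ α i : ℝ)) := by
    push_cast
    ring
  rw [h, Complex.I_mul_re, Complex.sub_im, Complex.add_im, Complex.im_ofReal_mul,
    Complex.im_ofReal_mul, twist_im, twist_im, Complex.ofReal_im]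
  change _ = -Real.pi * τ.im * _ - _
  have := sgn_mul_self i
  rw [UpperHalfPlane.coe_im]
  linear_combination (-Real.pi * coord φ (x + β) i ^ 2 * τ.im
    - 2 * Real.pi * coord φ (x + β) i * coord φ η i * z.im) * this

theorem norm_gaussTerm_le : ∃ ε K : ℝ, 0 < ε ∧ 0 ≤ K ∧ ∀ x, ‖gaussTerm φ η τ z α β x‖
    ≤ Real.exp (-ε * ‖coord φ (x + β)‖ ^ 2 + K * ‖coord φ (x + β)‖) := by
  refine ⟨Real.pi * τ.im, 2 * Real.pi * |z.im| * ∑ i, |coord φ η i|,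
    mul_pos Real.pi_pos τ.im_pos, by positivity, fun x => ?_⟩
  rw [norm_gaussTerm, Real.exp_le_exp]
  have h1 := mul_le_mul_of_nonneg_left (sq_norm_le_sum (coord φ (x + β)))
    (mul_pos Real.pi_pos τ.im_pos).le
  have h2 : |∑ i, coord φ (x + β) i * coord φ η i|
      ≤ (∑ i, |coord φ η i|) * ‖coord φ (x + β)‖ := by
    refine (Finset.abs_sum_le_sum_abs _ _).trans ?_
    rw [Finset.sum_mul]
    refine Finset.sum_le_sum fun i _ => ?_
    rw [abs_mul, mul_comm]
    exact mul_le_mul_of_nonneg_left (norm_le_pi_norm (coord φ (x + β)) i) (abs_nonneg _)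
  have h3 : -(z.im * ∑ i, coord φ (x + β) i * coord φ η i)
      ≤ |z.im| * ((∑ i, |coord φ η i|) * ‖coord φ (x + β)‖) := by
    refine (neg_le_abs _).trans ?_
    rw [abs_mul]
    exact mul_le_mul_of_nonneg_left h2 (abs_nonneg _)
  have h4 := mul_le_mul_of_nonneg_left h3 (by positivity : (0 : ℝ) ≤ 2 * Real.pi)
  nlinarith [h1, h4]

theorem summable_gaussTerm {L : Submodule ℤ V} (hL : IsFullLattice L) (x₀ : V) (K : ℝ) :
    Summable fun l : L => ‖gaussTerm φ η τ z α β (l + x₀)‖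
      * Real.exp (K * ‖coord φ (l + x₀ + β)‖) := by
  obtain ⟨m, b, rfl⟩ := hL
  obtain ⟨ε, K', hε, -, hle⟩ := norm_gaussTerm_le φ η τ z α β
  refine Summable.of_nonneg_of_le (fun _ => by positivity) (fun l => ?_)
    (summable_gaussian_span b (coord φ).toLinearMap (coord φ).injective (coord φ (x₀ + β)) hε
      (K' + K))
  refine (mul_le_mul_of_nonneg_right (hle _) (Real.exp_nonneg _)).trans ?_
  rw [← Real.exp_add, Real.exp_le_exp]
  have : coord φ (l + x₀ + β) = (coord φ).toLinearMap l + coord φ (x₀ + β) := by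
    rw [LinearEquiv.coe_coe, ← map_add, add_assoc]
  rw [this]
  exact le_of_eq (by ring)

theorem norm_fst_le (x : V) : ‖(φ x).1‖ ≤ ‖coord φ x‖ := by
  rw [pi_norm_le_iff_of_nonneg (norm_nonneg _)]
  exact fun i => norm_le_pi_norm (coord φ x) (Sum.inl i)

/-- The growth of f may be measured from a centre y different from the centre β of the Gaussian; the
shift costs only a constant factor. -/
theorem summable_gaussTerm_mul {L : Submodule ℤ V} (hL : IsFullLattice L) (x₀ y : V) {C K : ℝ}
    {f : V → ℂ} (hf : ∀ x, ‖f x‖ ≤ C * Real.exp (K * ‖coord φ (x + y)‖)) (hK : 0 ≤ K)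
    (hC : 0 ≤ C) :
    Summable fun l : L => ‖f (l + x₀)‖ * ‖gaussTerm φ η τ z α β (l + x₀)‖ := by
  have h := (summable_gaussTerm φ η τ z α β hL x₀ K).mul_left
    (C * Real.exp (K * ‖coord φ (y - β)‖))
  refine Summable.of_nonneg_of_le (fun _ => by positivity) (fun l => ?_) h
  rw [mul_comm ‖gaussTerm _ _ _ _ _ _ _‖, ← mul_assoc]
  refine mul_le_mul_of_nonneg_right ((hf _).trans ?_) (norm_nonneg _)
  rw [mul_assoc, ← Real.exp_add]
  refine mul_le_mul_of_nonneg_left (Real.exp_le_exp.mpr ?_) hC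
  rw [← mul_add]
  refine mul_le_mul_of_nonneg_left ?_ hK
  have : coord φ (l + x₀ + y) = coord φ (y - β) + coord φ (l + x₀ + β) := by
    rw [← map_add]
    congr 1
    abel
  rw [this]
  exact norm_add_le _ _

theorem summable_thetaTerm {L : Submodule ℤ V} (hL : IsFullLattice L) (x₀ : V) (k : ℕ)
    (P : MvPolynomial (Fin p) ℂ) :
    Summable fun l : L => ‖thetaTerm φ η τ z α β k P (l + x₀)‖ := by
  obtain ⟨C, K, hC, hK, h⟩ := exists_norm_evalReal_le (heatLin k τ.im P)
  simp only [thetaTerm, norm_mul]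
  refine summable_gaussTerm_mul (f := fun x =>
    evalReal (heatLin k τ.im P) (φ (x + (z.im / τ.im) • η + β)).1) φ η τ z α β hL x₀
    ((z.im / τ.im) • η + β) (fun x => ?_) hK hC
  refine (h _).trans (mul_le_mul_of_nonneg_left (Real.exp_le_exp.mpr
    (mul_le_mul_of_nonneg_left ?_ hK)) hC)
  rw [← add_assoc]
  exact norm_fst_le φ _

end ThetaTerms
end JacobiTheta
end

noncomputable section

namespace JacobiTheta

open UpperHalfPlane

/-! ### The inversion formula -/

section Inversion

variable {V : Type*} [AddCommGroup V] [Module ℝ V] {p n : ℕ}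
variable {B : LinearMap.BilinForm ℝ V} {φ : V ≃ₗ[ℝ] (Fin p → ℝ) × (Fin n → ℝ)}

/-- The comparison of exponents in a single coordinate: ε is the sign, T and Z are τ and z or their
conjugates, and x, D, H are coordinates of the base point, the dual vector and η. The last two
hypotheses carry the factor w because they are available only on positive coordinates; on negative
ones w = 0. -/
theorem inversion_exponent {ε T Z w t H v x β α D r r' q q' : ℂ} (hε : ε * ε = 1) (hT : T ≠ 0)
    (hv : v = x + α)
    (h1 : w * (Z + r') = w * (T * r))
    (h2 : w * (T / (4 * Real.pi * Complex.I * ε) - q') = w * (-(q * T ^ 2))) :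
    2 * Real.pi * Complex.I * (-(ε * D)) * v
      + ((2 * Real.pi * Complex.I * ε * (Z * H / T + β) + t * w)
        - 2 * Real.pi * Complex.I * (-(ε * D))) ^ 2 / (4 * (Real.pi * Complex.I * ε / T))
      + (-(w ^ 2 * q') * t ^ 2 + w * r' * H * t - Real.pi * Complex.I * ε * α * β)
    = Real.pi * Complex.I * ε * Z ^ 2 * H ^ 2 / T - 2 * Real.pi * Complex.I * (ε * x * D)
      + Real.pi * Complex.I * ε * (T * (D + β) ^ 2 + 2 * Z * (D + β) * H - (2 * D + β) * α)
      + (-(w ^ 2 * (q * T ^ 2)) * t ^ 2 + T * (w * (D + r * H + β)) * t) := by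
  have hε0 : ε ≠ 0 := fun h => by simp [h] at hε
  have hpi : (Real.pi : ℂ) ≠ 0 := by exact_mod_cast Real.pi_ne_zero
  have hI := Complex.I_ne_zero
  have e1 : ((2 * Real.pi * Complex.I * ε * (Z * H / T + β) + t * w)
        - 2 * Real.pi * Complex.I * (-(ε * D))) ^ 2 / (4 * (Real.pi * Complex.I * ε / T))
      = Real.pi * Complex.I * ε * T * (Z * H / T + β + D) ^ 2 + T * t * w * (Z * H / T + β + D)
        + w * (w * (T / (4 * Real.pi * Complex.I * ε))) * t ^ 2 := by
    field_simp
    ring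
  have e2 : w * (T / (4 * Real.pi * Complex.I * ε)) = w * q' - w * (q * T ^ 2) := by
    linear_combination h2
  have e3 : Z * H / T = (Z / T) * H := by ring
  have e5 : Real.pi * Complex.I * ε * Z ^ 2 * H ^ 2 / T
      = Real.pi * Complex.I * ε * T * ((Z / T) * H) ^ 2 := by field_simp
  have e6 : Z = T * (Z / T) := by field_simp
  rw [e1, e2, e3, e5, hv]
  generalize Z / T = s at *
  subst e6
  linear_combination (t * H) * h1

theorem inversion_re {T ε : ℂ} (hT : 0 < (T / (Complex.I * ε)).re) :
    0 < (Real.pi * Complex.I * ε / T).re := by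
  have h : (Real.pi * Complex.I * ε / T : ℂ) = (Real.pi : ℝ) * (T / (Complex.I * ε))⁻¹ := by
    rw [inv_div, mul_assoc, mul_div_assoc]
  rw [h, Complex.re_ofReal_mul, Complex.inv_re]
  refine mul_pos Real.pi_pos (div_pos hT (Complex.normSq_pos.mpr ?_))
  intro h0
  simp [h0] at hT

theorem twist_div_re (τ : ℍ) (i : Fin p ⊕ Fin n) :
    0 < (twist (τ : ℂ) i / (Complex.I * sgn i)).re := by
  have h : twist (τ : ℂ) i / (Complex.I * sgn i) = -Complex.I * ((sgn i : ℝ) * twist (τ : ℂ) i) := by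
    have h1 : (sgn i : ℂ) * sgn i = 1 := by exact_mod_cast sgn_mul_self i
    have h2 : (sgn i : ℂ) ≠ 0 := fun h => by simp [h] at h1
    rw [div_eq_iff (mul_ne_zero Complex.I_ne_zero h2)]
    linear_combination (-twist (τ : ℂ) i) * h1 + (sgn i * sgn i * twist (τ : ℂ) i) * Complex.I_mul_I
  rw [h, neg_mul, Complex.neg_re, Complex.I_mul_re, neg_neg, Complex.im_ofReal_mul, twist_im,
    ← mul_assoc, sgn_mul_self, one_mul]
  exact τ.im_pos

/-- Integral coordinates on the dual lattice. -/
def dualEquiv (hB : IsIsometryToStd B φ) (b : Module.Basis (Fin p ⊕ Fin n) ℝ V) :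
    (Fin p ⊕ Fin n → ℤ) ≃ dualLattice B (Submodule.span ℤ (Set.range b)) :=
  -- The reversal of signs makes the Poisson character at base point x₀ equal to e(-(x₀, δ)), the
  -- convention of the Weil representation.
  ((Equiv.neg _).trans (latticeEquiv (B.dualBasis (bilin_nondegenerate hB) b))).trans
    (LinearEquiv.ofEq _ _ (dualLattice_eq_span hB b).symm).toEquiv

theorem dualCoord_eq (hB : IsIsometryToStd B φ) (b : Module.Basis (Fin p ⊕ Fin n) ℝ V)
    (m : Fin p ⊕ Fin n → ℤ) (i : Fin p ⊕ Fin n) :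
    dualCoord hB b (fun i => (m i : ℝ)) i = -(sgn i * coord φ (dualEquiv hB b m : V) i) := by
  rw [dualCoord_apply]
  have : (dualEquiv hB b m : V) = -∑ j, (m j : ℝ) • B.dualBasis (bilin_nondegenerate hB) b j := by
    change (latticeEquiv (B.dualBasis (bilin_nondegenerate hB) b) (-m) : V) = _
    rw [latticeEquiv_coe]
    simp [Finset.sum_neg_distrib]
  rw [this, map_neg, Pi.neg_apply]
  ring

/-- The constant in the inversion formula. -/
def inversionFactor (φ : V ≃ₗ[ℝ] (Fin p → ℝ) × (Fin n → ℝ)) (η : V) (τ : ℍ) (z : ℂ) : ℂ :=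
  (∏ i : Fin p ⊕ Fin n, (twist (τ : ℂ) i / (Complex.I * sgn i)) ^ (1 / 2 : ℂ)) *
    Complex.exp (∑ i, Real.pi * Complex.I * sgn i * twist z i ^ 2 * coord φ η i ^ 2
      / twist (τ : ℂ) i)

theorem inversion_im {τ τ' : ℍ} (hτ : (τ' : ℂ) = -(τ : ℂ)⁻¹) :
    τ'.im = τ.im / Complex.normSq τ := by
  have := congrArg Complex.im hτ
  rw [Complex.neg_im, Complex.inv_im, neg_div, neg_neg] at this
  exact this

/-- Hence the linear form w evaluated at τ(δ + (Im z/Im τ)η) equals its value at τδ + zη plus the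
shift by η that belongs to (-1/τ, z/τ). So the argument λ + (y₂/y₁)η of the polynomial is the one
compatible with inversion. -/
theorem inversion_shift {τ τ' : ℍ} (hτ : (τ' : ℂ) = -(τ : ℂ)⁻¹) (z : ℂ) :
    z + ((z / τ).im / τ'.im : ℝ) = τ * (z.im / τ.im : ℝ) := by
  have hN : Complex.normSq τ ≠ 0 := UpperHalfPlane.normSq_ne_zero τ
  have hy := τ.im_ne_zero
  have h : (z / τ).im / τ'.im = (z.im * τ.re - z.re * τ.im) / τ.im := by
    rw [inversion_im hτ, Complex.div_im, UpperHalfPlane.coe_im, UpperHalfPlane.coe_re]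
    field_simp
  rw [h]
  apply Complex.ext
  · rw [Complex.add_re, Complex.ofReal_re, Complex.re_mul_ofReal, UpperHalfPlane.coe_re]
    field_simp
    ring
  · rw [Complex.add_im, Complex.ofReal_im, Complex.im_mul_ofReal, UpperHalfPlane.coe_im]
    field_simp
    ring

/-- Completing the square in Poisson summation produces a term in t². It is exactly the difference
between the heat operators at -1/τ and at τ, up to the scaling by τ²; this is why exp(-Δ/8πy) is
applied to P. -/
theorem inversion_heat {τ τ' : ℍ} (hτ : (τ' : ℂ) = -(τ : ℂ)⁻¹) :
    (τ : ℂ) / (4 * Real.pi * Complex.I) - 1 / (8 * Real.pi * τ'.im)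
      = -(1 / (8 * Real.pi * τ.im) * (τ : ℂ) ^ 2) := by
  have hN : (Complex.normSq τ : ℂ) ≠ 0 := by exact_mod_cast UpperHalfPlane.normSq_ne_zero τ
  have hy : (τ.im : ℂ) ≠ 0 := by exact_mod_cast τ.im_ne_zero
  have hpi : (Real.pi : ℂ) ≠ 0 := by exact_mod_cast Real.pi_ne_zero
  have h1 : (Complex.normSq τ : ℂ) = τ * (starRingEnd ℂ) (τ : ℂ) := (Complex.mul_conj _).symm
  have h2 : (τ : ℂ) - (starRingEnd ℂ) (τ : ℂ) = 2 * Complex.I * τ.im := by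
    rw [Complex.sub_conj, UpperHalfPlane.coe_im]
    push_cast
    ring
  have h3 : (τ : ℂ) / (4 * Real.pi * Complex.I) = -(Complex.I * τ / (4 * Real.pi)) := by
    have := Complex.I_mul_I
    field_simp
    linear_combination (τ : ℂ) * this
  rw [inversion_im hτ, h3, Complex.ofReal_div, h1]
  have h4 : (1 / (8 * Real.pi * (τ.im / (τ * (starRingEnd ℂ) (τ : ℂ)))) : ℂ)
      = τ * (starRingEnd ℂ) (τ : ℂ) / (8 * Real.pi * τ.im) := by
    rw [← mul_div_assoc, one_div_div]
  rw [h4]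
  field_simp
  linear_combination (4 * (τ : ℂ)) * h2

/-- The inversion formula for generating functions: it is `tsum_gaussian` with quadratic
coefficients πiε/τ, conjugated on negative coordinates. On the dual side t occurs only through τt,
so its coefficient of t^k acquires the factor τ^k. -/
theorem tsum_gaussTerm_inversion (hB : IsIsometryToStd B φ)
    (b : Module.Basis (Fin p ⊕ Fin n) ℝ V) (η : V) {τ τ' : ℍ} (hτ : (τ' : ℂ) = -(τ : ℂ)⁻¹)
    (z : ℂ) (α β x₀ : V) (w : Fin p → ℂ) (t : ℂ) :
    ∑' l : Submodule.span ℤ (Set.range b), gaussTerm φ η τ' (z / τ) (-β) α (l + x₀)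
        * Complex.exp (-((∑ i, w i ^ 2) / (8 * Real.pi * τ'.im)) * t ^ 2
          + (∑ i, w i * ((φ (l + x₀ + ((z / τ).im / τ'.im) • η + α)).1 i : ℂ)) * t)
      = (|LinearMap.det (basisCoord φ b : (Fin p ⊕ Fin n → ℝ) →ₗ[ℝ] (Fin p ⊕ Fin n → ℝ))|⁻¹ : ℝ)
        * inversionFactor φ η τ z
        * ∑' δ : dualLattice B (Submodule.span ℤ (Set.range b)),
          e (-(B x₀ δ : ℝ)) * gaussTerm φ η τ z α β δ
          * Complex.exp (-((∑ i, w i ^ 2) / (8 * Real.pi * τ.im) * (τ : ℂ) ^ 2) * t ^ 2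
            + τ * (∑ i, w i * ((φ (δ + (z.im / τ.im) • η + β)).1 i : ℂ)) * t) := by
  have hτ0 : (τ : ℂ) ≠ 0 := UpperHalfPlane.ne_zero τ
  set r : ℝ := z.im / τ.im with hr
  set r' : ℝ := (z / τ).im / τ'.im with hr'
  set q : ℂ := 1 / (8 * Real.pi * τ.im) with hq
  set q' : ℂ := 1 / (8 * Real.pi * τ'.im) with hq'
  set bb : Fin p ⊕ Fin n → ℂ := fun i => Real.pi * Complex.I * sgn i / twist (τ : ℂ) i with hbb
  set cc : Fin p ⊕ Fin n → ℂ := fun i => 2 * Real.pi * Complex.I * sgn i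
    * (twist z i * coord φ η i / twist (τ : ℂ) i + coord φ β i) + t * extZero w i with hcc
  set v : Fin p ⊕ Fin n → ℝ := coord φ (x₀ + α) with hv
  have hW : ∑ i, w i ^ 2 = ∑ i : Fin p ⊕ Fin n, extZero w i ^ 2 := by
    rw [Fintype.sum_sum_type]
    simp [extZero]
  have htw : ∀ i : Fin p ⊕ Fin n, twist (τ' : ℂ) i = -(twist (τ : ℂ) i)⁻¹ := by
    intro i
    rcases i with i | i <;> simp [twist, hτ]
  have htz : ∀ i : Fin p ⊕ Fin n, twist (z / τ) i = twist z i / twist (τ : ℂ) i := by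
    intro i
    rcases i with i | i <;> simp [twist]
  set K1 : ℂ := ∑ i, (-(extZero w i ^ 2 * q') * t ^ 2 + extZero w i * r' * coord φ η i * t
    - Real.pi * Complex.I * sgn i * coord φ α i * coord φ β i) with hK1
  have hL : ∀ k : Fin p ⊕ Fin n → ℤ,
      gaussTerm φ η τ' (z / τ) (-β) α (latticeEquiv b k + x₀)
        * Complex.exp (-((∑ i, w i ^ 2) / (8 * Real.pi * τ'.im)) * t ^ 2
          + (∑ i, w i * ((φ (latticeEquiv b k + x₀ + r' • η + α)).1 i : ℂ)) * t)
      = Complex.exp K1 * gaussian bb cc (basisCoord φ b (fun i => (k i : ℝ)) + v) := by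
    intro k
    rw [gaussTerm, gaussian, ← Complex.exp_add, ← Complex.exp_add, ← sum_extZero_mul, hW]
    congr 1
    rw [basisCoord_apply, ← latticeEquiv_coe, hv, ← map_add, Finset.sum_div, ← Finset.sum_neg_distrib,
      Finset.sum_mul, Finset.sum_mul, ← Finset.sum_add_distrib, ← Finset.sum_add_distrib, hK1,
      ← Finset.sum_neg_distrib, ← Finset.sum_add_distrib, ← Finset.sum_add_distrib]
    refine Finset.sum_congr rfl fun i _ => ?_
    rw [htw, htz, add_assoc (latticeEquiv b k : V) x₀ α]
    simp only [map_add, map_neg, map_smul, Pi.add_apply, Pi.neg_apply, Pi.smul_apply, smul_eq_mul,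
      hbb, hcc, hq']
    push_cast
    ring
  have hR : ∀ m : Fin p ⊕ Fin n → ℤ,
      Complex.exp K1 * Complex.exp (∑ i, (2 * Real.pi * Complex.I
          * (dualCoord hB b (fun i => (m i : ℝ)) i) * v i
          + (cc i - 2 * Real.pi * Complex.I * (dualCoord hB b (fun i => (m i : ℝ)) i)) ^ 2
            / (4 * bb i)))
      = Complex.exp (∑ i, Real.pi * Complex.I * sgn i * twist z i ^ 2 * coord φ η i ^ 2
          / twist (τ : ℂ) i)
        * (e (-(B x₀ (dualEquiv hB b m) : ℝ)) * gaussTerm φ η τ z α β (dualEquiv hB b m)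
          * Complex.exp (-((∑ i, w i ^ 2) / (8 * Real.pi * τ.im) * (τ : ℂ) ^ 2) * t ^ 2
            + τ * (∑ i, w i * ((φ (dualEquiv hB b m + r • η + β)).1 i : ℂ)) * t)) := by
    intro m
    rw [gaussTerm, e, ← Complex.exp_add, ← Complex.exp_add, ← Complex.exp_add, ← Complex.exp_add,
      ← sum_extZero_mul, hW, bilin_eq_sum_coord hB]
    congr 1
    rw [hK1, Complex.ofReal_sum, mul_neg, Finset.mul_sum, Finset.sum_div,
      Finset.sum_mul, ← Finset.sum_neg_distrib, ← Finset.sum_neg_distrib, Finset.sum_mul,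
      Finset.mul_sum, Finset.sum_mul, ← Finset.sum_add_distrib, ← Finset.sum_add_distrib,
      ← Finset.sum_add_distrib, ← Finset.sum_add_distrib, ← Finset.sum_add_distrib]
    refine Finset.sum_congr rfl fun i _ => ?_
    set δ : V := (dualEquiv hB b m).1
    have key := inversion_exponent (ε := (sgn i : ℂ)) (T := twist (τ : ℂ) i) (Z := twist z i)
      (w := extZero w i) (t := t) (H := coord φ η i) (v := v i) (x := coord φ x₀ i)
      (β := coord φ β i) (α := coord φ α i) (D := coord φ δ i) (r := r) (r' := r') (q := q)
      (q' := q') (by exact_mod_cast sgn_mul_self i) (twist_ne_zero hτ0 i)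
      (by rw [hv, map_add]; push_cast [Pi.add_apply]; ring)
      (by
        rcases i with i | i
        · have := inversion_shift hτ z
          simp only [twist, Sum.elim_inl]
          rw [this]
        · simp [extZero])
      (by
        rcases i with i | i
        · have := inversion_heat hτ
          simp only [twist, sgn, Sum.elim_inl, Complex.ofReal_one, mul_one]
          rw [this]
        · simp [extZero])
    rw [add_comm, dualCoord_eq]
    simp only [map_add, map_smul, Pi.add_apply, Pi.smul_apply, smul_eq_mul, hbb, hcc, hq] at key ⊢
    push_cast at key ⊢
    have hwt : extZero w i * twist (τ : ℂ) i = extZero w i * τ := by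
      rcases i with i | i <;> simp [extZero, twist]
    linear_combination key + (t * (coord φ δ i + r * coord φ η i + coord φ β i)
      - t ^ 2 * extZero w i / (8 * Real.pi * τ.im) * (twist (τ : ℂ) i + τ)) * hwt
  rw [← (latticeEquiv b).tsum_eq, ← (dualEquiv hB b).tsum_eq]
  simp only [hL]
  rw [tsum_mul_left, tsum_gaussian (fun i => inversion_re (twist_div_re τ i)) cc (basisCoord φ b)
    (dualCoord hB b) (sum_dualCoord_mul_basisCoord hB b) v]
  have hprod : ∏ i, (Real.pi / bb i) ^ (1 / 2 : ℂ)
      = ∏ i : Fin p ⊕ Fin n, (twist (τ : ℂ) i / (Complex.I * sgn i)) ^ (1 / 2 : ℂ) := by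
    refine Finset.prod_congr rfl fun i _ => ?_
    congr 1
    have hpi : (Real.pi : ℂ) ≠ 0 := by exact_mod_cast Real.pi_ne_zero
    simp only [hbb]
    rw [div_div_eq_mul_div, mul_assoc, mul_div_mul_left _ _ hpi]
  rw [hprod, inversionFactor]
  have hfin := congrArg (fun s : (Fin p ⊕ Fin n → ℤ) → ℂ => ∑' m, s m) (funext hR)
  simp only [tsum_mul_left] at hfin
  linear_combination (((|LinearMap.det (basisCoord φ b :
    (Fin p ⊕ Fin n → ℝ) →ₗ[ℝ] (Fin p ⊕ Fin n → ℝ))|⁻¹ : ℝ) : ℂ)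
    * (∏ i : Fin p ⊕ Fin n, (twist (τ : ℂ) i / (Complex.I * sgn i)) ^ (1 / 2 : ℂ))) * hfin

end Inversion
end JacobiTheta
end

noncomputable section

namespace JacobiTheta

open UpperHalfPlane

/-! ### Transformation of theta functions under the generators -/

section Generators

variable {V : Type*} [AddCommGroup V] [Module ℝ V] {p n : ℕ}
variable {B : LinearMap.BilinForm ℝ V} {φ : V ≃ₗ[ℝ] (Fin p → ℝ) × (Fin n → ℝ)}

theorem isFullLattice_span (b : Module.Basis (Fin p ⊕ Fin n) ℝ V) :
    IsFullLattice (Submodule.span ℤ (Set.range b)) :=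
  ⟨p + n, b.reindex finSumFinEquiv, by rw [Module.Basis.range_reindex]⟩

theorem isFullLattice_dualLattice (hB : IsIsometryToStd B φ) {L : Submodule ℤ V}
    (hL : IsFullLattice L) : IsFullLattice (dualLattice B L) := by
  obtain ⟨b, rfl⟩ := exists_basis_of_isFullLattice φ hL
  rw [dualLattice_eq_span hB b]
  exact isFullLattice_span _

theorem e_add (s t : ℂ) : e (s + t) = e s * e t := by
  rw [e, e, e, ← Complex.exp_add, mul_add]

theorem e_int (m : ℤ) : e m = 1 := by
  rw [e, Complex.exp_eq_one_iff]
  exact ⟨m, by ring⟩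

theorem norm_e_ofReal (t : ℝ) : ‖e t‖ = 1 := by
  rw [e, show (2 * Real.pi * Complex.I * t : ℂ) = (2 * Real.pi * t : ℝ) * Complex.I by
    push_cast; ring, Complex.norm_exp_ofReal_mul_I]

theorem exists_norm_sum_mul_le (φ : V ≃ₗ[ℝ] (Fin p → ℝ) × (Fin n → ℝ)) (w : Fin p → ℂ) (x : V) :
    ‖∑ i, w i * ((φ x).1 i : ℂ)‖ ≤ (∑ i, ‖w i‖) * ‖coord φ x‖ := by
  refine (norm_sum_le _ _).trans ?_
  rw [Finset.sum_mul]
  refine Finset.sum_le_sum fun i _ => ?_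
  rw [norm_mul, Complex.norm_real]
  exact mul_le_mul_of_nonneg_left (norm_le_pi_norm (coord φ x) (Sum.inl i)) (norm_nonneg _)

theorem summable_gaussTerm_exp {L : Submodule ℤ V} (hL : IsFullLattice L) (η : V) (τ : ℍ) (z : ℂ)
    (α β x₀ y : V) (w : Fin p → ℂ) :
    Summable fun l : L => ‖gaussTerm φ η τ z α β (l + x₀)‖
      * Real.exp ‖∑ i, w i * ((φ (l + x₀ + y)).1 i : ℂ)‖ := by
  have h := summable_gaussTerm_mul (f := fun x =>
    ((Real.exp ‖∑ i, w i * ((φ (x + y)).1 i : ℂ)‖ : ℝ) : ℂ)) φ η τ z α β hL x₀ y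
    (C := 1) (K := ∑ i, ‖w i‖) (fun x => by
      rw [Complex.norm_real, Real.norm_of_nonneg (Real.exp_nonneg _), one_mul, Real.exp_le_exp]
      exact exists_norm_sum_mul_le φ w _) (by positivity) zero_le_one
  refine h.congr fun l => ?_
  rw [Complex.norm_real, Real.norm_of_nonneg (Real.exp_nonneg _), mul_comm]

/-- For powers of linear forms, compare the coefficients of t^k in `tsum_gaussTerm_inversion`; both
sides are linear in P. The summability statements are what makes linearity pass through the infinite
sums. -/
theorem tsum_thetaTerm_inversion (hB : IsIsometryToStd B φ)
    (b : Module.Basis (Fin p ⊕ Fin n) ℝ V) (η : V) {τ τ' : ℍ} (hτ : (τ' : ℂ) = -(τ : ℂ)⁻¹)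
    (z : ℂ) (α β x₀ : V) {k : ℕ} {P : MvPolynomial (Fin p) ℂ} (hP : P.IsHomogeneous k) :
    ∑' l : Submodule.span ℤ (Set.range b), thetaTerm φ η τ' (z / τ) (-β) α k P (l + x₀)
      = (|LinearMap.det (basisCoord φ b : (Fin p ⊕ Fin n → ℝ) →ₗ[ℝ] (Fin p ⊕ Fin n → ℝ))|⁻¹ : ℝ)
        * inversionFactor φ η τ z * (τ : ℂ) ^ k
        * ∑' δ : dualLattice B (Submodule.span ℤ (Set.range b)),
          e (-(B x₀ δ : ℝ)) * thetaTerm φ η τ z α β k P δ := by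
  have hL := isFullLattice_span b
  have hL' := isFullLattice_dualLattice hB hL
  have hs1 : ∀ P, Summable fun l : Submodule.span ℤ (Set.range b) =>
      thetaTerm φ η τ' (z / τ) (-β) α k P (l + x₀) := fun P =>
    (summable_thetaTerm φ η τ' (z / τ) (-β) α hL x₀ k P).of_norm
  have hs2 : ∀ P, Summable fun δ : dualLattice B (Submodule.span ℤ (Set.range b)) =>
      e (-(B x₀ δ : ℝ)) * thetaTerm φ η τ z α β k P δ := by
    intro P
    have h := summable_thetaTerm φ η τ z α β hL' 0 k P
    simp only [add_zero] at h
    refine Summable.of_norm (h.congr fun δ => ?_)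
    rw [norm_mul, ← Complex.ofReal_neg, norm_e_ofReal, one_mul]
  have hmem := mem_span_linForm_pow hP
  clear hP
  induction hmem using Submodule.span_induction with
  | mem P h =>
    obtain ⟨w, rfl⟩ := h
    simp only [thetaTerm, heatLin_linForm_pow k _ w _ (N := k) (by omega)]
    set r : ℝ := z.im / τ.im with hr
    set r' : ℝ := (z / τ).im / τ'.im with hr'
    set Cc := ((|LinearMap.det (basisCoord φ b :
      (Fin p ⊕ Fin n → ℝ) →ₗ[ℝ] (Fin p ⊕ Fin n → ℝ))|⁻¹ : ℝ) : ℂ) * inversionFactor φ η τ z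
    have h1 := summable_gaussTerm_exp (φ := φ) hL η τ' (z / τ) (-β) α x₀ (r' • η + α) w
    have h2 := summable_gaussTerm_exp (φ := φ) hL' η τ z α β 0 (r • η + β) (fun i => τ * w i)
    have h2' : Summable fun δ : dualLattice B (Submodule.span ℤ (Set.range b)) =>
        ‖Cc * (e (-(B x₀ δ : ℝ)) * gaussTerm φ η τ z α β δ)‖
          * Real.exp ‖τ * ∑ i, w i * ((φ (δ + r • η + β)).1 i : ℂ)‖ := by
      refine (h2.mul_left ‖Cc‖).congr fun δ => ?_
      rw [norm_mul Cc, norm_mul (e _), ← Complex.ofReal_neg, norm_e_ofReal, one_mul, add_zero,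
        mul_assoc, Finset.mul_sum, add_assoc]
      simp only [mul_assoc]
    have h1' : Summable fun l : Submodule.span ℤ (Set.range b) =>
        ‖gaussTerm φ η τ' (z / τ) (-β) α (l + x₀)‖
          * Real.exp ‖∑ i, w i * ((φ (l + x₀ + r' • η + α)).1 i : ℂ)‖ := by
      refine h1.congr fun l => ?_
      rw [add_assoc (l + x₀ : V) (r' • η)]
    have key := tsum_hermiteCoeff_eq h1' h2' (a := (∑ i, w i ^ 2) / (8 * Real.pi * τ'.im))
      (a' := (∑ i, w i ^ 2) / (8 * Real.pi * τ.im) * (τ : ℂ) ^ 2) (fun t _ => by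
        have := tsum_gaussTerm_inversion hB b η hτ z α β x₀ w t
        rw [← tsum_mul_left] at this
        simp only [Cc]
        rw [this]
        exact tsum_congr fun _ => by ring) k
    have e1 : ∀ x y : ℂ, ((k.factorial : ℂ) * x) * y = k.factorial * (y * x) := fun x y => by ring
    simp only [e1]
    rw [tsum_mul_left, key, ← tsum_mul_left, ← tsum_mul_left]
    refine tsum_congr fun δ => ?_
    have h4 := hermiteCoeff_scale k ((∑ i, w i ^ 2) / (8 * Real.pi * τ.im))
      (∑ i, w i * ((φ (δ + r • η + β)).1 i : ℂ)) τ
    rw [mul_comm (τ : ℂ) (∑ i, w i * _), h4]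
    ring
  | zero => simp [thetaTerm, evalReal]
  | add P Q _ _ ihP ihQ =>
    have e1 : ∀ (τ : ℍ) z α β x, thetaTerm φ η τ z α β k (P + Q) x
        = thetaTerm φ η τ z α β k P x + thetaTerm φ η τ z α β k Q x := by
      intro τ z α β x
      simp [thetaTerm, evalReal, add_mul]
    simp only [e1, mul_add]
    rw [(hs1 P).tsum_add (hs1 Q), (hs2 P).tsum_add (hs2 Q), mul_add, ihP, ihQ]
  | smul c P _ ih =>
    have e1 : ∀ (τ : ℍ) z α β x, thetaTerm φ η τ z α β k (c • P) x
        = c * thetaTerm φ η τ z α β k P x := by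
      intro τ z α β x
      simp [thetaTerm, evalReal, mul_assoc]
    simp only [e1, mul_left_comm _ c]
    rw [tsum_mul_left, tsum_mul_left, ih]
    ring

/-- The theta function of a lattice in a space with coordinates `φ`. -/
def thetaVec (B : LinearMap.BilinForm ℝ V) (L : Submodule ℤ V)
    (φ : V ≃ₗ[ℝ] (Fin p → ℝ) × (Fin n → ℝ)) (η : V) (k : ℕ) (P : MvPolynomial (Fin p) ℂ)
    (τ : ℍ) (z : ℂ) (α β : V) : Disc B L → ℂ := fun σ =>
  ((τ.im ^ ((n : ℝ) / 2) * Real.exp (-2 * Real.pi * (∑ j, (φ η).2 j ^ 2) * (z.im ^ 2 / τ.im)) : ℝ)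
      : ℂ)
    * ∑' x : {x : V // InClass B L σ x}, thetaTerm φ η τ z α β k P x

/-- Replacing τ by τ + 1 adds q(x + β), and replacing α by α + β subtracts (x + β/2, β); the
difference is q(x). -/
theorem gaussTerm_translation (hB : IsIsometryToStd B φ) (η : V) {τ τ' : ℍ}
    (hτ : (τ' : ℂ) = τ + 1) (z : ℂ) (α β x : V) :
    gaussTerm φ η τ' z (α + β) β x = e (quad B x) * gaussTerm φ η τ z α β x := by
  rw [gaussTerm, gaussTerm, e, ← Complex.exp_add, quad, bilin_eq_sum_coord hB]
  congr 1
  rw [Complex.ofReal_div, Complex.ofReal_sum, Finset.sum_div, Finset.mul_sum,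
    ← Finset.sum_add_distrib]
  refine Finset.sum_congr rfl fun i _ => ?_
  have h : twist (τ' : ℂ) i = twist (τ : ℂ) i + 1 := by
    rcases i with i | i <;> simp [twist, hτ]
  rw [h]
  simp only [map_add, Pi.add_apply]
  push_cast
  ring

theorem thetaVec_translation (hB : IsIsometryToStd B φ) {L : Submodule ℤ V}
    (hLe : IsEvenLattice B L) (η : V) (k : ℕ) (P : MvPolynomial (Fin p) ℂ)
    {τ τ' : ℍ} (hτ : (τ' : ℂ) = τ + 1) (z : ℂ) (α β : V) {σ : Disc B L} {x₀ : V}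
    (h₀ : InClass B L σ x₀) :
    thetaVec B L φ η k P τ' z (α + β) β σ = e (quad B x₀) * thetaVec B L φ η k P τ z α β σ := by
  have hy : τ'.im = τ.im := by
    have := congrArg Complex.im hτ
    simpa using this
  have hle : L ≤ dualLattice B L := fun x hx => mem_dualLattice_of_mem hB hLe hx
  -- Modulo 1 the form q is constant on x₀ + L: the change q(l) + (l, x₀) is integral because L is
  -- even and x₀ is in the dual lattice.
  have h : ∀ x : {x : V // InClass B L σ x}, e (quad B x) = e (quad B x₀) := by
    intro x
    have h0 := h₀.1
    have hx := (inClass_iff_sub_mem h₀ hle).mp x.2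
    obtain ⟨m, hm⟩ := hLe _ hx
    obtain ⟨m', hm'⟩ := h0.2 _ hx
    have : quad B x = quad B x₀ + ((m + m' : ℤ) : ℝ) := by
      have e1 : (x : V) = (x - x₀ : V) + x₀ := by abel
      rw [quad, e1]
      push_cast
      rw [← hm, ← hm', quad, quad]
      simp only [map_add, LinearMap.add_apply]
      rw [bilin_symm hB (x - x₀ : V) x₀]
      ring
    rw [this, Complex.ofReal_add, e_add, Complex.ofReal_intCast, e_int, mul_one]
  simp only [thetaVec, thetaTerm, hy, gaussTerm_translation hB η hτ]
  rw [mul_left_comm, ← tsum_mul_left (a := e _)]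
  congr 1
  refine tsum_congr fun x => ?_
  rw [h x]
  ring

/-- The argument of τ/i lies in (-π/2, π/2), so adding arg i = π/2 stays in the principal range and
logarithms add. -/
theorem sqrt_mul_sqrt_I (τ : ℍ) :
    (τ : ℂ) ^ (1 / 2 : ℂ) = (τ / Complex.I : ℂ) ^ (1 / 2 : ℂ) * Complex.I ^ (1 / 2 : ℂ) := by
  have hτ0 : (τ : ℂ) ≠ 0 := UpperHalfPlane.ne_zero τ
  have hI := Complex.I_ne_zero
  have hu0 : (τ / Complex.I : ℂ) ≠ 0 := div_ne_zero hτ0 hI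
  have hre : 0 < (τ / Complex.I : ℂ).re := by
    rw [Complex.div_I, Complex.neg_re, Complex.mul_I_re, neg_neg]
    exact τ.im_pos
  have harg : |(τ / Complex.I : ℂ).arg| < Real.pi / 2 :=
    Complex.abs_arg_lt_pi_div_two_iff.mpr (Or.inl hre)
  rw [abs_lt] at harg
  have hlog : Complex.log τ = Complex.log (τ / Complex.I : ℂ) + Complex.log Complex.I := by
    rw [← Complex.log_mul hu0 hI]
    · rw [div_mul_cancel₀ _ hI]
    · rw [Complex.arg_I]
      constructor <;> linarith [Real.pi_pos, harg.1, harg.2]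
  rw [Complex.cpow_def_of_ne_zero hτ0, Complex.cpow_def_of_ne_zero hu0,
    Complex.cpow_def_of_ne_zero hI, hlog, ← Complex.exp_add, add_mul]

/-- Let a be the principal root of τ/i. Positive coordinates contribute a and negative ones its
conjugate a⁻¹‖τ‖, which leaves a^(p-n) and the power ‖τ‖^n. -/
theorem prod_sqrt_twist (τ : ℍ) :
    ∏ i : Fin p ⊕ Fin n, (twist (τ : ℂ) i / (Complex.I * sgn i)) ^ (1 / 2 : ℂ)
      = ((τ : ℂ) ^ (1 / 2 : ℂ)) ^ ((p : ℤ) - n) * (Complex.I ^ (1 / 2 : ℂ)) ^ ((n : ℤ) - p)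
        * (‖(τ : ℂ)‖ : ℂ) ^ n := by
  have hτ0 : (τ : ℂ) ≠ 0 := UpperHalfPlane.ne_zero τ
  set a : ℂ := (τ / Complex.I : ℂ) ^ (1 / 2 : ℂ) with ha
  have hI2 : Complex.I ^ (1 / 2 : ℂ) ≠ 0 := by
    rw [Ne, Complex.cpow_eq_zero_iff]
    simp
  have ha0 : a ≠ 0 := by
    rw [ha, Ne, Complex.cpow_eq_zero_iff]
    simp [hτ0]
  have hre : 0 < (τ / Complex.I : ℂ).re := by
    rw [Complex.div_I, Complex.neg_re, Complex.mul_I_re, neg_neg]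
    exact τ.im_pos
  have h1 : ∀ i : Fin n, (twist (τ : ℂ) (Sum.inr i : Fin p ⊕ Fin n)
      / (Complex.I * sgn (Sum.inr i : Fin p ⊕ Fin n))) ^ (1 / 2 : ℂ) = (starRingEnd ℂ) a := by
    intro i
    have e1 : twist (τ : ℂ) (Sum.inr i : Fin p ⊕ Fin n)
        / (Complex.I * sgn (Sum.inr i : Fin p ⊕ Fin n)) = (starRingEnd ℂ) (τ / Complex.I : ℂ) := by
      simp only [twist, sgn, Sum.elim_inr, map_div₀, Complex.conj_I]
      push_cast
      rw [mul_neg_one]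
    have e2 : (τ / Complex.I : ℂ).arg ≠ Real.pi := by
      have := Complex.abs_arg_lt_pi_div_two_iff.mpr (Or.inl hre)
      rw [abs_lt] at this
      intro h
      linarith [Real.pi_pos, this.2]
    rw [e1, Complex.conj_cpow _ _ e2, ha]
    congr 2
    rw [map_div₀, map_one, Complex.conj_ofNat]
  have h2 : ∀ i : Fin p, (twist (τ : ℂ) (Sum.inl i : Fin p ⊕ Fin n)
      / (Complex.I * sgn (Sum.inl i : Fin p ⊕ Fin n))) ^ (1 / 2 : ℂ) = a := by
    intro i
    simp [twist, sgn, ha]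
  have h3 : (starRingEnd ℂ) a = a⁻¹ * (‖(τ : ℂ)‖ : ℂ) := by
    have e1 : a * (starRingEnd ℂ) a = (‖(τ : ℂ)‖ : ℂ) := by
      rw [Complex.mul_conj, Complex.normSq_eq_norm_sq, ← norm_pow, ha, ← Complex.cpow_nat_mul]
      norm_num
    rw [← e1, inv_mul_cancel_left₀ ha0]
  rw [Fintype.prod_sum_type, Finset.prod_congr rfl fun i _ => h1 i,
    Finset.prod_congr rfl fun i _ => h2 i, Finset.prod_const, Finset.prod_const, Finset.card_univ,
    Finset.card_univ, Fintype.card_fin, Fintype.card_fin, h3, sqrt_mul_sqrt_I, ← ha, mul_zpow,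
    mul_pow, mul_assoc _ _ ((Complex.I ^ (1 / 2 : ℂ)) ^ ((n : ℤ) - p)), ← zpow_add₀ hI2,
    show (p : ℤ) - n + (n - p) = 0 by ring, zpow_zero, mul_one, zpow_sub₀ ha0, zpow_natCast,
    zpow_natCast, inv_pow]
  ring

/-- On negative coordinates z²/τ appears conjugated, so the sum differs from the holomorphic
exponent q(η)z²/τ by a multiple of Im(z²/τ). The prefactor of the theta function absorbs it, by
Im(z/τ)²/Im(-1/τ) + Im(z²/τ) = (Im z)²/Im τ. -/
theorem inversion_exp (hB : IsIsometryToStd B φ) (η : V) {τ τ' : ℍ} (hτ : (τ' : ℂ) = -(τ : ℂ)⁻¹)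
    (z : ℂ) :
    (Real.exp (-2 * Real.pi * (∑ j, (φ η).2 j ^ 2) * ((z / τ).im ^ 2 / τ'.im)) : ℂ)
      * Complex.exp (∑ i, Real.pi * Complex.I * sgn i * twist z i ^ 2 * coord φ η i ^ 2
        / twist (τ : ℂ) i)
      = e (quad B η * (z ^ 2 / τ))
        * Real.exp (-2 * Real.pi * (∑ j, (φ η).2 j ^ 2) * (z.im ^ 2 / τ.im)) := by
  have hy := τ.im_ne_zero
  have hN : Complex.normSq τ ≠ 0 := UpperHalfPlane.normSq_ne_zero τ
  have h1 : (z / τ).im ^ 2 / τ'.im + (z ^ 2 / τ).im = z.im ^ 2 / τ.im := by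
    have hN2 : Complex.normSq τ = τ.re ^ 2 + τ.im ^ 2 := by
      rw [Complex.normSq_apply, UpperHalfPlane.coe_re, UpperHalfPlane.coe_im]
      ring
    have e2 : (z ^ 2).im = 2 * z.re * z.im := by
      rw [sq, Complex.mul_im]
      ring
    have e1 : (z ^ 2).re = z.re ^ 2 - z.im ^ 2 := by
      rw [sq, Complex.mul_re]
      ring
    rw [inversion_im hτ, Complex.div_im, Complex.div_im, e1, e2, UpperHalfPlane.coe_re,
      UpperHalfPlane.coe_im]
    field_simp
    rw [hN2]
    ring
  have h2 : (∑ i, Real.pi * Complex.I * sgn i * twist z i ^ 2 * coord φ η i ^ 2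
        / twist (τ : ℂ) i)
      = 2 * Real.pi * Complex.I * (quad B η * (z ^ 2 / τ))
        - 2 * Real.pi * (∑ j, (φ η).2 j ^ 2 : ℝ) * (z ^ 2 / τ).im := by
    have e3 : (z ^ 2 / τ) - (starRingEnd ℂ) (z ^ 2 / τ) = 2 * Complex.I * (z ^ 2 / τ).im := by
      rw [Complex.sub_conj]
      push_cast
      ring
    have e4 : ∑ i, Real.pi * Complex.I * sgn i * twist z i ^ 2 * coord φ η i ^ 2
        / twist (τ : ℂ) i = Real.pi * Complex.I * ((∑ i, (φ η).1 i ^ 2 : ℝ) * (z ^ 2 / τ)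
          - (∑ i, (φ η).2 i ^ 2 : ℝ) * (starRingEnd ℂ) (z ^ 2 / τ)) := by
      rw [Fintype.sum_sum_type, mul_sub, sub_eq_add_neg, Complex.ofReal_sum, Complex.ofReal_sum,
        Finset.sum_mul, Finset.sum_mul, Finset.mul_sum, Finset.mul_sum, ← Finset.sum_neg_distrib]
      congr 1
      · refine Finset.sum_congr rfl fun i _ => ?_
        simp only [sgn, twist, Sum.elim_inl, coord_inl]
        push_cast
        ring
      · refine Finset.sum_congr rfl fun i _ => ?_
        simp only [sgn, twist, Sum.elim_inr, coord_inr, map_div₀, map_pow]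
        push_cast
        ring
    have e5 : quad B η = ((∑ i, (φ η).1 i ^ 2) - ∑ i, (φ η).2 i ^ 2) / 2 := by
      rw [quad, hB]
      simp only [sq]
    have hI := Complex.I_mul_I
    rw [e4, e5]
    push_cast
    linear_combination (Real.pi * Complex.I * ∑ j, ((φ η).2 j : ℂ) ^ 2) * e3
      + (2 * Real.pi * (∑ j, ((φ η).2 j : ℂ) ^ 2) * (z ^ 2 / τ).im) * hI
  rw [h2, e, Complex.ofReal_exp, Complex.ofReal_exp, ← Complex.exp_add, ← Complex.exp_add, ← h1]
  congr 1
  push_cast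
  ring

open Classical in
-- The dual lattice is sorted by classes; e(-(x₀, δ)) depends only on the class of δ, and this
-- produces the matrix of S.
theorem thetaVec_inversion (hB : IsIsometryToStd B φ) {L : Submodule ℤ V} (hL : IsFullLattice L)
    (hLe : IsEvenLattice B L) [Fintype (Disc B L)] (η : V) {k : ℕ} {P : MvPolynomial (Fin p) ℂ}
    (hP : P.IsHomogeneous k) {τ τ' : ℍ} (hτ : (τ' : ℂ) = -(τ : ℂ)⁻¹) (z : ℂ) (α β : V)
    (σ : Disc B L) :
    thetaVec B L φ η k P τ' (z / τ) (-β) α σ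
      = e (quad B η * (z ^ 2 / τ)) * ((τ : ℂ) ^ (1 / 2 : ℂ)) ^ (2 * (k : ℤ) + p - n)
        * ∑ σ', (Complex.I ^ (1 / 2 : ℂ)) ^ ((n : ℤ) - p) / (Real.sqrt (Nat.card (Disc B L)) : ℂ)
          * e (-(B (repr B L σ) (repr B L σ') : ℝ)) * thetaVec B L φ η k P τ z α β σ' := by
  obtain ⟨b, hb⟩ := exists_basis_of_isFullLattice φ hL
  have hle : L ≤ dualLattice B L := fun x hx => mem_dualLattice_of_mem hB hLe hx
  set x₀ := repr B L σ with hx₀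
  have hσ : InClass B L σ x₀ := inClass_repr σ
  have hτ0 : (τ : ℂ) ≠ 0 := UpperHalfPlane.ne_zero τ
  have hsum : Summable fun δ : dualLattice B L =>
      e (-(B x₀ δ : ℝ)) * thetaTerm φ η τ z α β k P δ := by
    have h := summable_thetaTerm φ η τ z α β (isFullLattice_dualLattice hB hL) 0 k P
    simp only [add_zero] at h
    refine Summable.of_norm (h.congr fun δ => ?_)
    rw [norm_mul, ← Complex.ofReal_neg, norm_e_ofReal, one_mul]
  have h1 : ∑' δ : dualLattice B L, e (-(B x₀ δ : ℝ)) * thetaTerm φ η τ z α β k P δ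
      = ∑ σ', e (-(B x₀ (repr B L σ') : ℝ))
        * ∑' x : {x : V // InClass B L σ' x}, thetaTerm φ η τ z α β k P x := by
    rw [← (dualEquivSigma B L).tsum_eq]
    refine (Summable.tsum_sigma ((dualEquivSigma B L).summable_iff.mpr hsum)).trans ?_
    rw [tsum_fintype]
    refine Finset.sum_congr rfl fun σ' _ => ?_
    rw [← tsum_mul_left]
    refine tsum_congr fun x => ?_
    change e (-(B x₀ x.1 : ℝ)) * _ = _
    congr 1
    have hx := (inClass_iff_sub_mem (inClass_repr σ') hle).mp x.2
    obtain ⟨m, hm⟩ := hσ.1.2 _ hx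
    rw [map_sub] at hm
    have : (-(B x₀ x.1 : ℝ) : ℂ) = -(B x₀ (repr B L σ') : ℝ) + ((-m : ℤ) : ℂ) := by
      have : (B x₀ x.1 : ℂ) - (B x₀ (repr B L σ') : ℂ) = m := by exact_mod_cast hm
      push_cast
      linear_combination -this
    rw [this, e_add, e_int, mul_one]
  have h2 : ∑' x : {x : V // InClass B L σ x}, thetaTerm φ η τ' (z / τ) (-β) α k P x
      = ∑' l : L, thetaTerm φ η τ' (z / τ) (-β) α k P (l + x₀) := by
    rw [← (classEquiv hσ hle).tsum_eq]
    rfl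
  -- The covolume of L is the square root of the order of the discriminant group.
  have hdet : (|LinearMap.det (basisCoord φ b :
      (Fin p ⊕ Fin n → ℝ) →ₗ[ℝ] (Fin p ⊕ Fin n → ℝ))|⁻¹ : ℝ)
      = (Real.sqrt (Nat.card (Disc B L)))⁻¹ := by
    subst hb
    rw [card_disc hB b hLe, Real.sqrt_sq (abs_nonneg _)]
  have hs0 : ((τ : ℂ) ^ (1 / 2 : ℂ)) ≠ 0 := by
    rw [Ne, Complex.cpow_eq_zero_iff]
    simp [hτ0]
  have hs2 : ((τ : ℂ) ^ (1 / 2 : ℂ)) ^ (2 * (k : ℤ) + p - n)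
      = (τ : ℂ) ^ k * ((τ : ℂ) ^ (1 / 2 : ℂ)) ^ ((p : ℤ) - n) := by
    rw [add_sub_assoc, zpow_add₀ hs0, zpow_mul]
    congr 1
    rw [zpow_natCast]
    congr 1
    rw [show (2 : ℤ) = ((2 : ℕ) : ℤ) from rfl, zpow_natCast, ← Complex.cpow_nat_mul]
    norm_num
  -- Since Im(-1/τ) = Im τ/‖τ‖², the factor y^(n/2) consumes the power ‖τ‖^n left by
  -- `prod_sqrt_twist`.
  have hy : ((τ'.im ^ ((n : ℝ) / 2) : ℝ) : ℂ) * (‖(τ : ℂ)‖ : ℂ) ^ n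
      = ((τ.im ^ ((n : ℝ) / 2) : ℝ) : ℂ) := by
    rw [inversion_im hτ, Complex.normSq_eq_norm_sq, Real.div_rpow τ.im_pos.le (by positivity),
      ← Real.rpow_natCast_mul (norm_nonneg _)]
    have hn : ‖(τ : ℂ)‖ ≠ 0 := norm_ne_zero_iff.mpr hτ0
    rw [show ((2 : ℕ) : ℝ) * ((n : ℝ) / 2) = n by push_cast; ring, Real.rpow_natCast]
    push_cast
    rw [div_mul_cancel₀]
    exact_mod_cast pow_ne_zero n hn
  have hexp := inversion_exp hB η hτ z
  have hinv : ∑' l : L, thetaTerm φ η τ' (z / τ) (-β) α k P (l + x₀)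
      = (|LinearMap.det (basisCoord φ b : (Fin p ⊕ Fin n → ℝ) →ₗ[ℝ] (Fin p ⊕ Fin n → ℝ))|⁻¹ : ℝ)
        * inversionFactor φ η τ z * (τ : ℂ) ^ k
        * ∑' δ : dualLattice B L, e (-(B x₀ δ : ℝ)) * thetaTerm φ η τ z α β k P δ := by
    subst hb
    exact tsum_thetaTerm_inversion hB b η hτ z α β x₀ hP
  simp only [thetaVec]
  generalize (∑ j, (φ η).2 j ^ 2) = N at hexp ⊢
  rw [h2, hinv, h1, inversionFactor, prod_sqrt_twist,
    hs2, hdet, Finset.mul_sum, Finset.mul_sum, Finset.mul_sum]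
  refine Finset.sum_congr rfl fun σ' _ => ?_
  rw [Complex.ofReal_mul, Complex.ofReal_mul, Complex.ofReal_inv, ← hy]
  set S : ℂ := ∑' x : {x : V // InClass B L σ' x}, thetaTerm φ η τ z α β k P x
  generalize ((τ'.im ^ ((n : ℝ) / 2) : ℝ) : ℂ) = Y
  linear_combination Y * (‖(τ : ℂ)‖ : ℂ) ^ n *
    (Real.sqrt (Nat.card (Disc B L)) : ℂ)⁻¹ * ((τ : ℂ) ^ (1 / 2 : ℂ)) ^ ((p : ℤ) - n)
    * (Complex.I ^ (1 / 2 : ℂ)) ^ ((n : ℤ) - p) * (τ : ℂ) ^ k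
    * e (-(B x₀ (repr B L σ') : ℝ)) * S * hexp

end Generators
end JacobiTheta
end

noncomputable section

namespace JacobiTheta

open UpperHalfPlane

/-! ### Generators of the metaplectic group -/

namespace Mp2Z

/-- The projection of the metaplectic group to the modular group. -/
def matHom : Mp2Z →* SL(2, ℤ) where
  toFun := mat
  map_one' := rfl
  map_mul' _ _ := rfl

/-- Two continuous square roots of the same nowhere vanishing function on the connected space ℍ
agree up to one global sign, and a single point decides the sign. -/
theorem eq_of_root_eq_at {x y : Mp2Z} (h : x.mat = y.mat) (τ : ℍ) (hτ : x.root τ = y.root τ) :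
    x = y := by
  have hx : Continuous x.root := x.holo.continuous
  have hy : Continuous y.root := y.holo.continuous
  have hsq : Set.EqOn (x.root ^ 2) (y.root ^ 2) Set.univ := by
    intro τ _
    simp only [Pi.pow_apply, x.sq, y.sq, h]
  have hpre : IsPreconnected (Set.univ : Set ℍ) := isPreconnected_univ
  rcases hpre.eq_or_eq_neg_of_sq_eq hx.continuousOn hy.continuousOn hsq
    (fun _ => y.root_ne_zero _) with h1 | h1
  · ext1
    · exact h
    · exact funext fun τ => h1 (Set.mem_univ τ)
  · have h2 := h1 (Set.mem_univ τ)
    rw [hτ, Pi.neg_apply, self_eq_neg] at h2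
    exact absurd h2 (y.root_ne_zero τ)

theorem stdLift_S_sq_mat : (stdLift ModularGroup.S ^ 2).mat = -1 := by
  rw [pow_two, mul_mat]
  change ModularGroup.S * ModularGroup.S = -1
  ext i j
  rw [Matrix.SpecialLinearGroup.coe_mul, ModularGroup.coe_S]
  fin_cases i <;> fin_cases j <;> simp

theorem root_stdLift_S_sq (τ : ℍ) : (stdLift ModularGroup.S ^ 2).root τ ^ 2 = -1 := by
  rw [sq, stdLift_S_sq_mat]
  simp [autFactor]

theorem stdLift_S_pow_four_mat : (stdLift ModularGroup.S ^ 4).mat = 1 := by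
  rw [show (4 : ℕ) = 2 + 2 from rfl, pow_add, mul_mat, stdLift_S_sq_mat]
  simp

/-- So S⁴ = (1, -1), the nontrivial element of the kernel of the projection to SL₂(ℤ). -/
theorem root_stdLift_S_pow_four (τ : ℍ) : (stdLift ModularGroup.S ^ 4).root τ = -1 := by
  rw [show (4 : ℕ) = 2 + 2 from rfl, pow_add, mul_root, stdLift_S_sq_mat]
  have : (-1 : SL(2, ℤ)) • τ = τ := by
    rw [ModularGroup.SL_neg_smul, one_smul]
  rw [this, ← pow_two, root_stdLift_S_sq]

theorem stdLift_S_pow_eight : stdLift ModularGroup.S ^ 8 = 1 := by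
  have h : (stdLift ModularGroup.S ^ 8).mat = (1 : Mp2Z).mat := by
    rw [show (8 : ℕ) = 4 + 4 from rfl, pow_add, mul_mat, stdLift_S_pow_four_mat, mul_one, one_mat]
  refine eq_of_root_eq_at h UpperHalfPlane.I ?_
  rw [show (8 : ℕ) = 4 + 4 from rfl, pow_add, mul_root, root_stdLift_S_pow_four,
    root_stdLift_S_pow_four, one_root]
  norm_num

/-- S and T generate SL₂(ℤ), so a suitable word in their lifts has the same matrix as x; if its root
has the opposite sign, a factor S⁴ corrects it. -/
theorem closure_eq_top :
    Subgroup.closure {stdLift ModularGroup.S, stdLift ModularGroup.T} = ⊤ := by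
  rw [eq_top_iff]
  intro x _
  set H := Subgroup.closure {stdLift ModularGroup.S, stdLift ModularGroup.T} with hH
  have hS : stdLift ModularGroup.S ∈ H := Subgroup.subset_closure (by simp)
  have hmap : H.map matHom = ⊤ := by
    rw [hH, MonoidHom.map_closure, Set.image_pair]
    exact SpecialLinearGroup.SL2Z_generators
  obtain ⟨y, hy, hyx⟩ : x.mat ∈ H.map matHom := by rw [hmap]; trivial
  change y.mat = x.mat at hyx
  have hsq : x.root UpperHalfPlane.I ^ 2 = y.root UpperHalfPlane.I ^ 2 := by
    rw [x.sq, y.sq, hyx]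
  rcases sq_eq_sq_iff_eq_or_eq_neg.mp hsq with h | h
  · rw [eq_of_root_eq_at hyx.symm _ h]
    exact hy
  · have h2 : x = stdLift ModularGroup.S ^ 4 * y := by
      refine eq_of_root_eq_at ?_ UpperHalfPlane.I ?_
      · rw [mul_mat, stdLift_S_pow_four_mat, one_mul, hyx]
      · rw [mul_root, root_stdLift_S_pow_four, h, neg_one_mul]
    rw [h2]
    exact H.mul_mem (H.pow_mem hS 4) hy

end Mp2Z

/-! ### The action on the parameters of theta functions -/

section Action

variable {V : Type*} [AddCommGroup V]

/-- The parameters `(τ, z, α, β)` of theta functions. -/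
abbrev ThetaPoint (V : Type*) := ℍ × ℂ × V × V

/-- The action of the modular group on the parameters of theta functions. -/
def act (γ : SL(2, ℤ)) (x : ThetaPoint V) : ThetaPoint V :=
  (γ • x.1, x.2.1 / autFactor γ x.1, γ 0 0 • x.2.2.1 + γ 0 1 • x.2.2.2,
    γ 1 0 • x.2.2.1 + γ 1 1 • x.2.2.2)

theorem act_one (x : ThetaPoint V) : act 1 x = x := by
  simp [act, autFactor_one]

theorem act_mul (γ δ : SL(2, ℤ)) (x : ThetaPoint V) : act (γ * δ) x = act γ (act δ x) := by
  simp only [act, mul_smul, autFactor_mul, Matrix.SpecialLinearGroup.coe_mul, Matrix.mul_apply,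
    Fin.sum_univ_two, Prod.mk.injEq, true_and]
  refine ⟨?_, ?_, ?_⟩
  · rw [div_div, mul_comm]
  all_goals
    simp only [smul_add, add_smul, mul_smul]
    abel

/-- The automorphy factor of theta functions of weight `κ / 2` and index `q`. -/
def thetaFactor (κ : ℤ) (q : ℂ) (x : Mp2Z) (pt : ThetaPoint V) : ℂ :=
  x.root pt.1 ^ κ * e (q * ((x.mat 1 0 : ℤ) * pt.2.1 ^ 2 / autFactor x.mat pt.1))

theorem coe_smul_eq (γ : SL(2, ℤ)) (τ : ℍ) :
    ((γ • τ : ℍ) : ℂ) = ((γ 0 0 : ℤ) * τ + (γ 0 1 : ℤ)) / autFactor γ τ := by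
  rw [UpperHalfPlane.specialLinearGroup_apply]
  simp [autFactor]

/-- The cocycle relation. For the exponential factor it reduces, over a common denominator, to the
determinant of the second matrix being 1. -/
theorem thetaFactor_mul (κ : ℤ) (q : ℂ) (x y : Mp2Z) (pt : ThetaPoint V) :
    thetaFactor κ q (x * y) pt = thetaFactor κ q x (act y.mat pt) * thetaFactor κ q y pt := by
  obtain ⟨τ, z, α, β⟩ := pt
  simp only [thetaFactor, act, Mp2Z.mul_root, mul_zpow, Mp2Z.mul_mat, autFactor_mul]
  have hx := autFactor_ne_zero x.mat (y.mat • τ)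
  have hy := autFactor_ne_zero y.mat τ
  have hdet : ((y.mat 0 0 : ℤ) : ℂ) * (y.mat 1 1 : ℤ) - (y.mat 0 1 : ℤ) * (y.mat 1 0 : ℤ) = 1 := by
    have := y.mat.det_coe
    rw [Matrix.det_fin_two] at this
    exact_mod_cast this
  have hc : (((x.mat * y.mat) 1 0 : ℤ) : ℂ) * z ^ 2
        / (autFactor x.mat (y.mat • τ) * autFactor y.mat τ)
      = (x.mat 1 0 : ℤ) * (z / autFactor y.mat τ) ^ 2 / autFactor x.mat (y.mat • τ)
        + (y.mat 1 0 : ℤ) * z ^ 2 / autFactor y.mat τ := by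
    have h1 : (((x.mat * y.mat) 1 0 : ℤ) : ℂ)
        = (x.mat 1 0 : ℤ) * (y.mat 0 0 : ℤ) + (x.mat 1 1 : ℤ) * (y.mat 1 0 : ℤ) := by
      rw [Matrix.SpecialLinearGroup.coe_mul, Matrix.mul_apply, Fin.sum_univ_two]
      push_cast
      ring
    have h2 : autFactor x.mat (y.mat • τ) * autFactor y.mat τ
        = (x.mat 1 0 : ℤ) * ((y.mat 0 0 : ℤ) * τ + (y.mat 0 1 : ℤ))
          + (x.mat 1 1 : ℤ) * autFactor y.mat τ := by
      rw [autFactor, coe_smul_eq]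
      field_simp
    have h3 : autFactor y.mat τ = (y.mat 1 0 : ℤ) * τ + (y.mat 1 1 : ℤ) := rfl
    rw [h1]
    field_simp
    linear_combination -z ^ 2 * (y.mat 1 0 : ℤ) * h2 + z ^ 2 * (x.mat 1 0 : ℤ) * (y.mat 0 0 : ℤ) * h3
      + z ^ 2 * (x.mat 1 0 : ℤ) * hdet
  rw [hc, mul_add, e_add]
  ring

theorem thetaFactor_one {U : Type*} (κ : ℤ) (q : ℂ) (pt : ThetaPoint U) : thetaFactor κ q 1 pt = 1 := by
  simp [thetaFactor, Mp2Z.one_root, Mp2Z.one_mat, e]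

theorem thetaFactor_ne_zero {U : Type*} (κ : ℤ) (q : ℂ) (x : Mp2Z) (pt : ThetaPoint U) :
    thetaFactor κ q x pt ≠ 0 :=
  mul_ne_zero (zpow_ne_zero _ (x.root_ne_zero _)) (Complex.exp_ne_zero _)

variable {W : Type*} [AddCommGroup W] [Module ℂ W]

/-- The function `Θ` transforms under `x` with the automorphy factor of weight `κ / 2` and index
`q` and the endomorphism `M`. -/
def Transforms (κ : ℤ) (q : ℂ) (Θ : ThetaPoint V → W) (x : Mp2Z) (M : Module.End ℂ W) : Prop :=
  ∀ pt, Θ (act x.mat pt) = thetaFactor κ q x pt • M (Θ pt)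

variable {κ : ℤ} {q : ℂ} {Θ : ThetaPoint V → W}

theorem Transforms.one : Transforms κ q Θ 1 1 := by
  intro pt
  rw [Mp2Z.one_mat, act_one, thetaFactor_one, one_smul, Module.End.one_apply]

theorem Transforms.mul {x y : Mp2Z} {M N : Module.End ℂ W} (hx : Transforms κ q Θ x M)
    (hy : Transforms κ q Θ y N) : Transforms κ q Θ (x * y) (M * N) := by
  intro pt
  rw [Mp2Z.mul_mat, act_mul, hx, hy, map_smul, smul_smul, thetaFactor_mul, Module.End.mul_apply]

theorem Transforms.pow {x : Mp2Z} {M : Module.End ℂ W} (hx : Transforms κ q Θ x M) (k : ℕ) :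
    Transforms κ q Θ (x ^ k) (M ^ k) := by
  induction k with
  | zero => exact Transforms.one
  | succ k ih => rw [pow_succ, pow_succ]; exact ih.mul hx

theorem Transforms.inv {x : Mp2Z} {M N : Module.End ℂ W} (hx : Transforms κ q Θ x M)
    (hN : N * M = 1) : Transforms κ q Θ x⁻¹ N := by
  intro pt
  have h1 := hx (act x⁻¹.mat pt)
  have h2 := thetaFactor_mul κ q x x⁻¹ pt
  rw [mul_inv_cancel, thetaFactor_one] at h2
  rw [← act_mul, ← Mp2Z.mul_mat, mul_inv_cancel, Mp2Z.one_mat, act_one] at h1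
  rw [h1, map_smul, smul_smul, mul_comm, ← h2, one_smul, ← Module.End.mul_apply, hN,
    Module.End.one_apply]

theorem Transforms.of_generators {ρ : Mp2Z →* Module.End ℂ W}
    (hS : Transforms κ q Θ (Mp2Z.stdLift ModularGroup.S) (ρ (Mp2Z.stdLift ModularGroup.S)))
    (hT : Transforms κ q Θ (Mp2Z.stdLift ModularGroup.T) (ρ (Mp2Z.stdLift ModularGroup.T)))
    (x : Mp2Z) : Transforms κ q Θ x (ρ x) := by
  have hx : x ∈ Subgroup.closure
      {Mp2Z.stdLift ModularGroup.S, Mp2Z.stdLift ModularGroup.T} := by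
    rw [Mp2Z.closure_eq_top]
    trivial
  induction hx using Subgroup.closure_induction with
  | mem x h =>
    rcases h with rfl | h
    · exact hS
    · rw [Set.mem_singleton_iff] at h
      rw [h]
      exact hT
  | one => rw [map_one]; exact Transforms.one
  | mul x y _ _ hx hy => rw [map_mul]; exact hx.mul hy
  | inv x _ hx => exact hx.inv (by rw [← map_mul, inv_mul_cancel, map_one])

/-- If the values of `Θ` are not killed by any nonzero endomorphism, then transformation behaviour
under the generators gives rise to a representation. -/
theorem exists_rep_of_transforms (hΘ : ∀ A : Module.End ℂ W, (∀ pt, A (Θ pt) = 0) → A = 0)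
    {MS MT NT : Module.End ℂ W} (hS : Transforms κ q Θ (Mp2Z.stdLift ModularGroup.S) MS)
    (hT : Transforms κ q Θ (Mp2Z.stdLift ModularGroup.T) MT) (h1 : NT * MT = 1)
    (h2 : MT * NT = 1) :
    ∃ ρ : Mp2Z →* Module.End ℂ W, ρ (Mp2Z.stdLift ModularGroup.S) = MS
      ∧ ρ (Mp2Z.stdLift ModularGroup.T) = MT := by
  have huniq : ∀ {x : Mp2Z} {M N : Module.End ℂ W}, Transforms κ q Θ x M → Transforms κ q Θ x N →
      M = N := by
    intro x M N hM hN
    refine sub_eq_zero.mp (hΘ _ fun pt => ?_)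
    have h := (hM pt).symm.trans (hN pt)
    rw [LinearMap.sub_apply, sub_eq_zero]
    exact smul_right_injective W (thetaFactor_ne_zero κ q x pt) h
  -- The relation S⁸ = 1 passes to the matrix by uniqueness and makes it invertible, with inverse
  -- `MS ^ 7`.
  have hS8 : MS ^ 8 = 1 := by
    have h := hS.pow 8
    rw [Mp2Z.stdLift_S_pow_eight] at h
    exact huniq h Transforms.one
  -- A two-sided inverse is carried along, so that inverses in the generated subgroup have a matrix
  -- as well.
  have hex : ∀ x : Mp2Z, ∃ M N : Module.End ℂ W, Transforms κ q Θ x M ∧ N * M = 1 ∧ M * N = 1 := by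
    intro x
    have hx : x ∈ Subgroup.closure
        {Mp2Z.stdLift ModularGroup.S, Mp2Z.stdLift ModularGroup.T} := by
      rw [Mp2Z.closure_eq_top]
      trivial
    induction hx using Subgroup.closure_induction with
    | mem x h =>
      rcases h with rfl | h
      · exact ⟨MS, MS ^ 7, hS, by rw [← pow_succ, hS8], by rw [← pow_succ', hS8]⟩
      · rw [Set.mem_singleton_iff] at h
        rw [h]
        exact ⟨MT, NT, hT, h1, h2⟩
    | one => exact ⟨1, 1, Transforms.one, one_mul 1, one_mul 1⟩
    | mul x y _ _ hx hy =>
      obtain ⟨M, N, hM, hNM, hMN⟩ := hx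
      obtain ⟨M', N', hM', hNM', hMN'⟩ := hy
      refine ⟨M * M', N' * N, hM.mul hM', ?_, ?_⟩
      · rw [mul_assoc, ← mul_assoc N, hNM, one_mul, hNM']
      · rw [mul_assoc, ← mul_assoc M', hMN', one_mul, hMN]
    | inv x _ hx =>
      obtain ⟨M, N, hM, hNM, hMN⟩ := hx
      exact ⟨N, M, hM.inv hNM, hMN, hNM⟩
  choose M N hM _ _ using hex
  exact ⟨{ toFun := M
           map_one' := huniq (hM 1) Transforms.one
           map_mul' := fun x y => huniq (hM _) ((hM x).mul (hM y)) },
    huniq (hM _) hS, huniq (hM _) hT⟩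

end Action
end JacobiTheta
end

noncomputable section

namespace JacobiTheta

open UpperHalfPlane

/-! ### The Weil representation -/

section Weil

variable {V : Type*} [AddCommGroup V] [Module ℝ V] {p n : ℕ}
variable {B : LinearMap.BilinForm ℝ V} {φ : V ≃ₗ[ℝ] (Fin p → ℝ) × (Fin n → ℝ)}

theorem e_bilin_congr (hB : IsIsometryToStd B φ) {L : Submodule ℤ V} (hLe : IsEvenLattice B L)
    {σ : Disc B L} {x y w : V} (hx : InClass B L σ x) (hy : InClass B L σ y)
    (hw : w ∈ dualLattice B L) : e (-(B x w : ℝ)) = e (-(B y w : ℝ)) := by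
  have hle : L ≤ dualLattice B L := fun x hx => mem_dualLattice_of_mem hB hLe hx
  obtain ⟨m, hm⟩ := hw.2 _ ((inClass_iff_sub_mem hy hle).mp hx)
  rw [bilin_symm hB, map_sub, LinearMap.sub_apply] at hm
  have : (-(B x w : ℝ) : ℂ) = -(B y w : ℝ) + ((-m : ℤ) : ℂ) := by
    have : (B x w : ℂ) - (B y w : ℂ) = m := by exact_mod_cast hm
    push_cast
    linear_combination -this
  rw [this, e_add, e_int, mul_one]

theorem e_quad_congr (hB : IsIsometryToStd B φ) {L : Submodule ℤ V} (hLe : IsEvenLattice B L)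
    {σ : Disc B L} {x y : V} (hx : InClass B L σ x) (hy : InClass B L σ y) :
    e (quad B x) = e (quad B y) := by
  have hle : L ≤ dualLattice B L := fun x hx => mem_dualLattice_of_mem hB hLe hx
  have hxy := (inClass_iff_sub_mem hy hle).mp hx
  obtain ⟨m, hm⟩ := hLe _ hxy
  obtain ⟨m', hm'⟩ := hy.1.2 _ hxy
  have : quad B x = quad B y + ((m + m' : ℤ) : ℝ) := by
    have e1 : x = (x - y) + y := by abel
    rw [quad, e1]
    push_cast
    rw [← hm, ← hm', quad, quad]
    simp only [map_add, LinearMap.add_apply]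
    rw [bilin_symm hB (x - y) y]
    ring
  rw [this, Complex.ofReal_add, e_add, Complex.ofReal_intCast, e_int, mul_one]

/-- The lattice is its own double dual: pairing with the dual basis reads off the coordinates of v.
-/
theorem mem_of_bilin_dualLattice_int (hB : IsIsometryToStd B φ) {L : Submodule ℤ V}
    (hL : IsFullLattice L) {v : V} (h : ∀ x ∈ dualLattice B L, ∃ m : ℤ, B x v = m) : v ∈ L := by
  obtain ⟨b, rfl⟩ := exists_basis_of_isFullLattice φ hL
  rw [b.mem_span_iff_repr_mem ℤ]
  intro i
  set b' := B.dualBasis (bilin_nondegenerate hB) b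
  have hb' : b' i ∈ dualLattice B (Submodule.span ℤ (Set.range b)) := by
    rw [dualLattice_eq_span hB b]
    exact Submodule.subset_span ⟨i, rfl⟩
  obtain ⟨m, hm⟩ := h _ hb'
  refine ⟨m, ?_⟩
  have h1 : B (b' i) v = b.repr v i := by
    have h2 : ∀ j, B (b' i) (b j) = if j = i then 1 else 0 := bilin_dualBasis hB b i
    conv_lhs => rw [← b.sum_repr v]
    rw [map_sum, Finset.sum_eq_single i]
    · rw [map_smul, h2, if_pos rfl, smul_eq_mul, mul_one]
    · intro j _ hj
      rw [map_smul, h2, if_neg hj, smul_zero]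
    · simp
  rw [← h1, hm]
  rfl

/-- The characters of the dual lattice given by the elements of the discriminant group. -/
def discChar (B : LinearMap.BilinForm ℝ V) (L : Submodule ℤ V) (σ : Disc B L) :
    Multiplicative (dualLattice B L) →* ℂ where
  toFun x := e (-(B x.toAdd (repr B L σ) : ℝ))
  map_one' := by simp [e]
  map_mul' x y := by
    rw [← e_add]
    congr 1
    rw [toAdd_mul, Submodule.coe_add, map_add, LinearMap.add_apply]
    push_cast
    ring

/-- The discriminant form is nondegenerate: two representatives that pair equally modulo 1 with the
whole dual lattice differ by an element of L. -/
theorem discChar_injective (hB : IsIsometryToStd B φ) {L : Submodule ℤ V} (hL : IsFullLattice L)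
    (hLe : IsEvenLattice B L) : Function.Injective (discChar B L) := by
  intro σ σ' h
  have hle : L ≤ dualLattice B L := fun x hx => mem_dualLattice_of_mem hB hLe hx
  have hmem : repr B L σ - repr B L σ' ∈ L := by
    refine mem_of_bilin_dualLattice_int hB hL fun x hx => ?_
    have h1 : e (-(B x (repr B L σ) : ℝ)) = e (-(B x (repr B L σ') : ℝ)) :=
      DFunLike.congr_fun h (Multiplicative.ofAdd ⟨x, hx⟩)
    rw [e, e, Complex.exp_eq_exp_iff_exists_int] at h1
    obtain ⟨m, hm⟩ := h1
    have h2 : (B x (repr B L σ) : ℂ) = B x (repr B L σ') - m := by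
      refine mul_left_cancel₀ Complex.two_pi_I_ne_zero ?_
      linear_combination -hm
    refine ⟨-m, ?_⟩
    have h3 : B x (repr B L σ) = B x (repr B L σ') - m := by exact_mod_cast h2
    rw [map_sub, h3]
    push_cast
    ring
  obtain ⟨h1, h2⟩ := (inClass_iff_sub_mem (inClass_repr σ') hle).mpr hmem
  rw [← h2]
  exact (inClass_repr σ).2.symm

theorem thetaTerm_one_I (φ : V ≃ₗ[ℝ] (Fin p → ℝ) × (Fin n → ℝ)) (x : V) :
    thetaTerm φ 0 UpperHalfPlane.I 0 0 0 0 1 x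
      = (Real.exp (-Real.pi * ∑ i, coord φ x i ^ 2) : ℝ) := by
  have h1 : evalReal (heatLin 0 UpperHalfPlane.I.im (1 : MvPolynomial (Fin p) ℂ))
      (φ (x + ((0 : ℂ).im / UpperHalfPlane.I.im) • (0 : V) + 0)).1 = 1 := by
    simp [heatLin, evalReal]
  rw [thetaTerm, h1, one_mul, gaussTerm, Complex.ofReal_exp]
  congr 1
  rw [Complex.ofReal_mul, Complex.ofReal_sum, Finset.mul_sum]
  refine Finset.sum_congr rfl fun i _ => ?_
  have h2 : (sgn i : ℂ) * twist (UpperHalfPlane.I : ℂ) i = Complex.I := by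
    rcases i with i | i <;> simp [sgn, twist]
  have hI := Complex.I_mul_I
  simp only [add_zero, map_zero, Pi.zero_apply, Complex.ofReal_zero, mul_zero, sub_zero]
  rw [UpperHalfPlane.coe_I] at h2 ⊢
  push_cast
  linear_combination (Real.pi * Complex.I * (coord φ x i : ℂ) ^ 2) * h2
    + Real.pi * (coord φ x i : ℂ) ^ 2 * hI

/-- At τ = i with all other parameters zero and P = 1, every term is a positive real number. -/
theorem thetaVec_one_I_ne_zero (hB : IsIsometryToStd B φ) {L : Submodule ℤ V}
    (hL : IsFullLattice L) (hLe : IsEvenLattice B L) (σ : Disc B L) :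
    thetaVec B L φ 0 0 1 UpperHalfPlane.I 0 0 0 σ ≠ 0 := by
  have hle : L ≤ dualLattice B L := fun x hx => mem_dualLattice_of_mem hB hLe hx
  have hσ := inClass_repr σ
  have hsum := summable_thetaTerm φ 0 UpperHalfPlane.I 0 0 0 hL (repr B L σ) 0 1
  have hs : Summable fun x : {x : V // InClass B L σ x} =>
      Real.exp (-Real.pi * ∑ i, coord φ (x : V) i ^ 2) := by
    rw [← (classEquiv hσ hle).summable_iff]
    refine hsum.congr fun l => ?_
    rw [thetaTerm_one_I, Complex.norm_real, Real.norm_of_nonneg (Real.exp_nonneg _)]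
    rfl
  rw [thetaVec]
  simp only [thetaTerm_one_I]
  rw [← Complex.ofReal_tsum]
  refine mul_ne_zero ?_ ?_
  · simp
  · exact_mod_cast (hs.tsum_pos (fun _ => Real.exp_nonneg _) ⟨repr B L σ, hσ⟩
      (Real.exp_pos _)).ne'

/-- Moving α through the dual lattice multiplies the component at σ by the value of a character that
depends only on σ; this separates the components. -/
theorem thetaVec_one_I_shift (hB : IsIsometryToStd B φ) {L : Submodule ℤ V}
    (hLe : IsEvenLattice B L) (σ : Disc B L) {w : V} (hw : w ∈ dualLattice B L) :
    thetaVec B L φ 0 0 1 UpperHalfPlane.I 0 w 0 σ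
      = e (-(B w (repr B L σ) : ℝ)) * thetaVec B L φ 0 0 1 UpperHalfPlane.I 0 0 0 σ := by
  rw [thetaVec, thetaVec, mul_left_comm, ← tsum_mul_left (a := e _)]
  congr 1
  refine tsum_congr fun x => ?_
  rw [bilin_symm hB w, ← e_bilin_congr hB hLe x.2 (inClass_repr σ) hw, thetaTerm, thetaTerm,
    mul_left_comm]
  congr 1
  rw [gaussTerm, gaussTerm, e, ← Complex.exp_add, bilin_eq_sum_coord hB]
  congr 1
  rw [Complex.ofReal_sum, mul_neg, Finset.mul_sum, ← Finset.sum_neg_distrib,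
    ← Finset.sum_add_distrib]
  refine Finset.sum_congr rfl fun i _ => ?_
  simp only [map_zero, Pi.zero_apply]
  push_cast
  ring

/-- The theta function of a lattice as a function of all parameters. -/
def thetaFun (B : LinearMap.BilinForm ℝ V) (L : Submodule ℤ V)
    (φ : V ≃ₗ[ℝ] (Fin p → ℝ) × (Fin n → ℝ)) (η : V) (k : ℕ) (P : MvPolynomial (Fin p) ℂ)
    (pt : ThetaPoint V) : Disc B L → ℂ :=
  thetaVec B L φ η k P pt.1 pt.2.1 pt.2.2.1 pt.2.2.2

open Classical in
-- With α varying in the dual lattice, the vanishing of A on theta values is a linear relation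
-- between the characters `discChar`. Distinct characters are linearly independent, and the
-- coefficients are nonzero theta values times the entries of A.
theorem end_eq_zero_of_thetaFun (hB : IsIsometryToStd B φ) {L : Submodule ℤ V}
    (hL : IsFullLattice L) (hLe : IsEvenLattice B L) (A : Module.End ℂ (Disc B L → ℂ))
    (hA : ∀ pt, A (thetaFun B L φ 0 0 1 pt) = 0) : A = 0 := by
  have := finite_disc hB hL hLe
  have := Fintype.ofFinite (Disc B L)
  set t : Disc B L → ℂ := thetaVec B L φ 0 0 1 UpperHalfPlane.I 0 0 0 with ht
  have hli : LinearIndependent ℂ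
      fun σ : Disc B L => (discChar B L σ : Multiplicative (dualLattice B L) → ℂ) :=
    (linearIndependent_monoidHom (Multiplicative (dualLattice B L)) ℂ).comp _
      (discChar_injective hB hL hLe)
  rw [Fintype.linearIndependent_iff] at hli
  refine (Pi.basisFun ℂ (Disc B L)).ext fun σ => ?_
  ext δ
  have h := hli (fun σ => t σ * A (Pi.single σ 1) δ) (by
    ext w
    have h1 := congrFun (hA (UpperHalfPlane.I, 0, (w.toAdd : V), 0)) δ
    have h2 : thetaFun B L φ 0 0 1 (UpperHalfPlane.I, 0, (w.toAdd : V), 0)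
        = ∑ σ, (discChar B L σ w * t σ) • (Pi.single σ 1 : Disc B L → ℂ) := by
      ext σ
      rw [Finset.sum_apply, Finset.sum_eq_single σ]
      · rw [Pi.smul_apply, Pi.single_eq_same, smul_eq_mul, mul_one]
        exact thetaVec_one_I_shift hB hLe σ w.toAdd.2
      · intro σ' _ hne
        rw [Pi.smul_apply, Pi.single_eq_of_ne hne.symm, smul_zero]
      · simp
    rw [h2, map_sum, Finset.sum_apply] at h1
    simp only [Finset.sum_apply, Pi.smul_apply, smul_eq_mul, map_smul, Pi.zero_apply] at h1 ⊢
    rw [← h1]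
    exact Finset.sum_congr rfl fun σ _ => by ring) σ
  rw [Pi.basisFun_apply]
  exact (mul_eq_zero.mp h).resolve_left (thetaVec_one_I_ne_zero hB hL hLe σ)

open Classical in
/-- The matrix of `S` in the Weil representation. -/
def weilS (B : LinearMap.BilinForm ℝ V) (L : Submodule ℤ V) (p n : ℕ) [Fintype (Disc B L)] :
    Module.End ℂ (Disc B L → ℂ) :=
  Matrix.toLin' <| Matrix.of fun σ σ' => (Complex.I ^ (1 / 2 : ℂ)) ^ ((n : ℤ) - (p : ℤ))
    / (Real.sqrt (Nat.card (Disc B L)) : ℂ) * e (-(B (repr B L σ) (repr B L σ') : ℝ))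

open Classical in
/-- The matrix of `T` in the Weil representation. -/
def weilT (B : LinearMap.BilinForm ℝ V) (L : Submodule ℤ V) [Fintype (Disc B L)] :
    Module.End ℂ (Disc B L → ℂ) :=
  Matrix.toLin' (Matrix.diagonal fun σ => e (quad B (repr B L σ)))

open Classical in
theorem weilS_apply {L : Submodule ℤ V} [Fintype (Disc B L)] (v : Disc B L → ℂ) (σ : Disc B L) :
    weilS B L p n v σ = ∑ σ', (Complex.I ^ (1 / 2 : ℂ)) ^ ((n : ℤ) - (p : ℤ))
      / (Real.sqrt (Nat.card (Disc B L)) : ℂ) * e (-(B (repr B L σ) (repr B L σ') : ℝ)) * v σ' := by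
  rw [weilS, Matrix.toLin'_apply]
  rfl

open Classical in
theorem weilT_apply {L : Submodule ℤ V} [Fintype (Disc B L)] (v : Disc B L → ℂ) (σ : Disc B L) :
    weilT B L v σ = e (quad B (repr B L σ)) * v σ := by
  rw [weilT, Matrix.toLin'_apply, Matrix.mulVec_diagonal]

open Classical in
-- The defining conditions range over all representatives of the classes, while the matrices use
-- chosen ones. Integrality of the pairings and evenness show that the values do not depend on the
-- choice.
theorem isWeilRep_iff (hB : IsIsometryToStd B φ) {L : Submodule ℤ V}
    (hLe : IsEvenLattice B L) [Fintype (Disc B L)] (ρ : Mp2Z →* Module.End ℂ (Disc B L → ℂ)) :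
    IsWeilRep B L p n ρ ↔ ρ (Mp2Z.stdLift ModularGroup.S) = weilS B L p n
      ∧ ρ (Mp2Z.stdLift ModularGroup.T) = weilT B L := by
  have hS : ∀ (σ σ' : Disc B L) (x x' : V), InClass B L σ x → InClass B L σ' x' →
      weilS B L p n (basisVec B L σ) σ' = (Complex.I ^ (1 / 2 : ℂ)) ^ ((n : ℤ) - (p : ℤ))
        / (Real.sqrt (Nat.card (Disc B L)) : ℂ) * e (-(B x x' : ℝ)) := by
    intro σ σ' x x' hx hx'
    rw [weilS_apply, Finset.sum_eq_single σ]
    · rw [basisVec, Pi.single_eq_same, mul_one]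
      congr 1
      rw [e_bilin_congr hB hLe (inClass_repr σ') hx' (inClass_repr σ).1, bilin_symm hB,
        e_bilin_congr hB hLe (inClass_repr σ) hx hx'.1]
    · intro b _ hb
      rw [basisVec, Pi.single_eq_of_ne hb, mul_zero]
    · simp
  have hT : ∀ (σ : Disc B L) (x : V), InClass B L σ x →
      weilT B L (basisVec B L σ) = e (quad B x) • basisVec B L σ := by
    intro σ x hx
    ext σ'
    rw [weilT_apply, Pi.smul_apply, smul_eq_mul]
    by_cases h : σ' = σ
    · rw [h, e_quad_congr hB hLe (inClass_repr σ) hx]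
    · rw [basisVec, Pi.single_eq_of_ne h, mul_zero, mul_zero]
  constructor
  · rintro ⟨h1, h2⟩
    constructor
    · refine (Pi.basisFun ℂ (Disc B L)).ext fun σ => ?_
      rw [Pi.basisFun_apply]
      ext σ'
      exact (h2 σ σ' _ _ (inClass_repr σ) (inClass_repr σ')).trans
        (hS σ σ' _ _ (inClass_repr σ) (inClass_repr σ')).symm
    · refine (Pi.basisFun ℂ (Disc B L)).ext fun σ => ?_
      rw [Pi.basisFun_apply]
      exact (h1 σ _ (inClass_repr σ)).trans (hT σ _ (inClass_repr σ)).symm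
  · rintro ⟨h1, h2⟩
    refine ⟨fun σ x hx => ?_, fun σ σ' x x' hx hx' => ?_⟩
    · rw [h2, hT σ x hx]
    · rw [h1, hS σ σ' x x' hx hx']

theorem transforms_weilS (hB : IsIsometryToStd B φ) {L : Submodule ℤ V} (hL : IsFullLattice L)
    (hLe : IsEvenLattice B L) [Fintype (Disc B L)] (η : V) {k : ℕ} {P : MvPolynomial (Fin p) ℂ}
    (hP : P.IsHomogeneous k) :
    Transforms (2 * (k : ℤ) + p - n) (quad B η) (thetaFun B L φ η k P)
      (Mp2Z.stdLift ModularGroup.S) (weilS B L p n) := by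
  rintro ⟨τ, z, α, β⟩
  have haut : autFactor ModularGroup.S τ = τ := by
    simp [autFactor, ModularGroup.coe_S]
  have hτ : ((ModularGroup.S • τ : ℍ) : ℂ) = -(τ : ℂ)⁻¹ := by
    rw [UpperHalfPlane.modular_S_smul, UpperHalfPlane.coe_mk, inv_neg]
  have hact : act ModularGroup.S (τ, z, α, β) = (ModularGroup.S • τ, z / τ, -β, α) := by
    simp [act, haut, ModularGroup.coe_S]
  ext σ
  change thetaFun B L φ η k P (act ModularGroup.S (τ, z, α, β)) σ = _
  rw [hact]
  change thetaVec B L φ η k P _ _ _ _ σ = _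
  rw [thetaVec_inversion hB hL hLe η hP hτ z α β σ, Pi.smul_apply, weilS_apply, smul_eq_mul]
  congr 1
  simp only [thetaFactor, Mp2Z.stdLift, haut]
  rw [mul_comm]
  simp [ModularGroup.coe_S]

theorem transforms_weilT (hB : IsIsometryToStd B φ) {L : Submodule ℤ V}
    (hLe : IsEvenLattice B L) [Fintype (Disc B L)] (η : V) (k : ℕ) (P : MvPolynomial (Fin p) ℂ)
    (κ : ℤ) :
    Transforms κ (quad B η) (thetaFun B L φ η k P)
      (Mp2Z.stdLift ModularGroup.T) (weilT B L) := by
  rintro ⟨τ, z, α, β⟩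
  have haut : autFactor ModularGroup.T τ = 1 := by
    simp [autFactor, ModularGroup.coe_T]
  have hτ : ((ModularGroup.T • τ : ℍ) : ℂ) = τ + 1 := by
    rw [UpperHalfPlane.modular_T_smul]
    simp [add_comm]
  have hact : act ModularGroup.T (τ, z, α, β) = (ModularGroup.T • τ, z, α + β, β) := by
    simp [act, haut, ModularGroup.coe_T]
  ext σ
  change thetaFun B L φ η k P (act ModularGroup.T (τ, z, α, β)) σ = _
  rw [hact]
  change thetaVec B L φ η k P _ _ _ _ σ = _
  rw [thetaVec_translation hB hLe η k P hτ z α β (inClass_repr σ), Pi.smul_apply, weilT_apply,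
    smul_eq_mul]
  simp only [thetaFactor, Mp2Z.stdLift, haut]
  simp [ModularGroup.coe_T, e, thetaFun]

/-- The definition of `weilRep` takes a default value unless a representation exists. Existence is
proved here with the theta functions for η = 0 and P = 1. -/
theorem isWeilRep_weilRep (hB : IsIsometryToStd B φ) {L : Submodule ℤ V} (hL : IsFullLattice L)
    (hLe : IsEvenLattice B L) : IsWeilRep B L p n (weilRep B L p n) := by
  have := finite_disc hB hL hLe
  have := Fintype.ofFinite (Disc B L)
  have hex : ∃ ρ, IsWeilRep B L p n ρ := by
    have hS := transforms_weilS hB hL hLe 0 (MvPolynomial.isHomogeneous_one (Fin p) ℂ)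
    have hT := transforms_weilT hB hLe 0 0 1 (2 * ((0 : ℕ) : ℤ) + p - n)
    classical
    let N : Module.End ℂ (Disc B L → ℂ) :=
      Matrix.toLin' (Matrix.diagonal fun σ => e (-quad B (repr B L σ)))
    have hN : ∀ v σ, N v σ = e (-quad B (repr B L σ)) * v σ := by
      intro v σ
      rw [Matrix.toLin'_apply, Matrix.mulVec_diagonal]
    have he : ∀ t : ℂ, e t * e (-t) = 1 := by
      intro t
      rw [← e_add, add_neg_cancel]
      simp [e]
    obtain ⟨ρ, h1, h2⟩ := exists_rep_of_transforms (end_eq_zero_of_thetaFun hB hL hLe) hS hT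
      (NT := N)
      (by
        refine LinearMap.ext fun v => funext fun σ => ?_
        rw [Module.End.mul_apply, hN, weilT_apply, ← mul_assoc, mul_comm (e _), he, one_mul,
          Module.End.one_apply])
      (by
        refine LinearMap.ext fun v => funext fun σ => ?_
        rw [Module.End.mul_apply, weilT_apply, hN, ← mul_assoc, he, one_mul,
          Module.End.one_apply])
    exact ⟨ρ, (isWeilRep_iff hB hLe ρ).mpr ⟨h1, h2⟩⟩
  rw [weilRep, dif_pos hex]
  exact hex.choose_spec

/-- The transformation formula of theta functions under the metaplectic group. -/
theorem transforms_weilRep (hB : IsIsometryToStd B φ) {L : Submodule ℤ V} (hL : IsFullLattice L)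
    (hLe : IsEvenLattice B L) (η : V) {k : ℕ} {P : MvPolynomial (Fin p) ℂ}
    (hP : P.IsHomogeneous k) (x : Mp2Z) :
    Transforms (2 * (k : ℤ) + p - n) (quad B η) (thetaFun B L φ η k P) x
      (weilRep B L p n x) := by
  have := finite_disc hB hL hLe
  have := Fintype.ofFinite (Disc B L)
  obtain ⟨h1, h2⟩ := (isWeilRep_iff hB hLe _).mp (isWeilRep_weilRep hB hL hLe)
  refine Transforms.of_generators ?_ ?_ x
  · rw [h1]
    exact transforms_weilS hB hL hLe η hP
  · rw [h2]
    exact transforms_weilT hB hLe η k P _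

end Weil
end JacobiTheta
end

noncomputable section

namespace JacobiTheta

open UpperHalfPlane

/-! ### Partial Poisson summation in an isotropic direction -/

section Isotropic

variable {V : Type*} [AddCommGroup V] [Module ℝ V] {p n : ℕ}

/-- The contribution of the positive coordinates to the bilinear form. -/
def posForm (φ : V ≃ₗ[ℝ] (Fin p → ℝ) × (Fin n → ℝ)) : LinearMap.BilinForm ℝ V :=
  LinearMap.mk₂ ℝ (fun x y => ∑ i, (φ x).1 i * (φ y).1 i)
    (fun _ _ _ => by simp [add_mul, Finset.sum_add_distrib])
    (fun _ _ _ => by simp [mul_assoc, Finset.mul_sum])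
    (fun _ _ _ => by simp [mul_add, Finset.sum_add_distrib])
    (fun _ _ _ => by simp [mul_left_comm, Finset.mul_sum])

/-- The contribution of the negative coordinates to the bilinear form, without its sign. -/
def negForm (φ : V ≃ₗ[ℝ] (Fin p → ℝ) × (Fin n → ℝ)) : LinearMap.BilinForm ℝ V :=
  LinearMap.mk₂ ℝ (fun x y => ∑ i, (φ x).2 i * (φ y).2 i)
    (fun _ _ _ => by simp [add_mul, Finset.sum_add_distrib])
    (fun _ _ _ => by simp [mul_assoc, Finset.mul_sum])
    (fun _ _ _ => by simp [mul_add, Finset.sum_add_distrib])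
    (fun _ _ _ => by simp [mul_left_comm, Finset.mul_sum])

variable (φ : V ≃ₗ[ℝ] (Fin p → ℝ) × (Fin n → ℝ))

theorem posForm_apply (x y : V) : posForm φ x y = ∑ i, (φ x).1 i * (φ y).1 i := rfl

theorem negForm_apply (x y : V) : negForm φ x y = ∑ i, (φ x).2 i * (φ y).2 i := rfl

theorem posForm_comm (x y : V) : posForm φ x y = posForm φ y x := by
  simp only [posForm_apply, mul_comm]

theorem negForm_comm (x y : V) : negForm φ x y = negForm φ y x := by
  simp only [negForm_apply, mul_comm]

variable {φ} {B : LinearMap.BilinForm ℝ V}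

theorem bilin_eq_posForm_sub (hB : IsIsometryToStd B φ) (x y : V) :
    B x y = posForm φ x y - negForm φ x y := hB x y

/-- The positive and negative parts of an isotropic vector have the same length, so if one vanished
the vector would be zero. -/
theorem posForm_pos (hB : IsIsometryToStd B φ) {u : V} (hu : u ≠ 0) (huu : B u u = 0) :
    0 < posForm φ u u := by
  have h0 : 0 ≤ posForm φ u u := by
    rw [posForm_apply]
    exact Finset.sum_nonneg fun i _ => mul_self_nonneg _
  refine h0.lt_of_ne' fun h => hu ?_
  rw [bilin_eq_posForm_sub hB, h, zero_sub, neg_eq_zero] at huu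
  rw [posForm_apply, Finset.sum_eq_zero_iff_of_nonneg fun i _ => mul_self_nonneg _] at h
  rw [negForm_apply, Finset.sum_eq_zero_iff_of_nonneg fun i _ => mul_self_nonneg _] at huu
  apply φ.injective
  rw [map_zero]
  ext i
  · exact mul_self_eq_zero.mp (h i (Finset.mem_univ i))
  · exact mul_self_eq_zero.mp (huu i (Finset.mem_univ i))

theorem negForm_self_eq (hB : IsIsometryToStd B φ) {u : V} (huu : B u u = 0) :
    negForm φ u u = posForm φ u u := by
  rw [bilin_eq_posForm_sub hB] at huu
  linarith

variable (φ) (η : V) (τ : ℍ) (z : ℂ) (u : V)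

theorem gaussTerm_zero (x : V) : gaussTerm φ η τ z 0 0 x
    = Complex.exp (Real.pi * Complex.I * (τ * posForm φ x x - (starRingEnd ℂ) (τ : ℂ) * negForm φ x x
      + 2 * z * posForm φ x η - 2 * (starRingEnd ℂ) z * negForm φ x η)) := by
  rw [gaussTerm]
  congr 1
  rw [Fintype.sum_sum_type]
  have h1 : ∑ i : Fin p, (Real.pi * Complex.I * sgn (Sum.inl i : Fin p ⊕ Fin n)
      * (twist (τ : ℂ) (Sum.inl i : Fin p ⊕ Fin n) * (coord φ (x + 0) (Sum.inl i)) ^ 2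
      + 2 * twist z (Sum.inl i : Fin p ⊕ Fin n) * coord φ (x + 0) (Sum.inl i)
        * coord φ η (Sum.inl i) - (2 * coord φ x (Sum.inl i) + coord φ 0 (Sum.inl i))
        * coord φ 0 (Sum.inl i)) : ℂ)
      = Real.pi * Complex.I * (τ * posForm φ x x + 2 * z * posForm φ x η) := by
    rw [posForm_apply, posForm_apply, Complex.ofReal_sum, Complex.ofReal_sum, Finset.mul_sum,
      Finset.mul_sum, ← Finset.sum_add_distrib, Finset.mul_sum]
    refine Finset.sum_congr rfl fun i _ => ?_
    simp only [add_zero, map_zero, Prod.fst_zero, Pi.zero_apply, Complex.ofReal_zero, coord_inl, sgn, twist, Sum.elim_inl]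
    push_cast
    ring
  have h2 : ∑ i : Fin n, (Real.pi * Complex.I * sgn (Sum.inr i : Fin p ⊕ Fin n)
      * (twist (τ : ℂ) (Sum.inr i : Fin p ⊕ Fin n) * (coord φ (x + 0) (Sum.inr i)) ^ 2
      + 2 * twist z (Sum.inr i : Fin p ⊕ Fin n) * coord φ (x + 0) (Sum.inr i)
        * coord φ η (Sum.inr i) - (2 * coord φ x (Sum.inr i) + coord φ 0 (Sum.inr i))
        * coord φ 0 (Sum.inr i)) : ℂ)
      = -(Real.pi * Complex.I * ((starRingEnd ℂ) (τ : ℂ) * negForm φ x x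
        + 2 * (starRingEnd ℂ) z * negForm φ x η)) := by
    rw [negForm_apply, negForm_apply, Complex.ofReal_sum, Complex.ofReal_sum, Finset.mul_sum,
      Finset.mul_sum, ← Finset.sum_add_distrib, Finset.mul_sum, ← Finset.sum_neg_distrib]
    refine Finset.sum_congr rfl fun i _ => ?_
    simp only [add_zero, map_zero, Prod.snd_zero, Pi.zero_apply, Complex.ofReal_zero, coord_inr, sgn, twist, Sum.elim_inr]
    push_cast
    ring
  rw [h1, h2]
  ring

/-- The linear coefficient of the exponent of the theta terms along `u`. -/
def lineCoeff (x : V) : ℂ :=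
  Complex.I * (posForm φ u x - negForm φ u x : ℝ) * (starRingEnd ℂ) (τ : ℂ)
    - (2 * τ.im * posForm φ u (x + (z.im / τ.im) • η) : ℝ)

variable {φ η u}

theorem conj_eq (w : ℂ) : (starRingEnd ℂ) w = w - 2 * Complex.I * w.im := by
  have := Complex.sub_conj w
  push_cast at this
  linear_combination -this

/-- Both parts of u have the same length Q, so the quadratic coefficient along u is πi(τ - τ̄)Q =
-2π Im(τ) Q: a real Gaussian, to which one-dimensional Poisson summation applies. -/
theorem gaussTerm_add_smul (hB : IsIsometryToStd B φ) (huu : B u u = 0) (hηu : B η u = 0)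
    (x : V) (r : ℝ) :
    gaussTerm φ η τ z 0 0 (x + r • u) = gaussTerm φ η τ z 0 0 x
      * Complex.exp (-Real.pi * (2 * τ.im * posForm φ u u : ℝ) * r ^ 2
        + 2 * Real.pi * lineCoeff φ η τ z u x * r) := by
  have hN := negForm_self_eq hB huu
  rw [bilin_eq_posForm_sub hB] at hηu
  have hη : negForm φ u η = posForm φ u η := by
    rw [negForm_comm, posForm_comm]
    linarith
  have hy : (τ.im : ℂ) ≠ 0 := by exact_mod_cast τ.im_ne_zero
  rw [gaussTerm_zero, gaussTerm_zero, ← Complex.exp_add, lineCoeff, conj_eq (τ : ℂ), conj_eq z,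
    UpperHalfPlane.coe_im]
  congr 1
  have hξ : 2 * τ.im * posForm φ u (x + (z.im / τ.im) • η)
      = 2 * τ.im * posForm φ u x + 2 * z.im * posForm φ u η := by
    have := τ.im_ne_zero
    rw [map_add, map_smul, smul_eq_mul]
    field_simp
  rw [hξ]
  simp only [map_add, map_smul, LinearMap.add_apply, LinearMap.smul_apply, smul_eq_mul]
  rw [posForm_comm φ x u, negForm_comm φ x u, hN, hη]
  have hI := Complex.I_mul_I
  push_cast
  linear_combination (2 * Real.pi * posForm φ u u * τ.im * r ^ 2
    + 4 * Real.pi * r * (τ.im * posForm φ u x + z.im * posForm φ u η)) * hI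

/-- The Gaussian factor in the terms after Poisson summation along `u`. -/
def dualKernel (φ : V ≃ₗ[ℝ] (Fin p → ℝ) × (Fin n → ℝ)) (η : V) (τ : ℍ) (z : ℂ) (u x : V)
    (d : ℝ) : ℂ :=
  gaussTerm φ η τ z 0 0 x * Complex.exp (-Real.pi / (2 * τ.im * posForm φ u u : ℝ)
    * (d + Complex.I * lineCoeff φ η τ z u x) ^ 2)

theorem lineCoeff_add_smul (hB : IsIsometryToStd B φ) (huu : B u u = 0) (x : V) (r : ℝ) :
    lineCoeff φ η τ z u (x + r • u)
      = lineCoeff φ η τ z u x - r * (2 * τ.im * posForm φ u u : ℝ) := by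
  have hN := negForm_self_eq hB huu
  simp only [lineCoeff, map_add, map_smul, smul_eq_mul, hN]
  push_cast
  ring

/-- Translation along u becomes modulation after the Fourier transform. The phase e(rd) produces the
Fourier expansion in β = su, and later the characters of E_n. -/
theorem dualKernel_add_smul (hB : IsIsometryToStd B φ) (hu : u ≠ 0) (huu : B u u = 0)
    (hηu : B η u = 0) (x : V) (r d : ℝ) :
    dualKernel φ η τ z u (x + r • u) d = e (r * d) * dualKernel φ η τ z u x d := by
  have hA : ((2 * τ.im * posForm φ u u : ℝ) : ℂ) ≠ 0 := by
    exact_mod_cast (mul_pos (mul_pos two_pos τ.im_pos) (posForm_pos hB hu huu)).ne'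
  rw [dualKernel, dualKernel, gaussTerm_add_smul τ z hB huu hηu, lineCoeff_add_smul τ z hB huu,
    e, mul_assoc, ← Complex.exp_add, mul_left_comm, ← Complex.exp_add]
  congr 2
  generalize ((2 * τ.im * posForm φ u u : ℝ) : ℂ) = A at hA
  have hI := Complex.I_mul_I
  have hAJ := mul_inv_cancel₀ hA
  rw [div_eq_mul_inv]
  generalize A⁻¹ = J at hAJ
  generalize lineCoeff φ η τ z u x = ℓ
  linear_combination (2 * Real.pi * Complex.I * r * (d + Complex.I * ℓ)
    - Real.pi * Complex.I ^ 2 * r ^ 2 * A) * hAJ + (-Real.pi * A * r ^ 2 + 2 * Real.pi * ℓ * r) * hI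

/-- The parameters on which the terms after Poisson summation along `u` depend. -/
def dualCoords (φ : V ≃ₗ[ℝ] (Fin p → ℝ) × (Fin n → ℝ)) (u : V) :
    V × ℝ →ₗ[ℝ] (Fin p ⊕ Fin n → ℝ) × ℝ × ℝ :=
  LinearMap.prod
    (LinearMap.pi (Sum.elim
      (fun i => (LinearMap.proj i ∘ₗ LinearMap.fst ℝ _ _ ∘ₗ φ.toLinearMap
        - ((φ u).1 i / posForm φ u u) • posForm φ u) ∘ₗ LinearMap.fst ℝ V ℝ)
      (fun i => (LinearMap.proj i ∘ₗ LinearMap.snd ℝ _ _ ∘ₗ φ.toLinearMap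
        - ((φ u).2 i / negForm φ u u) • negForm φ u) ∘ₗ LinearMap.fst ℝ V ℝ)))
    (LinearMap.prod ((posForm φ u - negForm φ u) ∘ₗ LinearMap.fst ℝ V ℝ) (LinearMap.snd ℝ V ℝ))

theorem dualCoords_fst_inl (x : V) (d : ℝ) (i : Fin p) :
    (dualCoords φ u (x, d)).1 (Sum.inl i)
      = (φ x).1 i - (φ u).1 i / posForm φ u u * posForm φ u x := rfl

theorem dualCoords_fst_inr (x : V) (d : ℝ) (i : Fin n) :
    (dualCoords φ u (x, d)).1 (Sum.inr i)
      = (φ x).2 i - (φ u).2 i / negForm φ u u * negForm φ u x := rfl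

theorem dualCoords_snd (x : V) (d : ℝ) :
    (dualCoords φ u (x, d)).2 = (posForm φ u x - negForm φ u x, d) := rfl

theorem sum_sq_sub_smul {m : ℕ} (a b : Fin m → ℝ) (hb : ∑ i, b i * b i ≠ 0) :
    ∑ i, (a i - b i / (∑ i, b i * b i) * ∑ i, b i * a i) ^ 2
      = ∑ i, a i * a i - (∑ i, b i * a i) ^ 2 / ∑ i, b i * b i := by
  generalize hQ : ∑ i, b i * b i = Q at hb
  generalize hS : ∑ i, b i * a i = S
  have h : ∀ i, (a i - b i / Q * S) ^ 2
      = a i * a i - 2 * (S / Q) * (b i * a i) + (S / Q) ^ 2 * (b i * b i) := fun i => by ring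
  simp only [h]
  rw [Finset.sum_add_distrib, Finset.sum_sub_distrib, ← Finset.mul_sum, ← Finset.mul_sum, hQ, hS]
  field_simp
  ring

theorem sum_sq_dualCoords (hB : IsIsometryToStd B φ) (hu : u ≠ 0) (huu : B u u = 0)
    (x : V) (d : ℝ) :
    ∑ i, (dualCoords φ u (x, d)).1 i ^ 2 = posForm φ x x + negForm φ x x
      - (posForm φ u x ^ 2 + negForm φ u x ^ 2) / posForm φ u u := by
  have hQ := (posForm_pos hB hu huu).ne'
  have hQ' : negForm φ u u ≠ 0 := by rwa [negForm_self_eq hB huu]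
  rw [Fintype.sum_sum_type]
  simp only [dualCoords_fst_inl, dualCoords_fst_inr]
  have h1 := sum_sq_sub_smul (φ x).1 (φ u).1 hQ
  have h2 := sum_sq_sub_smul (φ x).2 (φ u).2 hQ'
  rw [← posForm_apply φ u u, ← posForm_apply φ u x, ← posForm_apply φ x x] at h1
  rw [← negForm_apply φ u u, ← negForm_apply φ u x, ← negForm_apply φ x x] at h2
  rw [h1, h2, negForm_self_eq hB huu]
  ring

/-- With c = (x, u), the last two terms combine to π‖cτ - d‖²/(2 Im(τ) Q), where Q is the length of
the positive part of u. So the kernel decays in c, in d and in the components orthogonal to both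
parts of u, which are exactly the entries of `dualCoords`. -/
theorem norm_dualKernel (hB : IsIsometryToStd B φ) (hu : u ≠ 0) (huu : B u u = 0)
    (hηu : B η u = 0) (x : V) (d : ℝ) :
    ‖dualKernel φ η τ z u x d‖
      = Real.exp (Real.pi * z.im ^ 2 / τ.im * (posForm φ η η + negForm φ η η))
        * Real.exp (-(Real.pi * τ.im
            * ∑ i, (dualCoords φ u (x + (z.im / τ.im) • η, d)).1 i ^ 2
          + Real.pi / (2 * τ.im * posForm φ u u) * (B x u * τ.re - d) ^ 2
          + Real.pi * τ.im / (2 * posForm φ u u) * (B x u) ^ 2)) := by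
  have hQ := (posForm_pos hB hu huu).ne'
  have hy := τ.im_ne_zero
  have hη : negForm φ u η = posForm φ u η := by
    rw [bilin_eq_posForm_sub hB] at hηu
    rw [negForm_comm, posForm_comm]
    linarith
  set P := posForm φ u (x + (z.im / τ.im) • η) with hP
  have hc : B x u = posForm φ u x - negForm φ u x := by
    rw [bilin_eq_posForm_sub hB, posForm_comm, negForm_comm]
  have hN : negForm φ u (x + (z.im / τ.im) • η) = P - B x u := by
    rw [hc, hP, map_add, map_add, map_smul, map_smul, hη]
    ring
  have h1 : (-Real.pi / (2 * τ.im * posForm φ u u : ℝ)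
      * (d + Complex.I * lineCoeff φ η τ z u x) ^ 2 : ℂ)
      = ((-Real.pi / (2 * τ.im * posForm φ u u) * ((d - B x u * τ.re) ^ 2
          - (B x u * τ.im - 2 * τ.im * P) ^ 2) : ℝ) : ℂ)
        + ((-Real.pi / (2 * τ.im * posForm φ u u) * (2 * (d - B x u * τ.re)
          * (B x u * τ.im - 2 * τ.im * P)) : ℝ) : ℂ) * Complex.I := by
    have hτ : (starRingEnd ℂ) (τ : ℂ) = τ.re - τ.im * Complex.I := by
      apply Complex.ext <;> simp
    have hI := Complex.I_mul_I
    rw [lineCoeff, ← hP, ← hc, hτ]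
    push_cast
    generalize (-Real.pi / (2 * τ.im * posForm φ u u) : ℂ) = J
    generalize (P : ℂ) = P'
    generalize (B x u : ℂ) = c
    have h2 : (d + Complex.I * (Complex.I * c * (τ.re - τ.im * Complex.I) - 2 * τ.im * P') : ℂ)
        = (d - c * τ.re) + (c * τ.im - 2 * τ.im * P') * Complex.I := by
      linear_combination (c * τ.re - c * τ.im * Complex.I) * hI
    rw [h2]
    linear_combination J * (c * τ.im - 2 * τ.im * P') ^ 2 * hI
  rw [dualKernel, norm_mul, norm_gaussTerm, Complex.norm_exp, h1, Complex.add_re,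
    Complex.ofReal_re, Complex.re_ofReal_mul, Complex.I_re, mul_zero, add_zero, add_zero, ← Real.exp_add,
    ← Real.exp_add, sum_sq_dualCoords hB hu huu, hN, ← hP]
  congr 1
  have h3 : ∑ i, coord φ x i ^ 2 = posForm φ x x + negForm φ x x := by
    rw [Fintype.sum_sum_type, posForm_apply, negForm_apply]
    simp only [coord_inl, coord_inr, sq]
  have h4 : ∑ i, coord φ x i * coord φ η i = posForm φ x η + negForm φ x η := by
    rw [Fintype.sum_sum_type, posForm_apply, negForm_apply]
    simp only [coord_inl, coord_inr]
  rw [h3, h4]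
  simp only [map_add, map_smul, LinearMap.add_apply, LinearMap.smul_apply, smul_eq_mul]
  rw [posForm_comm φ η x, negForm_comm φ η x]
  field_simp
  ring

end Isotropic
end JacobiTheta
end

noncomputable section

namespace JacobiTheta

open UpperHalfPlane

/-! ### Decay of the dual kernel and one-dimensional Poisson summation along u. -/

section Isotropic

variable {V : Type*} [AddCommGroup V] [Module ℝ V] {p n : ℕ}
variable {φ : V ≃ₗ[ℝ] (Fin p → ℝ) × (Fin n → ℝ)} {B : LinearMap.BilinForm ℝ V}
variable {η : V} (τ : ℍ) (z : ℂ) {u : V}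

theorem exists_norm_dualKernel_le (hB : IsIsometryToStd B φ) (hu : u ≠ 0) (huu : B u u = 0)
    (hηu : B η u = 0) : ∃ ε C : ℝ, 0 < ε ∧ 0 ≤ C ∧ ∀ x d, ‖dualKernel φ η τ z u x d‖
      ≤ C * Real.exp (-ε * ‖dualCoords φ u (x + (z.im / τ.im) • η, d)‖ ^ 2) := by
  have hQ := posForm_pos hB hu huu
  have hy := τ.im_pos
  set a₁ := Real.pi * τ.im
  set a₂ := Real.pi / (2 * τ.im * posForm φ u u)
  set a₃ := Real.pi * τ.im / (2 * posForm φ u u)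
  have h1 : 0 < a₁ := by positivity
  have h2 : 0 < a₂ := by positivity
  have h3 : 0 < a₃ := by positivity
  have hx : 0 < 1 + 2 * τ.re ^ 2 := by positivity
  -- From d² ≤ 2(c Re τ - d)² + 2(c Re τ)² one gets c² + d² ≤ (1 + 2(Re τ)²)c² + 2(c Re τ - d)²,
  -- which dictates the three bounds on ε.
  refine ⟨min a₁ (min (a₂ / 2) (a₃ / (1 + 2 * τ.re ^ 2))),
    Real.exp (Real.pi * z.im ^ 2 / τ.im * (posForm φ η η + negForm φ η η)),
    lt_min h1 (lt_min (by positivity) (by positivity)), Real.exp_nonneg _, fun x d => ?_⟩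
  rw [norm_dualKernel τ z hB hu huu hηu]
  refine mul_le_mul_of_nonneg_left (Real.exp_le_exp.mpr ?_) (Real.exp_nonneg _)
  set ε := min a₁ (min (a₂ / 2) (a₃ / (1 + 2 * τ.re ^ 2))) with hε
  have e1 : ε ≤ a₁ := min_le_left _ _
  have e2 : ε ≤ a₂ / 2 := (min_le_right _ _).trans (min_le_left _ _)
  have e3 : ε * (1 + 2 * τ.re ^ 2) ≤ a₃ := by
    rw [← le_div_iff₀ hx]
    exact (min_le_right _ _).trans (min_le_right _ _)
  have e0 : 0 < ε := lt_min h1 (lt_min (by positivity) (by positivity))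
  set R := dualCoords φ u (x + (z.im / τ.im) • η, d) with hR
  have hR2 : R.2 = (B x u, d) := by
    rw [hR, dualCoords_snd]
    have : B x u = B (x + (z.im / τ.im) • η) u := by
      rw [map_add, map_smul, LinearMap.add_apply, LinearMap.smul_apply, hηu, smul_zero, add_zero]
    rw [this, bilin_eq_posForm_sub hB, posForm_comm, negForm_comm]
  have hn : ‖R‖ ^ 2 ≤ ∑ i, R.1 i ^ 2 + (B x u ^ 2 + d ^ 2) := by
    have hs := sq_norm_le_sum R.1
    have hs0 : 0 ≤ ∑ i, R.1 i ^ 2 := Finset.sum_nonneg fun i _ => sq_nonneg _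
    rw [Prod.norm_def, Prod.norm_def, hR2]
    rcases max_cases ‖R.1‖ (max ‖B x u‖ ‖d‖) with ⟨h, -⟩ | ⟨h, -⟩
    · rw [h]
      nlinarith [sq_nonneg (B x u), sq_nonneg d]
    · rw [h]
      rcases max_cases ‖B x u‖ ‖d‖ with ⟨h, -⟩ | ⟨h, -⟩
      · rw [h, Real.norm_eq_abs, sq_abs]
        nlinarith [sq_nonneg (B x u), sq_nonneg d]
      · rw [h, Real.norm_eq_abs, sq_abs]
        nlinarith [sq_nonneg (B x u), sq_nonneg d]
  have hs0 : 0 ≤ ∑ i, R.1 i ^ 2 := Finset.sum_nonneg fun i _ => sq_nonneg _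
  have f1 := mul_le_mul_of_nonneg_left hn e0.le
  have f2 := mul_le_mul_of_nonneg_right e1 hs0
  have f3 := mul_le_mul_of_nonneg_right e2 (sq_nonneg (B x u * τ.re - d))
  have f4 := mul_le_mul_of_nonneg_right e3 (sq_nonneg (B x u))
  have f5 : 0 ≤ ε * (2 * B x u * τ.re - d) ^ 2 := mul_nonneg e0.le (sq_nonneg _)
  nlinarith [f1, f2, f3, f4, f5]

/-- A lattice vector l is encoded by its reduction l - (l, u')u and the number (l, u'). Thus the
double sum over lines and dual integers is itself a sum over L, and a Gaussian in an injective
linear image of L is summable. -/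
theorem summable_dualKernel_mul (hB : IsIsometryToStd B φ) {L : Submodule ℤ V}
    (hL : IsFullLattice L) (hu : u ≠ 0) (huu : B u u = 0) (hηu : B η u = 0) {u' : V}
    (huu' : B u u' = 1) (x₀ : V) {f : V → ℝ → ℂ} {C K : ℝ}
    (hf : ∀ x d, ‖f x d‖ ≤ C * Real.exp (K * ‖dualCoords φ u (x + (z.im / τ.im) • η, d)‖)) :
    Summable fun l : L => ‖dualKernel φ η τ z u (x₀ + (l - B l u' • u)) (B l u')‖
      * ‖f (x₀ + (l - B l u' • u)) (B l u')‖ := by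
  obtain ⟨ε, C', hε, hC', hle⟩ := exists_norm_dualKernel_le τ z hB hu huu hηu
  have hQ := (posForm_pos hB hu huu).ne'
  let pr : V →ₗ[ℝ] V × ℝ := LinearMap.prod (LinearMap.id - (B.flip u').smulRight u) (B.flip u')
  have hpr : ∀ l, pr l = (l - B l u' • u, B l u') := fun l => rfl
  let Φ := dualCoords φ u ∘ₗ pr
  have hΦ : Function.Injective Φ := by
    rw [← LinearMap.ker_eq_bot, LinearMap.ker_eq_bot']
    intro l hl
    change dualCoords φ u (pr l) = 0 at hl
    rw [hpr] at hl
    have hd : B l u' = 0 := by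
      have := congrArg (fun t => t.2.2) hl
      exact this
    rw [hd, zero_smul, sub_zero] at hl
    have hc : posForm φ u l = negForm φ u l := by
      have := congrArg (fun t => t.2.1) hl
      exact sub_eq_zero.mp this
    have hw : l = (posForm φ u l / posForm φ u u) • u := by
      apply φ.injective
      rw [map_smul]
      ext i
      · have := congrFun (congrArg (fun t => t.1) hl) (Sum.inl i)
        change (φ l).1 i - (φ u).1 i / posForm φ u u * posForm φ u l = 0 at this
        rw [Prod.smul_fst, Pi.smul_apply, smul_eq_mul]
        linear_combination this
      · have := congrFun (congrArg (fun t => t.1) hl) (Sum.inr i)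
        change (φ l).2 i - (φ u).2 i / negForm φ u u * negForm φ u l = 0 at this
        rw [negForm_self_eq hB huu, ← hc] at this
        rw [Prod.smul_snd, Pi.smul_apply, smul_eq_mul]
        linear_combination this
    rw [hw, map_smul, LinearMap.smul_apply, huu', smul_eq_mul, mul_one] at hd
    rw [hw, hd, zero_smul]
  obtain ⟨m, b, rfl⟩ := hL
  have hs := (summable_gaussian_span b Φ hΦ (dualCoords φ u (x₀ + (z.im / τ.im) • η, 0)) hε
    K).mul_left (C' * C)
  refine Summable.of_nonneg_of_le (fun _ => by positivity) (fun l => ?_) hs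
  have hv : dualCoords φ u (x₀ + (l - B l u' • u) + (z.im / τ.im) • η, B l u')
      = Φ l + dualCoords φ u (x₀ + (z.im / τ.im) • η, 0) := by
    change _ = dualCoords φ u (pr l) + _
    rw [hpr, ← map_add, Prod.mk_add_mk, add_zero]
    congr 2
    abel
  have h1 := hle (x₀ + (l - B l u' • u)) (B l u')
  have h2 := hf (x₀ + (l - B l u' • u)) (B l u')
  rw [hv] at h1 h2
  refine (mul_le_mul h1 h2 (norm_nonneg _) (by positivity)).trans (le_of_eq ?_)
  rw [Real.exp_add]
  ring

/-- The multiples du lie in L, reduce to zero and have (du, u') = d, so a fixed line is a subfamily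
of the lattice sum. -/
theorem summable_dualKernel_line (hB : IsIsometryToStd B φ) {L : Submodule ℤ V}
    (hL : IsFullLattice L) (huL : u ∈ L) (hu : u ≠ 0) (huu : B u u = 0) (hηu : B η u = 0) {u' : V}
    (huu' : B u u' = 1) (x : V) {f : V → ℝ → ℂ} {C K : ℝ}
    (hf : ∀ x d, ‖f x d‖ ≤ C * Real.exp (K * ‖dualCoords φ u (x + (z.im / τ.im) • η, d)‖)) :
    Summable fun d : ℤ => ‖dualKernel φ η τ z u x d‖ * ‖f x d‖ := by
  have h := summable_dualKernel_mul τ z hB hL hu huu hηu huu' x hf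
  let ι : ℤ → L := fun d => ⟨d • u, L.smul_mem d huL⟩
  have hι : ∀ d : ℤ, ((ι d : L) : V) = (d : ℝ) • u := fun d => (Int.cast_smul_eq_zsmul ℝ d u).symm
  have hb : ∀ d : ℤ, B (ι d : V) u' = d := by
    intro d
    rw [hι, map_smul, LinearMap.smul_apply, huu', smul_eq_mul, mul_one]
  have hinj : Function.Injective ι := by
    intro d d' hd
    have := congrArg (fun l : L => B (l : V) u') hd
    simp only [hb] at this
    exact_mod_cast this
  refine (h.comp_injective hinj).congr fun d => ?_
  simp only [Function.comp_apply, hb]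
  rw [hι, sub_self, add_zero]

/-- The variable `c τ̄ - d`. -/
def nuVar (B : LinearMap.BilinForm ℝ V) (τ : ℍ) (u x : V) (d : ℝ) : ℂ :=
  B x u * (starRingEnd ℂ) (τ : ℂ) - d

theorem norm_nuVar_le (hB : IsIsometryToStd B φ) (hηu : B η u = 0) (x : V) (d : ℝ) :
    ‖nuVar B τ u x d‖ ≤ (‖(τ : ℂ)‖ + 1) * ‖dualCoords φ u (x + (z.im / τ.im) • η, d)‖ := by
  set R := dualCoords φ u (x + (z.im / τ.im) • η, d) with hR
  have hR2 : R.2 = (B x u, d) := by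
    rw [hR, dualCoords_snd]
    have : B x u = B (x + (z.im / τ.im) • η) u := by
      rw [map_add, map_smul, LinearMap.add_apply, LinearMap.smul_apply, hηu, smul_zero, add_zero]
    rw [this, bilin_eq_posForm_sub hB, posForm_comm, negForm_comm]
  have h1 : ‖B x u‖ ≤ ‖R‖ := by
    have := (_root_.norm_fst_le R.2).trans (_root_.norm_snd_le R)
    rwa [hR2] at this
  have h2 : ‖d‖ ≤ ‖R‖ := by
    have := (_root_.norm_snd_le R.2).trans (_root_.norm_snd_le R)
    rwa [hR2] at this
  refine (norm_sub_le _ _).trans ?_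
  rw [norm_mul, Complex.norm_real, Complex.norm_real, RCLike.norm_conj]
  nlinarith [mul_le_mul_of_nonneg_right h1 (norm_nonneg (τ : ℂ))]

/-- Poisson summation in one variable, with the generating variable t. Completing the square splits
w into its part orthogonal to the positive part of u and a multiple κ of the latter; the second part
is then evaluated at iν/(2 Im τ) with ν = cτ̄ - d. -/
theorem tsum_gaussTerm_line (hB : IsIsometryToStd B φ) (hu : u ≠ 0) (huu : B u u = 0)
    (hηu : B η u = 0) (x : V) (w : Fin p → ℂ) (t : ℂ) :
    ∑' m : ℤ, gaussTerm φ η τ z 0 0 (x + (m : ℝ) • u)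
        * Complex.exp (-((∑ i, w i ^ 2) / (8 * Real.pi * τ.im)) * t ^ 2
          + (∑ i, w i * ((φ (x + (m : ℝ) • u + (z.im / τ.im) • η)).1 i : ℂ)) * t)
      = ∑' d : ℤ, (1 / ((2 * τ.im * posForm φ u u : ℝ) : ℂ) ^ (1 / 2 : ℂ)
          * dualKernel φ η τ z u x d)
        * Complex.exp (-((∑ i, (w i - (∑ i, w i * (φ u).1 i) / ((φ u).1 ⬝ᵥ (φ u).1 : ℝ)
              * (φ u).1 i) ^ 2) / (8 * Real.pi * τ.im)) * t ^ 2
          + (∑ i, (w i - (∑ i, w i * (φ u).1 i) / ((φ u).1 ⬝ᵥ (φ u).1 : ℝ) * (φ u).1 i)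
              * ((φ (x + (z.im / τ.im) • η)).1 i : ℂ)
            + Complex.I * nuVar B τ u x d / (2 * τ.im)
              * ((∑ i, w i * (φ u).1 i) / ((φ u).1 ⬝ᵥ (φ u).1 : ℝ))) * t) := by
  have hQ := (posForm_pos hB hu huu)
  have hy := τ.im_pos
  have hQQ : (φ u).1 ⬝ᵥ (φ u).1 = posForm φ u u := rfl
  rw [hQQ]
  set ω : ℂ := ∑ i, w i * (φ u).1 i with hω
  set ξ : V := x + (z.im / τ.im) • η with hξ
  have hQ0 : (posForm φ u u : ℂ) ≠ 0 := by exact_mod_cast hQ.ne'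
  set κ : ℂ := ω / (posForm φ u u : ℝ) with hκ
  have hωκ : ω = κ * posForm φ u u := by rw [hκ, div_mul_cancel₀ _ hQ0]
  have hW : ∑ i, (w i - κ * (φ u).1 i) ^ 2 = ∑ i, w i ^ 2 - κ ^ 2 * posForm φ u u := by
    have h : ∀ i, (w i - κ * (φ u).1 i) ^ 2
        = w i ^ 2 - 2 * κ * (w i * (φ u).1 i) + κ ^ 2 * (((φ u).1 i * (φ u).1 i : ℝ) : ℂ) := by
      intro i
      push_cast
      ring
    simp only [h]
    rw [Finset.sum_add_distrib, Finset.sum_sub_distrib, ← Finset.mul_sum, ← Finset.mul_sum, ← hω,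
      ← Complex.ofReal_sum, ← posForm_apply, hωκ]
    ring
  have hwξ : ∑ i, (w i - κ * (φ u).1 i) * ((φ ξ).1 i : ℂ)
      = ∑ i, w i * ((φ ξ).1 i : ℂ) - κ * posForm φ u ξ := by
    rw [posForm_apply, Complex.ofReal_sum, Finset.mul_sum, ← Finset.sum_sub_distrib]
    refine Finset.sum_congr rfl fun i _ => ?_
    push_cast
    ring
  have hL : ∀ m : ℤ, gaussTerm φ η τ z 0 0 (x + (m : ℝ) • u)
        * Complex.exp (-((∑ i, w i ^ 2) / (8 * Real.pi * τ.im)) * t ^ 2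
          + (∑ i, w i * ((φ (x + (m : ℝ) • u + (z.im / τ.im) • η)).1 i : ℂ)) * t)
      = gaussTerm φ η τ z 0 0 x * Complex.exp (-((∑ i, w i ^ 2) / (8 * Real.pi * τ.im)) * t ^ 2
          + (∑ i, w i * ((φ ξ).1 i : ℂ)) * t)
        * Complex.exp (-Real.pi * ((2 * τ.im * posForm φ u u : ℝ) : ℂ) * m ^ 2
          + 2 * Real.pi * (lineCoeff φ η τ z u x + t * ω / (2 * Real.pi)) * m) := by
    intro m
    have h1 : ∑ i, w i * ((φ (x + (m : ℝ) • u + (z.im / τ.im) • η)).1 i : ℂ)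
        = ∑ i, w i * ((φ ξ).1 i : ℂ) + m * ω := by
      rw [hω, Finset.mul_sum, ← Finset.sum_add_distrib]
      refine Finset.sum_congr rfl fun i _ => ?_
      rw [hξ]
      simp only [map_add, map_smul, Prod.fst_add, Prod.smul_fst, Pi.add_apply, Pi.smul_apply,
        smul_eq_mul]
      push_cast
      ring
    have hpi : (Real.pi : ℂ) ≠ 0 := by exact_mod_cast Real.pi_ne_zero
    rw [h1, gaussTerm_add_smul τ z hB huu hηu, mul_assoc (gaussTerm φ η τ z 0 0 x),
      mul_assoc (gaussTerm φ η τ z 0 0 x), ← Complex.exp_add, ← Complex.exp_add]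
    congr 2
    push_cast
    field_simp
    ring
  have hR : ∀ d : ℤ, gaussTerm φ η τ z 0 0 x
        * Complex.exp (-((∑ i, w i ^ 2) / (8 * Real.pi * τ.im)) * t ^ 2
          + (∑ i, w i * ((φ ξ).1 i : ℂ)) * t)
        * Complex.exp (-Real.pi / ((2 * τ.im * posForm φ u u : ℝ) : ℂ)
          * (d + Complex.I * (lineCoeff φ η τ z u x + t * ω / (2 * Real.pi))) ^ 2)
      = dualKernel φ η τ z u x d
        * Complex.exp (-((∑ i, (w i - κ * (φ u).1 i) ^ 2) / (8 * Real.pi * τ.im)) * t ^ 2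
          + (∑ i, (w i - κ * (φ u).1 i) * ((φ ξ).1 i : ℂ)
            + Complex.I * nuVar B τ u x d / (2 * τ.im) * κ) * t) := by
    intro d
    rw [dualKernel, mul_assoc (gaussTerm φ η τ z 0 0 x), mul_assoc (gaussTerm φ η τ z 0 0 x),
      ← Complex.exp_add, ← Complex.exp_add, hW, hwξ, nuVar]
    have hc : B x u = posForm φ u x - negForm φ u x := by
      rw [bilin_eq_posForm_sub hB, posForm_comm, negForm_comm]
    have hd : (((d : ℤ) : ℝ) : ℂ) + Complex.I * lineCoeff φ η τ z u x
        = -((B x u * (starRingEnd ℂ) (τ : ℂ) - d) + Complex.I * (2 * τ.im * posForm φ u ξ)) := by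
      rw [lineCoeff, ← hc, ← hξ]
      have hI := Complex.I_mul_I
      push_cast
      linear_combination (B x u * (starRingEnd ℂ) (τ : ℂ)) * hI
    have hd2 : (d : ℂ) + Complex.I * (lineCoeff φ η τ z u x + t * ω / (2 * Real.pi))
        = -((B x u * (starRingEnd ℂ) (τ : ℂ) - d) + Complex.I * (2 * τ.im * posForm φ u ξ))
          + Complex.I * t * ω / (2 * Real.pi) := by
      rw [← hd]
      push_cast
      ring
    rw [hd2, hd]
    congr 2
    have hpi : (Real.pi : ℂ) ≠ 0 := by exact_mod_cast Real.pi_ne_zero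
    have hy0 : (τ.im : ℂ) ≠ 0 := by exact_mod_cast hy.ne'
    rw [hωκ]
    push_cast
    generalize (B x u * (starRingEnd ℂ) (τ : ℂ) - d : ℂ) = ν
    have hI := Complex.I_sq
    field_simp
    ring_nf
    rw [hI]
    ring
  have hA : 0 < (((2 * τ.im * posForm φ u u : ℝ) : ℂ)).re := by
    rw [Complex.ofReal_re]
    positivity
  simp only [hL]
  rw [tsum_mul_left, Complex.tsum_exp_neg_quadratic hA, mul_left_comm, ← tsum_mul_left]
  simp only [hR]
  rw [← tsum_mul_left]
  exact tsum_congr fun d => (mul_assoc _ _ _).symm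

end Isotropic
end JacobiTheta
end

noncomputable section

namespace JacobiTheta

open UpperHalfPlane

/-! ### Poisson summation along u for theta series with polynomials. -/

section Isotropic

variable {V : Type*} [AddCommGroup V] [Module ℝ V] {p n : ℕ}
variable {B : LinearMap.BilinForm ℝ V} {φ : V ≃ₗ[ℝ] (Fin p → ℝ) × (Fin n → ℝ)}

theorem evalReal_add (P Q : MvPolynomial (Fin p) ℂ) (x : Fin p → ℝ) :
    evalReal (P + Q) x = evalReal P x + evalReal Q x := by
  simp [evalReal]

theorem evalReal_smul (c : ℂ) (P : MvPolynomial (Fin p) ℂ) (x : Fin p → ℝ) :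
    evalReal (c • P) x = c * evalReal P x := by
  simp [evalReal]

/-- For powers of linear forms, the component of index h is a power of a form orthogonal to v, and
the heat operator keeps it constant in the direction of v. -/
theorem evalReal_subPoly_sub_smul {k N : ℕ} {P : MvPolynomial (Fin p) ℂ} (hP : P.IsHomogeneous k)
    (hN : k ≤ N) (y : ℝ) {v : Fin p → ℝ} (hv : v ⬝ᵥ v ≠ 0) (h : ℕ) (x : Fin p → ℝ) (s : ℝ) :
    evalReal (heatLin N y (subPoly P v h)) (x - s • v)
      = evalReal (heatLin N y (subPoly P v h)) x := by
  have hmem := mem_span_linForm_pow hP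
  change evalReal (heatLin N y (subPolyLin v h P)) _ = evalReal (heatLin N y (subPolyLin v h P)) _
  clear hP
  induction hmem using Submodule.span_induction with
  | mem P hw =>
    obtain ⟨w, rfl⟩ := hw
    change evalReal (heatLin N y (subPoly (linForm w ^ k) v h)) _
      = evalReal (heatLin N y (subPoly (linForm w ^ k) v h)) _
    rw [subPoly_linForm_pow, map_smul, evalReal_smul, evalReal_smul,
      heatLin_linForm_pow _ _ _ _ (by omega), heatLin_linForm_pow _ _ _ _ (by omega)]
    congr 3
    rw [← sub_eq_zero, ← Finset.sum_sub_distrib]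
    set κ : ℂ := (∑ i, w i * v i) / (v ⬝ᵥ v : ℝ) with hκ
    have hv' : ((v ⬝ᵥ v : ℝ) : ℂ) ≠ 0 := by exact_mod_cast hv
    have h1 : κ * (v ⬝ᵥ v : ℝ) = ∑ i, w i * v i := by rw [hκ, div_mul_cancel₀ _ hv']
    have h2 : ∀ i, (w i - κ * v i) * ((x - s • v) i : ℂ) - (w i - κ * v i) * (x i : ℂ)
        = -s * (w i * v i) + s * κ * ((v i * v i : ℝ) : ℂ) := by
      intro i
      rw [Pi.sub_apply, Pi.smul_apply, smul_eq_mul]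
      push_cast
      ring
    simp only [h2]
    rw [Finset.sum_add_distrib, ← Finset.mul_sum, ← Finset.mul_sum, ← Complex.ofReal_sum, ← h1]
    change -(s : ℂ) * (κ * (v ⬝ᵥ v : ℝ)) + s * κ * (v ⬝ᵥ v : ℝ) = 0
    ring
  | zero => simp [evalReal]
  | add P Q _ _ ihP ihQ => rw [map_add, map_add, evalReal_add, evalReal_add, ihP, ihQ]
  | smul c P _ ih => rw [map_smul, map_smul, evalReal_smul, evalReal_smul, ih]

variable (B φ) (η : V) (τ : ℍ) (z : ℂ) (u : V)

/-- The polynomial factor in the terms after Poisson summation along `u`. -/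
def dualPoly (k : ℕ) (P : MvPolynomial (Fin p) ℂ) (x : V) (d : ℝ) : ℂ :=
  ∑ h ∈ Finset.range (k + 1), (Complex.I * nuVar B τ u x d / (2 * τ.im)) ^ h
    * evalReal (heatLin k τ.im (subPolyLin (φ u).1 h P)) (φ (x + (z.im / τ.im) • η)).1

/-- The terms after Poisson summation along `u`. -/
def dualTerm (k : ℕ) (P : MvPolynomial (Fin p) ℂ) (x : V) (d : ℝ) : ℂ :=
  1 / ((2 * τ.im * posForm φ u u : ℝ) : ℂ) ^ (1 / 2 : ℂ) * dualKernel φ η τ z u x d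
    * dualPoly B φ η τ z u k P x d

theorem dualPoly_add (k : ℕ) (P Q : MvPolynomial (Fin p) ℂ) (x : V) (d : ℝ) :
    dualPoly B φ η τ z u k (P + Q) x d
      = dualPoly B φ η τ z u k P x d + dualPoly B φ η τ z u k Q x d := by
  simp only [dualPoly, map_add, evalReal_add, mul_add, Finset.sum_add_distrib]

theorem dualPoly_smul (k : ℕ) (c : ℂ) (P : MvPolynomial (Fin p) ℂ) (x : V) (d : ℝ) :
    dualPoly B φ η τ z u k (c • P) x d = c * dualPoly B φ η τ z u k P x d := by
  simp only [dualPoly, map_smul, evalReal_smul, Finset.mul_sum, mul_left_comm]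

variable {B φ η u}

theorem dualPoly_add_smul (hB : IsIsometryToStd B φ) (hu : u ≠ 0) (huu : B u u = 0) {k : ℕ}
    {P : MvPolynomial (Fin p) ℂ} (hP : P.IsHomogeneous k) (x : V) (r d : ℝ) :
    dualPoly B φ η τ z u k P (x + r • u) d = dualPoly B φ η τ z u k P x d := by
  have hν : nuVar B τ u (x + r • u) d = nuVar B τ u x d := by
    rw [nuVar, nuVar, map_add, map_smul, LinearMap.add_apply, LinearMap.smul_apply, huu, smul_zero,
      add_zero]
  refine Finset.sum_congr rfl fun h _ => ?_
  rw [hν]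
  congr 1
  have h1 := evalReal_subPoly_sub_smul hP le_rfl τ.im (v := (φ u).1)
    (posForm_pos hB hu huu).ne' h (φ (x + r • u + (z.im / τ.im) • η)).1 r
  refine h1.symm.trans ?_
  congr 1
  rw [← Prod.smul_fst, ← map_smul, ← Prod.fst_sub, ← map_sub]
  congr 2
  abel

theorem dualTerm_add_smul (hB : IsIsometryToStd B φ) (hu : u ≠ 0) (huu : B u u = 0)
    (hηu : B η u = 0) {k : ℕ} {P : MvPolynomial (Fin p) ℂ} (hP : P.IsHomogeneous k) (x : V)
    (r d : ℝ) :
    dualTerm B φ η τ z u k P (x + r • u) d = e (r * d) * dualTerm B φ η τ z u k P x d := by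
  rw [dualTerm, dualTerm, dualPoly_add_smul τ z hB hu huu hP,
    dualKernel_add_smul τ z hB hu huu hηu]
  ring

/-- The dual kernel gives no decay in the direction of u, so the growth must be bounded by
coordinates modulo u. Invariance along the positive part of u permits evaluation at the orthogonal
projection. -/
theorem exists_norm_evalReal_subPoly_le (hB : IsIsometryToStd B φ) (hu : u ≠ 0) (huu : B u u = 0)
    {k : ℕ} {P : MvPolynomial (Fin p) ℂ} (hP : P.IsHomogeneous k) (y : ℝ) (h : ℕ) :
    ∃ C K : ℝ, 0 ≤ C ∧ 0 ≤ K ∧ ∀ x d, ‖evalReal (heatLin k y (subPolyLin (φ u).1 h P)) (φ x).1‖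
      ≤ C * Real.exp (K * ‖dualCoords φ u (x, d)‖) := by
  have hQ := posForm_pos hB hu huu
  obtain ⟨C, K, hC, hK, hle⟩ := exists_norm_evalReal_le (heatLin k y (subPolyLin (φ u).1 h P))
  refine ⟨C, K, hC, hK, fun x d => ?_⟩
  set R := dualCoords φ u (x, d) with hR
  have e1 := evalReal_subPoly_sub_smul hP le_rfl y (v := (φ u).1) hQ.ne' h (φ x).1
    (posForm φ u x / posForm φ u u)
  change evalReal (heatLin k y (subPolyLin (φ u).1 h P)) _
    = evalReal (heatLin k y (subPolyLin (φ u).1 h P)) _ at e1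
  rw [← e1]
  refine (hle _).trans (mul_le_mul_of_nonneg_left (Real.exp_le_exp.mpr
    (mul_le_mul_of_nonneg_left ?_ hK)) hC)
  rw [pi_norm_le_iff_of_nonneg (norm_nonneg _)]
  intro i
  have e2 : ((φ x).1 - (posForm φ u x / posForm φ u u) • (φ u).1) i = R.1 (Sum.inl i) := by
    rw [hR, dualCoords_fst_inl, Pi.sub_apply, Pi.smul_apply, smul_eq_mul]
    ring
  rw [e2]
  exact (norm_le_pi_norm R.1 (Sum.inl i)).trans (_root_.norm_fst_le R)

theorem exists_norm_dualPoly_le (hB : IsIsometryToStd B φ) (hu : u ≠ 0) (huu : B u u = 0)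
    (hηu : B η u = 0) {k : ℕ} {P : MvPolynomial (Fin p) ℂ} (hP : P.IsHomogeneous k) :
    ∃ C K : ℝ, ∀ x d, ‖dualPoly B φ η τ z u k P x d‖
      ≤ C * Real.exp (K * ‖dualCoords φ u (x + (z.im / τ.im) • η, d)‖) := by
  choose C K hC hK hle using fun h : ℕ => exists_norm_evalReal_subPoly_le hB hu huu hP τ.im h
  set c : ℝ := (‖(τ : ℂ)‖ + 1) / (2 * τ.im) with hc
  have hc0 : 0 ≤ c := div_nonneg (by positivity) (by have := τ.im_pos; positivity)
  refine ⟨∑ h ∈ Finset.range (k + 1), h.factorial * C h,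
    c + ∑ h ∈ Finset.range (k + 1), K h, fun x d => ?_⟩
  set ξ := x + (z.im / τ.im) • η with hξ
  set R := dualCoords φ u (ξ, d) with hR
  rw [dualPoly, Finset.sum_mul]
  refine (norm_sum_le _ _).trans (Finset.sum_le_sum fun h hh => ?_)
  have h1 : ‖(Complex.I * nuVar B τ u x d / (2 * τ.im)) ^ h‖
      ≤ h.factorial * Real.exp (c * ‖R‖) := by
    have e1 : ‖Complex.I * nuVar B τ u x d / (2 * τ.im)‖ ≤ c * ‖R‖ := by
      rw [norm_div, norm_mul, Complex.norm_I, one_mul, norm_mul, Complex.norm_ofNat,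
        Complex.norm_real, Real.norm_of_nonneg τ.im_pos.le, hc, div_mul_eq_mul_div]
      exact div_le_div_of_nonneg_right (norm_nuVar_le τ z hB hηu x d)
        (by have := τ.im_pos; positivity)
    rw [norm_pow]
    refine (pow_le_pow_left₀ (norm_nonneg _) e1 h).trans ?_
    have := Real.pow_div_factorial_le_exp _ (mul_nonneg hc0 (norm_nonneg R)) h
    rwa [div_le_iff₀ (by positivity), mul_comm (Real.exp _)] at this
  have h2 : ‖evalReal (heatLin k τ.im (subPolyLin (φ u).1 h P)) (φ ξ).1‖
      ≤ C h * Real.exp (K h * ‖R‖) := hle h ξ d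
  rw [norm_mul]
  refine (mul_le_mul h1 h2 (norm_nonneg _) (by positivity)).trans ?_
  have h3 : K h ≤ ∑ h ∈ Finset.range (k + 1), K h :=
    Finset.single_le_sum (f := K) (fun i _ => hK i) hh
  have h4 : Real.exp (c * ‖R‖) * Real.exp (K h * ‖R‖)
      ≤ Real.exp ((c + ∑ h ∈ Finset.range (k + 1), K h) * ‖R‖) := by
    rw [← Real.exp_add, ← add_mul]
    exact Real.exp_le_exp.mpr (mul_le_mul_of_nonneg_right (by linarith) (norm_nonneg R))
  calc _ = h.factorial * C h * (Real.exp (c * ‖R‖) * Real.exp (K h * ‖R‖)) := by ring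
    _ ≤ _ := mul_le_mul_of_nonneg_left h4 (mul_nonneg (by positivity) (hC h))

theorem summable_dualTerm (hB : IsIsometryToStd B φ) {L : Submodule ℤ V}
    (hL : IsFullLattice L) (hu : u ≠ 0) (huu : B u u = 0) (hηu : B η u = 0) {u' : V}
    (huu' : B u u' = 1) {k : ℕ} {P : MvPolynomial (Fin p) ℂ} (hP : P.IsHomogeneous k) (x₀ : V) :
    Summable fun l : L =>
      ‖dualTerm B φ η τ z u k P (x₀ + (l - B l u' • u)) (B l u')‖ := by
  obtain ⟨C, K, h⟩ := exists_norm_dualPoly_le τ z hB hu huu hηu hP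
  have := (summable_dualKernel_mul τ z hB hL hu huu hηu huu' x₀ h).mul_left
    ‖1 / ((2 * τ.im * posForm φ u u : ℝ) : ℂ) ^ (1 / 2 : ℂ)‖
  refine this.congr fun l => ?_
  rw [dualTerm, norm_mul, norm_mul, ← mul_assoc]

theorem summable_dualTerm_line (hB : IsIsometryToStd B φ) {L : Submodule ℤ V}
    (hL : IsFullLattice L) (huL : u ∈ L) (hu : u ≠ 0) (huu : B u u = 0) (hηu : B η u = 0) {u' : V}
    (huu' : B u u' = 1) {k : ℕ} {P : MvPolynomial (Fin p) ℂ} (hP : P.IsHomogeneous k) (x : V) :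
    Summable fun d : ℤ => ‖dualTerm B φ η τ z u k P x d‖ := by
  obtain ⟨C, K, h⟩ := exists_norm_dualPoly_le τ z hB hu huu hηu hP
  have := (summable_dualKernel_line τ z hB hL huL hu huu hηu huu' x h).mul_left
    ‖1 / ((2 * τ.im * posForm φ u u : ℝ) : ℂ) ^ (1 / 2 : ℂ)‖
  refine this.congr fun l => ?_
  rw [dualTerm, norm_mul, norm_mul, ← mul_assoc]

theorem summable_line {L : Submodule ℤ V} (huL : u ∈ L) (hu : u ≠ 0) {f : V → ℝ} {x : V}
    (hf : Summable fun l : L => f (l + x)) : Summable fun m : ℤ => f (x + (m : ℝ) • u) := by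
  let ι : ℤ → L := fun d => ⟨d • u, L.smul_mem d huL⟩
  have hι : ∀ d : ℤ, ((ι d : L) : V) = (d : ℝ) • u := fun d => (Int.cast_smul_eq_zsmul ℝ d u).symm
  have hinj : Function.Injective ι := by
    intro d d' hd
    have h := congrArg (fun l : L => (l : V)) hd
    simp only [hι] at h
    exact_mod_cast smul_left_injective ℝ hu h
  refine (hf.comp_injective hinj).congr fun d => ?_
  rw [Function.comp_apply, hι, add_comm]

/-- Compare coefficients of t^k in `tsum_gaussTerm_line`. The sum over h comes from
`hermiteCoeff_add`, applied to the orthogonal part of w and the extra term in ν. -/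
theorem tsum_thetaTerm_line (hB : IsIsometryToStd B φ) {L : Submodule ℤ V}
    (hL : IsFullLattice L) (huL : u ∈ L) (hu : u ≠ 0) (huu : B u u = 0) (hηu : B η u = 0) {u' : V}
    (huu' : B u u' = 1) {k : ℕ} {P : MvPolynomial (Fin p) ℂ} (hP : P.IsHomogeneous k) (x : V) :
    ∑' m : ℤ, thetaTerm φ η τ z 0 0 k P (x + (m : ℝ) • u)
      = ∑' d : ℤ, dualTerm B φ η τ z u k P x d := by
  have hQ := posForm_pos hB hu huu
  have hs1 : ∀ P, Summable fun m : ℤ => thetaTerm φ η τ z 0 0 k P (x + (m : ℝ) • u) := fun P =>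
    (summable_line (f := fun x => ‖thetaTerm φ η τ z 0 0 k P x‖) huL hu
      (summable_thetaTerm φ η τ z 0 0 hL x k P)).of_norm
  have hmem := mem_span_linForm_pow hP
  have hhom : ∀ Q ∈ Submodule.span ℂ (Set.range fun w : Fin p → ℂ => linForm w ^ k),
      Q.IsHomogeneous k := by
    have : Submodule.span ℂ (Set.range fun w : Fin p → ℂ => linForm w ^ k)
        ≤ MvPolynomial.homogeneousSubmodule (Fin p) ℂ k := by
      rw [Submodule.span_le]
      rintro _ ⟨w, rfl⟩
      exact linForm_isHomogeneous w k
    exact fun Q hQ => this hQ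
  have hs2 : ∀ Q ∈ Submodule.span ℂ (Set.range fun w : Fin p → ℂ => linForm w ^ k),
      Summable fun d : ℤ => dualTerm B φ η τ z u k Q x d := fun Q hQ =>
    (summable_dualTerm_line τ z hB hL huL hu huu hηu huu' (hhom Q hQ) x).of_norm
  clear hP
  induction hmem using Submodule.span_induction with
  | mem P h =>
    obtain ⟨w, rfl⟩ := h
    set r := z.im / τ.im with hr
    set ω : ℂ := ∑ i, w i * (φ u).1 i with hω
    set κ : ℂ := ω / ((φ u).1 ⬝ᵥ (φ u).1 : ℝ) with hκ
    set w' : Fin p → ℂ := fun i => w i - κ * (φ u).1 i with hw'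
    set ξ := x + r • η with hξ
    have hx1 : Summable fun m : ℤ => ‖gaussTerm φ η τ z 0 0 (x + (m : ℝ) • u)‖
        * Real.exp ‖∑ i, w i * ((φ (x + (m : ℝ) • u + r • η)).1 i : ℂ)‖ :=
      summable_line (f := fun x => ‖gaussTerm φ η τ z 0 0 x‖
        * Real.exp ‖∑ i, w i * ((φ (x + r • η)).1 i : ℂ)‖) huL hu
        (summable_gaussTerm_exp (φ := φ) hL η τ z 0 0 x (r • η) w)
    have hx2 : Summable fun d : ℤ => ‖1 / ((2 * τ.im * posForm φ u u : ℝ) : ℂ) ^ (1 / 2 : ℂ)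
          * dualKernel φ η τ z u x d‖
        * Real.exp ‖∑ i, w' i * ((φ ξ).1 i : ℂ)
          + Complex.I * nuVar B τ u x d / (2 * τ.im) * κ‖ := by
      set c : ℝ := ‖κ / (2 * τ.im)‖ * (‖(τ : ℂ)‖ + 1) with hc
      have h := (summable_dualKernel_line τ z hB hL huL hu huu hηu huu' x
        (f := fun x d => ((Real.exp ‖∑ i, w' i * ((φ ξ).1 i : ℂ)
          + Complex.I * nuVar B τ u x d / (2 * τ.im) * κ‖ : ℝ) : ℂ))
        (C := Real.exp ‖∑ i, w' i * ((φ ξ).1 i : ℂ)‖) (K := c) (fun x d => by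
          rw [Complex.norm_real, Real.norm_of_nonneg (Real.exp_nonneg _), ← Real.exp_add,
            Real.exp_le_exp]
          refine (norm_add_le _ _).trans (add_le_add_right ?_ _)
          rw [show Complex.I * nuVar B τ u x d / (2 * τ.im) * κ
            = κ / (2 * τ.im) * (Complex.I * nuVar B τ u x d) by ring, norm_mul, norm_mul,
            Complex.norm_I, one_mul, hc, mul_assoc]
          exact mul_le_mul_of_nonneg_left (norm_nuVar_le τ z hB hηu x d) (norm_nonneg _))).mul_left
        ‖1 / ((2 * τ.im * posForm φ u u : ℝ) : ℂ) ^ (1 / 2 : ℂ)‖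
      refine h.congr fun d => ?_
      rw [Complex.norm_real, Real.norm_of_nonneg (Real.exp_nonneg _), norm_mul, ← mul_assoc]
    have key := tsum_hermiteCoeff_eq hx1 hx2 (a := (∑ i, w i ^ 2) / (8 * Real.pi * τ.im))
      (a' := (∑ i, w' i ^ 2) / (8 * Real.pi * τ.im)) (fun t _ =>
        tsum_gaussTerm_line τ z hB hu huu hηu x w t) k
    have e1 : ∀ m : ℤ, thetaTerm φ η τ z 0 0 k (linForm w ^ k) (x + (m : ℝ) • u)
        = k.factorial * (gaussTerm φ η τ z 0 0 (x + (m : ℝ) • u)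
          * hermiteCoeff k ((∑ i, w i ^ 2) / (8 * Real.pi * τ.im))
            (∑ i, w i * ((φ (x + (m : ℝ) • u + r • η)).1 i : ℂ))) := by
      intro m
      rw [thetaTerm, heatLin_linForm_pow k _ w _ (N := k) (by omega), add_zero]
      ring
    have e2 : ∀ d : ℤ, dualTerm B φ η τ z u k (linForm w ^ k) x d
        = k.factorial * (1 / ((2 * τ.im * posForm φ u u : ℝ) : ℂ) ^ (1 / 2 : ℂ)
          * dualKernel φ η τ z u x d * hermiteCoeff k ((∑ i, w' i ^ 2) / (8 * Real.pi * τ.im))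
            (∑ i, w' i * ((φ ξ).1 i : ℂ) + Complex.I * nuVar B τ u x d / (2 * τ.im) * κ)) := by
      intro d
      rw [dualTerm, hermiteCoeff_add, mul_left_comm]
      congr 1
      rw [dualPoly, Finset.mul_sum]
      refine Finset.sum_congr rfl fun h hh => ?_
      have hhk : h ≤ k := Nat.lt_succ_iff.mp (Finset.mem_range.mp hh)
      change _ * evalReal (heatLin k τ.im (subPoly (linForm w ^ k) (φ u).1 h)) _ = _
      rw [subPoly_linForm_pow, map_smul, evalReal_smul, heatLin_linForm_pow _ _ _ _ (by omega),
        ← hω, ← hκ]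
      -- The binomial coefficient from `subPoly_linForm_pow` turns k! into h!(k - h)!, matching the
      -- two factors of the Hermite decomposition.
      have hf := Nat.choose_mul_factorial_mul_factorial hhk
      have hf' : ((k.choose h : ℕ) : ℂ) * h.factorial * (k - h).factorial = k.factorial := by
        exact_mod_cast hf
      have hh0 : (h.factorial : ℂ) ≠ 0 := by exact_mod_cast h.factorial_ne_zero
      rw [← hf', mul_pow]
      field_simp
      rfl
    simp only [e1, e2]
    rw [tsum_mul_left, tsum_mul_left, key]
  | zero => simp [thetaTerm, dualTerm, dualPoly, evalReal]
  | add P Q hP hQ ihP ihQ =>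
    have e1 : ∀ x, thetaTerm φ η τ z 0 0 k (P + Q) x
        = thetaTerm φ η τ z 0 0 k P x + thetaTerm φ η τ z 0 0 k Q x := by
      intro x
      rw [thetaTerm, map_add, evalReal_add, add_mul]
      rfl
    have e2 : ∀ d, dualTerm B φ η τ z u k (P + Q) x d
        = dualTerm B φ η τ z u k P x d + dualTerm B φ η τ z u k Q x d := by
      intro d
      rw [dualTerm, dualPoly_add, mul_add]
      rfl
    simp only [e1, e2]
    rw [(hs1 P).tsum_add (hs1 Q), (hs2 P hP).tsum_add (hs2 Q hQ), ihP, ihQ]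
  | smul c P _ ih =>
    have e1 : ∀ x, thetaTerm φ η τ z 0 0 k (c • P) x = c * thetaTerm φ η τ z 0 0 k P x := by
      intro x
      rw [thetaTerm, map_smul, evalReal_smul, mul_assoc]
      rfl
    have e2 : ∀ d, dualTerm B φ η τ z u k (c • P) x d = c * dualTerm B φ η τ z u k P x d := by
      intro d
      rw [dualTerm, dualPoly_smul, mul_left_comm]
      rfl
    simp only [e1, e2]
    rw [tsum_mul_left, tsum_mul_left, ih]

end Isotropic
end JacobiTheta
end

noncomputable section

namespace JacobiTheta

open UpperHalfPlane

/-! ### Fourier coefficients of theta functions in an isotropic direction -/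

section Fourier

variable {V : Type*} [AddCommGroup V] [Module ℝ V] {p n : ℕ}

/-- As u is isotropic, α = ru contributes only the phase -r(x, u), without a term in rs, and β = su
is a translation along u. -/
theorem thetaTerm_smul_smul {B : LinearMap.BilinForm ℝ V}
    {φ : V ≃ₗ[ℝ] (Fin p → ℝ) × (Fin n → ℝ)} (hB : IsIsometryToStd B φ) (η : V) (τ : ℍ) (z : ℂ)
    {u : V} (huu : B u u = 0) (r s : ℝ) (k : ℕ) (P : MvPolynomial (Fin p) ℂ) (x : V) :
    thetaTerm φ η τ z (r • u) (s • u) k P x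
      = e ((-(r * B x u) : ℝ)) * thetaTerm φ η τ z 0 0 k P (x + s • u) := by
  have h1 : x + s • u + (z.im / τ.im) • η + 0 = x + (z.im / τ.im) • η + s • u := by abel
  have h2 : gaussTerm φ η τ z (r • u) (s • u) x
      = e ((-(r * B x u) : ℝ)) * gaussTerm φ η τ z 0 0 (x + s • u) := by
    have e1 : -(r * B x u) = ∑ i, sgn (p := p) (n := n) i
        * (-(1 / 2) * (2 * coord φ x i + coord φ (s • u) i) * coord φ (r • u) i) := by
      have e2 : B ((2 : ℝ) • x + s • u) (r • u) = 2 * (r * B x u) := by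
        simp only [map_add, LinearMap.add_apply, map_smul, LinearMap.smul_apply, huu, smul_eq_mul]
        ring
      have e3 := bilin_eq_sum_coord hB ((2 : ℝ) • x + s • u) (r • u)
      rw [e2] at e3
      have e4 : ∀ i, coord φ ((2 : ℝ) • x + s • u) i = 2 * coord φ x i + coord φ (s • u) i := by
        intro i
        rw [map_add, map_smul, Pi.add_apply, Pi.smul_apply, smul_eq_mul]
      simp only [e4] at e3
      rw [show -(r * B x u) = -(1 / 2) * (2 * (r * B x u)) by ring, e3, Finset.mul_sum]
      exact Finset.sum_congr rfl fun i _ => by ring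
    rw [gaussTerm, gaussTerm, e, ← Complex.exp_add]
    congr 1
    rw [e1, Complex.ofReal_sum, Finset.mul_sum, ← Finset.sum_add_distrib]
    refine Finset.sum_congr rfl fun i _ => ?_
    have e5 : coord φ (0 : V) i = 0 := by rcases i with i | i <;> simp [coord]
    rw [add_zero, e5]
    push_cast
    ring
  rw [thetaTerm, thetaTerm, h1, h2]
  ring

variable (B : LinearMap.BilinForm ℝ V) (L : Submodule ℤ V)
  (φ : V ≃ₗ[ℝ] (Fin p → ℝ) × (Fin n → ℝ)) (η u u' : V) (k : ℕ) (P : MvPolynomial (Fin p) ℂ)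
  (τ : ℍ) (z : ℂ)

/-- The Fourier coefficients of the theta function in the direction of `u`. -/
def dualCoeff (m : Fin 2 → ℤ) : Disc B L → ℂ := fun σ =>
  ((τ.im ^ ((n : ℝ) / 2) * Real.exp (-2 * Real.pi * (∑ j, (φ η).2 j ^ 2) * (z.im ^ 2 / τ.im)) : ℝ)
      : ℂ)
    * ∑' x : {x : V // (InClass B L σ x ∧ B (x - repr B L σ) u' = 0) ∧ B x u = m 0},
        dualTerm B φ η τ z u k P x (m 1)

variable {B L φ η u u' k P}

/-- The condition (x - x₀, u') = 0 selects one point on each line x + ℤu of the class, because (u,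
u') = 1. Poisson summation on each line, translated by β = su, gives the phase e(sd); absolute
convergence allows regrouping by the pair ((x, u), d). -/
theorem hasSum_dualCoeff (hB : IsIsometryToStd B φ) (hL : IsFullLattice L)
    (hLe : IsEvenLattice B L) (huL : u ∈ L) (hu : u ≠ 0) (huu : B u u = 0) (hηu : B η u = 0)
    (hu'L : u' ∈ dualLattice B L) (huu' : B u u' = 1) (hP : P.IsHomogeneous k) (r s : ℝ) :
    HasSum (fun m : Fin 2 → ℤ => e ((-(r * m 0) + s * m 1 : ℝ)) •
        dualCoeff B L φ η u u' k P τ z m)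
      (thetaVec B L φ η k P τ z (r • u) (s • u)) := by
  rw [Pi.hasSum]
  intro σ
  have hle : L ≤ dualLattice B L := fun x hx => mem_dualLattice_of_mem hB hLe hx
  set x₀ := repr B L σ with hx₀
  have h₀ : InClass B L σ x₀ := inClass_repr σ
  let S := {x : V // InClass B L σ x ∧ B (x - x₀) u' = 0}
  have hxL : ∀ x : S, (x : V) - x₀ ∈ L := fun x => (inClass_iff_sub_mem h₀ hle).mp x.2.1
  have hu'int : ∀ l ∈ L, ∃ d : ℤ, B l u' = d := by
    intro l hl
    obtain ⟨d, hd⟩ := hu'L.2 l hl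
    exact ⟨d, by rw [bilin_symm hB, hd]⟩
  have huint : ∀ x : S, ∃ c : ℤ, B x u = c := fun x => x.2.1.1.2 u huL
  choose c hc using huint
  -- Each vector of L is a selected point minus x₀ plus an integral multiple of u; the multiple is
  -- recovered by pairing with u'.
  let ψ : S × ℤ → L := fun w => ⟨(w.1 : V) - x₀ + w.2 • u, L.add_mem (hxL w.1) (L.smul_mem _ huL)⟩
  have hψ : ∀ w : S × ℤ, ((ψ w : L) : V) = (w.1 : V) - x₀ + (w.2 : ℝ) • u := fun w => by
    rw [Int.cast_smul_eq_zsmul]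
  have hψu' : ∀ w : S × ℤ, B (ψ w) u' = w.2 := by
    intro w
    rw [hψ, map_add, LinearMap.add_apply, w.1.2.2, map_smul, LinearMap.smul_apply, huu', zero_add,
      smul_eq_mul, mul_one]
  have hbij : Function.Bijective ψ := by
    constructor
    · intro w w' h
      have h2 : w.2 = w'.2 := by
        have := hψu' w
        rw [h, hψu'] at this
        exact_mod_cast this.symm
      have h1 : (w.1 : V) = w'.1 := by
        have e1 := hψ w
        rw [h, hψ, h2] at e1
        simpa using e1.symm
      exact Prod.ext (Subtype.ext h1) h2
    · intro l
      obtain ⟨d, hd⟩ := hu'int l l.2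
      refine ⟨(⟨x₀ + l - (d : ℝ) • u, ?_, ?_⟩, d), ?_⟩
      · rw [inClass_iff_sub_mem h₀ hle, Int.cast_smul_eq_zsmul]
        have : x₀ + (l : V) - d • u - x₀ = l - d • u := by abel
        rw [this]
        exact L.sub_mem l.2 (L.smul_mem _ huL)
      · have : x₀ + (l : V) - (d : ℝ) • u - x₀ = l - (d : ℝ) • u := by abel
        rw [this, map_sub, LinearMap.sub_apply, map_smul, LinearMap.smul_apply, huu', hd]
        simp
      · refine Subtype.ext ?_
        rw [hψ]
        change x₀ + (l : V) - (d : ℝ) • u - x₀ + (d : ℝ) • u = l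
        abel
  let Ψ : S × ℤ ≃ L := Equiv.ofBijective ψ hbij
  have hT : Summable fun w : S × ℤ => ‖dualTerm B φ η τ z u k P w.1 w.2‖ := by
    refine ((summable_dualTerm τ z hB hL hu huu hηu huu' hP x₀).comp_injective
      Ψ.injective).congr fun w => ?_
    change ‖dualTerm B φ η τ z u k P (x₀ + (ψ w - B (ψ w) u' • u)) (B (ψ w) u')‖ = _
    rw [hψu', hψ]
    congr 2
    abel
  set f : S × ℤ → ℂ := fun w => e ((-(r * c w.1) + s * w.2 : ℝ)) * dualTerm B φ η τ z u k P w.1 w.2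
    with hf
  have hfs : Summable f := by
    refine Summable.of_norm (hT.congr fun w => ?_)
    rw [hf, norm_mul, norm_e_ofReal, one_mul]
  set t : S × ℤ → ℂ := fun w => thetaTerm φ η τ z (r • u) (s • u) k P (ψ w + x₀) with ht
  have hts : Summable t := (Summable.of_norm (summable_thetaTerm φ η τ z (r • u) (s • u) hL x₀ k
    P)).comp_injective Ψ.injective
  have ht1 : ∀ w : S × ℤ, t w = e ((-(r * c w.1) : ℝ))
      * thetaTerm φ η τ z 0 0 k P ((w.1 : V) + s • u + (w.2 : ℝ) • u) := by
    intro w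
    have e1 : (ψ w : V) + x₀ = (w.1 : V) + (w.2 : ℝ) • u := by rw [hψ]; abel
    have e2 : B ((w.1 : V) + (w.2 : ℝ) • u) u = c w.1 := by
      rw [map_add, LinearMap.add_apply, map_smul, LinearMap.smul_apply, huu, smul_zero, add_zero,
        hc]
    rw [ht]
    change thetaTerm φ η τ z (r • u) (s • u) k P (ψ w + x₀) = _
    rw [e1, thetaTerm_smul_smul hB η τ z huu, e2]
    congr 2
    abel
  have hsum : ∑' w, t w = ∑' w, f w := by
    rw [hts.tsum_prod, hfs.tsum_prod]
    refine tsum_congr fun x => ?_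
    simp only [ht1]
    rw [tsum_mul_left, tsum_thetaTerm_line τ z hB hL huL hu huu hηu huu' hP, ← tsum_mul_left]
    refine tsum_congr fun d => ?_
    rw [dualTerm_add_smul τ z hB hu huu hηu hP, hf, ← mul_assoc, ← e_add]
    push_cast
    rfl
  have hθ : ∑' x : {x : V // InClass B L σ x}, thetaTerm φ η τ z (r • u) (s • u) k P x
      = ∑' w, f w := by
    rw [← hsum, ← (classEquiv h₀ hle).tsum_eq]
    exact (Ψ.tsum_eq fun l : L => thetaTerm φ η τ z (r • u) (s • u) k P (l + x₀)).symm
  let g : S × ℤ → (Fin 2 → ℤ) := fun w => ![c w.1, w.2]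
  have hfib := (hfs.hasSum.tsum_fiberwise g).mul_left
    ((τ.im ^ ((n : ℝ) / 2) * Real.exp (-2 * Real.pi * (∑ j, (φ η).2 j ^ 2) * (z.im ^ 2 / τ.im))
      : ℝ) : ℂ)
  rw [thetaVec, hθ]
  refine hfib.congr_fun fun m => ?_
  rw [Pi.smul_apply, smul_eq_mul, dualCoeff, mul_left_comm, ← tsum_mul_left (a := e _)]
  congr 1
  let Φ : {x : V // (InClass B L σ x ∧ B (x - repr B L σ) u' = 0) ∧ B x u = m 0} ≃ g ⁻¹' {m} :=
    { toFun := fun x => ⟨(⟨x, x.2.1⟩, m 1), by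
        have h1 : c ⟨x, x.2.1⟩ = m 0 := by
          exact_mod_cast (x.2.2.symm.trans (hc ⟨x, x.2.1⟩)).symm
        change ![c ⟨x, x.2.1⟩, m 1] = m
        rw [h1]
        funext i
        fin_cases i <;> rfl⟩
      invFun := fun w => ⟨w.1.1, w.1.1.2, by
        have h1 : ![c w.1.1, w.1.2] = m := w.2
        rw [hc]
        exact congrArg Int.cast (congrFun h1 0)⟩
      left_inv := fun x => rfl
      right_inv := fun w => by
        have h1 : ![c w.1.1, w.1.2] = m := w.2
        refine Subtype.ext (Prod.ext rfl ?_)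
        exact (congrFun h1 1).symm }
  rw [← Φ.tsum_eq]
  refine tsum_congr fun x => ?_
  have h1 : c ⟨x, x.2.1⟩ = m 0 := by
    exact_mod_cast (x.2.2.symm.trans (hc ⟨x, x.2.1⟩)).symm
  change _ = e ((-(r * c ⟨x, x.2.1⟩) + s * m 1 : ℝ)) * dualTerm B φ η τ z u k P x (m 1)
  rw [h1]

/-- For all r and s the transformation law equates two Fourier series, since the group acts linearly
on the parameters (ru, su). Uniqueness of coefficients turns the action on (r, s) into the dual
action on m. -/
theorem dualCoeff_smul (hB : IsIsometryToStd B φ) (hL : IsFullLattice L)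
    (hLe : IsEvenLattice B L) (huL : u ∈ L) (hu : u ≠ 0) (huu : B u u = 0) (hηu : B η u = 0)
    (hu'L : u' ∈ dualLattice B L) (huu' : B u u' = 1) (hP : P.IsHomogeneous k) (x : Mp2Z)
    (m : Fin 2 → ℤ) :
    dualCoeff B L φ η u u' k P (x.mat • τ) (z / autFactor x.mat τ) m
      = thetaFactor (2 * (k : ℤ) + p - n) (quad B η) x (τ, z, (0 : V), (0 : V)) •
        weilRep B L p n x (dualCoeff B L φ η u u' k P τ z
          ![x.mat 0 0 * m 0 - x.mat 1 0 * m 1, -(x.mat 0 1 * m 0) + x.mat 1 1 * m 1]) := by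
  have := finite_disc hB hL hLe
  have hdet : x.mat 0 0 * x.mat 1 1 - x.mat 0 1 * x.mat 1 0 = 1 := by
    have := x.mat.det_coe
    rwa [Matrix.det_fin_two] at this
  -- The transpose of the matrix with respect to the pairing -r m₀ + s m₁, hence the signs of the
  -- off-diagonal entries.
  let E : (Fin 2 → ℤ) ≃ (Fin 2 → ℤ) :=
    { toFun := fun m => ![x.mat 0 0 * m 0 - x.mat 1 0 * m 1, -(x.mat 0 1 * m 0) + x.mat 1 1 * m 1]
      invFun := fun m => ![x.mat 1 1 * m 0 + x.mat 1 0 * m 1, x.mat 0 1 * m 0 + x.mat 0 0 * m 1]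
      left_inv := fun m => by
        funext i
        fin_cases i
        · simp
          linear_combination m 0 * hdet
        · simp
          linear_combination m 1 * hdet
      right_inv := fun m => by
        funext i
        fin_cases i
        · simp
          linear_combination m 0 * hdet
        · simp
          linear_combination m 1 * hdet }
  set J := thetaFactor (2 * (k : ℤ) + p - n) (quad B η) x (τ, z, (0 : V), (0 : V)) with hJ
  set A : Module.End ℂ (Disc B L → ℂ) := J • weilRep B L p n x with hA
  have h1 := fun r s => hasSum_dualCoeff (x.mat • τ) (z / autFactor x.mat τ) hB hL hLe huL hu huu
    hηu hu'L huu' hP r s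
  have h2 : ∀ r s : ℝ, HasSum (fun m => e ((-(r * E m 0) + s * E m 1 : ℝ)) •
      A (dualCoeff B L φ η u u' k P τ z (E m)))
      (A (thetaVec B L φ η k P τ z (r • u) (s • u))) := by
    intro r s
    have e1 := (hasSum_dualCoeff τ z hB hL hLe huL hu huu hηu hu'L huu' hP r s).map A
      (LinearMap.continuous_of_finiteDimensional A)
    have e2 := (E.hasSum_iff).mpr e1
    refine e2.congr_fun fun m => ?_
    rw [Function.comp_apply, Function.comp_apply, map_smul]
  have h3 : ∀ r s : ℝ, thetaVec B L φ η k P (x.mat • τ) (z / autFactor x.mat τ)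
      ((x.mat 0 0 * r + x.mat 0 1 * s) • u) ((x.mat 1 0 * r + x.mat 1 1 * s) • u)
      = A (thetaVec B L φ η k P τ z (r • u) (s • u)) := by
    intro r s
    have := transforms_weilRep hB hL hLe η hP x (τ, z, r • u, s • u)
    rw [thetaFun, thetaFun, act] at this
    simp only [← Int.cast_smul_eq_zsmul ℝ, smul_smul, ← add_smul] at this
    exact this
  funext σ
  refine congrFun (fourier_series_unique (ι := Fin 2)
    (a := fun m => dualCoeff B L φ η u u' k P (x.mat • τ) (z / autFactor x.mat τ) m σ)
    (b := fun m => A (dualCoeff B L φ η u u' k P τ z (E m)) σ) ?_ ?_ ?_) m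
  · have := (Pi.hasSum.mp (h1 0 0) σ).summable.norm
    refine this.congr fun m => ?_
    rw [Pi.smul_apply, smul_eq_mul, norm_mul, norm_e_ofReal, one_mul]
  · have := (Pi.hasSum.mp (h2 0 0) σ).summable.norm
    refine this.congr fun m => ?_
    rw [Pi.smul_apply, smul_eq_mul, norm_mul, norm_e_ofReal, one_mul]
  · intro y
    have hdet' : (x.mat 0 0 : ℝ) * x.mat 1 1 - x.mat 0 1 * x.mat 1 0 = 1 := by exact_mod_cast hdet
    -- The vector (r, s) is the inverse matrix applied to (-y₀, y₁), so that the transformed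
    -- parameters are (-y₀, y₁) and the character is e(m₀y₀ + m₁y₁).
    set r : ℝ := -(x.mat 1 1 * y 0) - x.mat 0 1 * y 1 with hr
    set s : ℝ := x.mat 1 0 * y 0 + x.mat 0 0 * y 1 with hs
    have e1 : x.mat 0 0 * r + x.mat 0 1 * s = -y 0 := by
      rw [hr, hs]
      linear_combination -y 0 * hdet'
    have e2 : x.mat 1 0 * r + x.mat 1 1 * s = y 1 := by
      rw [hr, hs]
      linear_combination y 1 * hdet'
    have e3 := (Pi.hasSum.mp (h1 (-y 0) (y 1)) σ).tsum_eq
    have e4 := (Pi.hasSum.mp (h2 r s) σ).tsum_eq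
    rw [← h3, e1, e2, ← e3] at e4
    refine Eq.trans (tsum_congr fun m => ?_) (e4.symm.trans (tsum_congr fun m => ?_))
    · rw [Pi.smul_apply, smul_eq_mul, mul_comm, e, Fin.sum_univ_two]
      congr 2
      push_cast
      ring
    · rw [Pi.smul_apply, smul_eq_mul, mul_comm, e, Fin.sum_univ_two]
      have e5 : -(r * E m 0) + s * E m 1 = m 0 * y 0 + m 1 * y 1 := by
        change -(r * ((x.mat 0 0 * m 0 - x.mat 1 0 * m 1 : ℤ) : ℝ))
          + s * ((-(x.mat 0 1 * m 0) + x.mat 1 1 * m 1 : ℤ) : ℝ) = _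
        rw [hr, hs]
        push_cast
        linear_combination (m 0 * y 0 + m 1 * y 1) * hdet'
      rw [e5]
      push_cast
      rfl

end Fourier
end JacobiTheta
end

noncomputable section

namespace JacobiTheta

open UpperHalfPlane

/-! ### Theta functions in coordinates -/

section Projections

variable {V : Type*} [AddCommGroup V] [Module ℝ V] {p n : ℕ} {B : LinearMap.BilinForm ℝ V}
  {g₀ : V ≃ₗ[ℝ] (Fin p → ℝ) × (Fin n → ℝ)} {g : V ≃ₗ[ℝ] V}

theorem IsIsometryToStd.trans (hB : IsIsometryToStd B g₀) (hg : ∀ x y, B (g x) (g y) = B x y) :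
    IsIsometryToStd B (g.trans g₀) := fun x y => by
  rw [← hg, hB]
  rfl

theorem trans_posProj (x : V) : g.trans g₀ (posProj g₀ g x) = ((g.trans g₀ x).1, 0) := by
  simp [posProj]

theorem trans_negProj (x : V) : g.trans g₀ (negProj g₀ g x) = (0, (g.trans g₀ x).2) := by
  simp [negProj]

theorem posProj_add_negProj (x : V) : posProj g₀ g x + negProj g₀ g x = x := by
  apply (g.trans g₀).injective
  rw [map_add, trans_posProj, trans_negProj, Prod.mk_add_mk, add_zero, zero_add]

theorem bilin_posProj (hB : IsIsometryToStd B (g.trans g₀)) (x y : V) :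
    B x (posProj g₀ g y) = posForm (g.trans g₀) x y := by
  rw [hB, trans_posProj, posForm_apply]
  simp

theorem bilin_negProj (hB : IsIsometryToStd B (g.trans g₀)) (x y : V) :
    B x (negProj g₀ g y) = -negForm (g.trans g₀) x y := by
  rw [hB, trans_negProj, negForm_apply]
  simp

theorem bilin_posProj_posProj (hB : IsIsometryToStd B (g.trans g₀)) (x y : V) :
    B (posProj g₀ g x) (posProj g₀ g y) = posForm (g.trans g₀) x y := by
  rw [bilin_posProj hB, posForm_apply, trans_posProj, posForm_apply]

theorem bilin_negProj_negProj (hB : IsIsometryToStd B (g.trans g₀)) (x y : V) :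
    B (negProj g₀ g x) (negProj g₀ g y) = -negForm (g.trans g₀) x y := by
  rw [bilin_negProj hB, negForm_apply, trans_negProj, negForm_apply]

theorem quad_posProj (hB : IsIsometryToStd B (g.trans g₀)) (x : V) :
    quad B (posProj g₀ g x) = posForm (g.trans g₀) x x / 2 := by
  rw [quad, bilin_posProj_posProj hB]

theorem quad_negProj (hB : IsIsometryToStd B (g.trans g₀)) (x : V) :
    quad B (negProj g₀ g x) = -negForm (g.trans g₀) x x / 2 := by
  rw [quad, bilin_negProj_negProj hB]

/-- In the coordinates of g₀ ∘ g the subspaces z^⊥ and z are coordinate subspaces. This passes from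
the function of the theorem to the coordinate form used in the analytic part. -/
theorem thetaL_eq_thetaVec (hB : IsIsometryToStd B (g.trans g₀)) (L : Submodule ℤ V) {k : ℕ}
    {P : MvPolynomial (Fin p) ℂ} (hP : P.IsHomogeneous k) (η : V) (τ : ℍ) (z : ℂ) :
    thetaL B L g₀ g P η τ z 0 0 = thetaVec B L (g.trans g₀) η k P τ z 0 0 := by
  funext σ
  rw [thetaL, theta, thetaVec, quad_negProj hB]
  congr 1
  · rw [Complex.ofReal_mul]
    congr 3
    rw [negForm_apply]
    simp only [sq]
    ring
  · refine tsum_congr fun l => ?_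
    simp only [add_zero]
    rw [thetaTerm, heatPoly_eq_heatLin _ hP le_rfl, gaussTerm_zero, add_zero, quad_posProj hB,
      quad_negProj hB, bilin_posProj hB, bilin_negProj hB, map_zero, e]
    congr 2
    have h : ∀ a b c d : ℝ, (2 * Real.pi * Complex.I * ((a / 2 : ℝ) * τ
        + (-b / 2 : ℝ) * (starRingEnd ℂ) (τ : ℂ) + z * c + (starRingEnd ℂ) z * (-d : ℝ) - (0 : ℝ)) : ℂ)
        = Real.pi * Complex.I * (τ * a - (starRingEnd ℂ) (τ : ℂ) * b + 2 * z * c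
          - 2 * (starRingEnd ℂ) z * d) := fun a b c d => by
      push_cast
      ring
    exact h _ _ _ _

variable {u : V}

theorem wPosProj_apply (hB : IsIsometryToStd B (g.trans g₀)) (x : V) :
    wPosProj B g₀ g u x = posProj g₀ g
      (x - (posForm (g.trans g₀) u x / posForm (g.trans g₀) u u) • u) := by
  rw [wPosProj, projPerp, map_sub, map_smul, LinearMap.sub_apply, LinearMap.smulRight_apply,
    LinearMap.smul_apply, LinearMap.comp_apply, bilin_posProj_posProj hB, bilin_posProj_posProj hB,
    smul_eq_mul, inv_mul_eq_div]

theorem wNegProj_apply (hB : IsIsometryToStd B (g.trans g₀)) (x : V) :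
    wNegProj B g₀ g u x = negProj g₀ g
      (x - (negForm (g.trans g₀) u x / negForm (g.trans g₀) u u) • u) := by
  rw [wNegProj, projPerp, map_sub, map_smul, LinearMap.sub_apply, LinearMap.smulRight_apply,
    LinearMap.smul_apply, LinearMap.comp_apply, bilin_negProj_negProj hB, bilin_negProj_negProj hB,
    smul_eq_mul, inv_mul_eq_div, neg_div_neg_eq]

theorem negForm_eq_posForm_of_orthogonal (hB : IsIsometryToStd B (g.trans g₀)) {x : V}
    (hx : B x u = 0) : negForm (g.trans g₀) u x = posForm (g.trans g₀) u x := by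
  rw [bilin_eq_posForm_sub hB] at hx
  rw [negForm_comm, posForm_comm]
  linarith

theorem wNegProj_apply_of_orthogonal (hB : IsIsometryToStd B (g.trans g₀)) (huu : B u u = 0) {x : V}
    (hx : B x u = 0) : wNegProj B g₀ g u x = negProj g₀ g
      (x - (posForm (g.trans g₀) u x / posForm (g.trans g₀) u u) • u) := by
  rw [wNegProj_apply hB, negForm_eq_posForm_of_orthogonal hB hx, negForm_self_eq hB huu]

/-- For x orthogonal to u, the projections in z^⊥ and in z remove the same multiple of u, so
together they replace x by its translate along u. -/
theorem subIsometry_apply (hB : IsIsometryToStd B (g.trans g₀)) (huu : B u u = 0) {x : V}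
    (hx : B x u = 0) : subIsometry B g₀ g u x
      = g (x - (posForm (g.trans g₀) u x / posForm (g.trans g₀) u u) • u) := by
  rw [subIsometry, LinearMap.comp_apply, LinearMap.add_apply, wPosProj_apply hB,
    wNegProj_apply_of_orthogonal hB huu hx, posProj_add_negProj]
  rfl

/-- Since x is orthogonal to u and u', its positive and negative parts contribute one half each. The
value is the phase that appears when the square in the dual kernel is expanded. -/
theorem bilin_muVec (hB : IsIsometryToStd B (g.trans g₀)) (huu : B u u = 0) {u' x : V}
    (hx : B x u = 0) (hx' : B x u' = 0) :
    B x (muVec B g₀ g u u') = posForm (g.trans g₀) u x / posForm (g.trans g₀) u u := by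
  rw [muVec, map_add, map_add, map_neg, map_smul, map_smul, hx', bilin_posProj_posProj hB,
    bilin_negProj_negProj hB, bilin_posProj hB, bilin_negProj hB, negForm_self_eq hB huu,
    negForm_comm, negForm_eq_posForm_of_orthogonal hB hx, posForm_comm _ x u, smul_eq_mul,
    smul_eq_mul, mul_inv, mul_inv, inv_neg]
  ring

end Projections
end JacobiTheta
end

noncomputable section

namespace JacobiTheta

open UpperHalfPlane

/-! ### The sublattice orthogonal to an isotropic vector -/

section SubLattice

variable {V : Type*} [AddCommGroup V] [Module ℝ V] {p n : ℕ} {B : LinearMap.BilinForm ℝ V}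
  {φ : V ≃ₗ[ℝ] (Fin p → ℝ) × (Fin n → ℝ)} {L : Submodule ℤ V} {u u' : V}

theorem IsFullLattice.span_eq_top (hL : IsFullLattice L) :
    Submodule.span ℝ (L : Set V) = ⊤ := by
  obtain ⟨n, b, rfl⟩ := hL
  rw [eq_top_iff, ← b.span_eq]
  exact Submodule.span_mono Submodule.subset_span

theorem mem_subLattice {x : V} : x ∈ subLattice B L u u' ↔ x ∈ L ∧ B x u = 0 ∧ B x u' = 0 :=
  Iff.rfl

/-- The real span of M is the full orthogonal complement of u and u'; the dual lattice of M is
defined inside this span. -/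
theorem mem_span_subLattice (hB : IsIsometryToStd B φ) (hL : IsFullLattice L)
    (hLe : IsEvenLattice B L) (huL : u ∈ L) (huu : B u u = 0) (hu'L : u' ∈ dualLattice B L)
    (huu' : B u u' = 1) {x : V} :
    x ∈ Submodule.span ℝ (subLattice B L u u' : Set V) ↔ B x u = 0 ∧ B x u' = 0 := by
  constructor
  · intro hx
    induction hx using Submodule.span_induction with
    | mem x hx => exact hx.2
    | zero => simp
    | add x y _ _ hx hy => simp [hx.1, hx.2, hy.1, hy.2]
    | smul c x _ hx => simp [hx.1, hx.2]
  rintro ⟨hx, hx'⟩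
  obtain ⟨l₁, hl₁, hc⟩ : ∃ l ∈ L, B l u ≠ 0 := by
    by_contra! h
    have h1 : Submodule.span ℝ (L : Set V) ≤ LinearMap.ker (B.flip u) :=
      Submodule.span_le.mpr fun l hl => h l hl
    rw [hL.span_eq_top] at h1
    have h2 : B u' u = 0 := h1 (Submodule.mem_top (x := u'))
    rw [bilin_symm hB, huu'] at h2
    exact one_ne_zero h2
  -- The map has integral coefficients on L, sends L into M, and is multiplication by the nonzero
  -- number (l₁, u) on the complement of u and u'.
  let π : V →ₗ[ℝ] V := B l₁ u • LinearMap.id - (B.flip u).smulRight l₁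
    - (B l₁ u • B.flip u' - B l₁ u' • B.flip u).smulRight u
  have hπ : ∀ y, π y = B l₁ u • y - B y u • l₁ - (B l₁ u * B y u' - B l₁ u' * B y u) • u :=
    fun y => rfl
  have hint : ∀ l ∈ L, ∃ d : ℤ, B l u' = d := fun l hl => by
    obtain ⟨d, hd⟩ := hu'L.2 l hl
    exact ⟨d, by rw [bilin_symm hB, hd]⟩
  have hmem : ∀ l ∈ L, π l ∈ subLattice B L u u' := by
    intro l hl
    refine ⟨?_, ?_, ?_⟩
    · obtain ⟨a, ha⟩ := bilin_int_of_even hB hLe hl huL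
      obtain ⟨a₁, ha₁⟩ := bilin_int_of_even hB hLe hl₁ huL
      obtain ⟨d, hd⟩ := hint l hl
      obtain ⟨d₁, hd₁⟩ := hint l₁ hl₁
      rw [hπ, ha, ha₁, hd, hd₁]
      have : ((a₁ : ℝ) * d - d₁ * a) = ((a₁ * d - d₁ * a : ℤ) : ℝ) := by push_cast; ring
      rw [this, Int.cast_smul_eq_zsmul, Int.cast_smul_eq_zsmul, Int.cast_smul_eq_zsmul]
      exact L.sub_mem (L.sub_mem (L.smul_mem _ hl) (L.smul_mem _ hl₁)) (L.smul_mem _ huL)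
    · rw [hπ]
      simp only [map_sub, map_smul, LinearMap.sub_apply, LinearMap.smul_apply, smul_eq_mul, huu]
      ring
    · rw [hπ]
      simp only [map_sub, map_smul, LinearMap.sub_apply, LinearMap.smul_apply, smul_eq_mul, huu']
      ring
  have h1 : π x ∈ Submodule.span ℝ (subLattice B L u u' : Set V) := by
    have h2 : π x ∈ (Submodule.span ℝ (L : Set V)).map π :=
      Submodule.mem_map_of_mem (hL.span_eq_top ▸ Submodule.mem_top)
    rw [Submodule.map_span] at h2
    refine Submodule.span_mono ?_ h2
    rintro _ ⟨l, hl, rfl⟩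
    exact hmem l hl
  rw [hπ, hx, hx', mul_zero, mul_zero, sub_zero, zero_smul, zero_smul, sub_zero, sub_zero] at h1
  have h2 := Submodule.smul_mem _ (B l₁ u)⁻¹ h1
  rwa [inv_smul_smul₀ hc] at h2

open Classical in
-- At most one pair (σ, t) contributes to the component at δ. Pairing with u' forces t to be
-- congruent modulo 1 to s = (δ, u'), and then the class of x in D_M is determined by δ. Since k is
-- integral, e(-kt) = e(-ks).
theorem inflate_tsum (hB : IsIsometryToStd B φ) (hL : IsFullLattice L)
    (hLe : IsEvenLattice B L) (huL : u ∈ L) (huu : B u u = 0) (hu'L : u' ∈ dualLattice B L)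
    (huu' : B u u' = 1) (F : V → ℂ) (k : ℤ) (δ : Disc B L) :
    inflate B L (subLattice B L u u') u k
        (fun σ => ∑' x : {x : V // InClass B (subLattice B L u u') σ x}, F x) δ
      = e (-(k * (B (repr B L δ) u' : ℝ)))
        * ∑' x : {x : V // InClass B L δ (x + B (repr B L δ) u' • u) ∧ B x u = 0 ∧ B x u' = 0},
            F x := by
  set M := subLattice B L u u' with hM
  set s := B (repr B L δ) u' with hs
  have hle : L ≤ dualLattice B L := fun x hx => mem_dualLattice_of_mem hB hLe hx
  have hspan : ∀ {x : V}, x ∈ Submodule.span ℝ (M : Set V) ↔ B x u = 0 ∧ B x u' = 0 :=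
    mem_span_subLattice hB hL hLe huL huu hu'L huu'
  have hMle : M ≤ dualLattice B M := fun x hx =>
    ⟨Submodule.subset_span hx, fun y hy => bilin_int_of_even hB hLe hx.1 hy.1⟩
  have h₀ : InClass B L δ (repr B L δ) := inClass_repr δ
  have key : ∀ y t, B y u' = 0 → (InClass B L δ (y + t • u) ↔
      InClass B L δ (y + s • u) ∧ ∃ j : ℤ, t = s + j) := by
    intro y t hy
    have hj : ∀ j : ℤ, InClass B L δ (y + (s + j) • u) ↔ InClass B L δ (y + s • u) := by
      intro j
      rw [inClass_iff_sub_mem h₀ hle, inClass_iff_sub_mem h₀ hle, add_smul,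
        Int.cast_smul_eq_zsmul]
      have : y + (s • u + j • u) - repr B L δ = y + s • u - repr B L δ + j • u := by abel
      rw [this]
      exact L.add_mem_iff_left (L.smul_mem _ huL)
    constructor
    · intro h
      obtain ⟨j, hjt⟩ : ∃ j : ℤ, t = s + j := by
        obtain ⟨j, hj⟩ := hu'L.2 _ ((inClass_iff_sub_mem h₀ hle).mp h)
        rw [bilin_symm hB, map_sub, map_add, map_smul, LinearMap.sub_apply, LinearMap.add_apply,
          LinearMap.smul_apply, huu', hy, ← hs, smul_eq_mul] at hj
        exact ⟨j, by linarith⟩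
      refine ⟨?_, j, hjt⟩
      rwa [hjt, hj] at h
    · rintro ⟨h, j, rfl⟩
      rwa [hj]
  have hrepr : ∀ σ : Disc B M, B (repr B M σ) u' = 0 := fun σ =>
    (hspan.mp (Quotient.out σ).2.1).2
  have hrepr' : ∀ σ : Disc B M, B (repr B M σ) u = 0 := fun σ =>
    (hspan.mp (Quotient.out σ).2.1).1
  -- If no translate x + su with x orthogonal to u and u' lies in the class δ, both sides are zero.
  by_cases h : ∃ x, InClass B L δ (x + s • u) ∧ B x u = 0 ∧ B x u' = 0
  · obtain ⟨x, hx, hxu, hxu'⟩ := h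
    have hxM : x ∈ dualLattice B M := by
      refine ⟨hspan.mpr ⟨hxu, hxu'⟩, fun y hy => ?_⟩
      obtain ⟨a, ha⟩ := hx.1.2 y hy.1
      refine ⟨a, ?_⟩
      rw [← ha, map_add, map_smul, LinearMap.add_apply, LinearMap.smul_apply, bilin_symm hB u,
        hy.2.1, smul_zero, add_zero]
    set σ : Disc B M := Submodule.Quotient.mk ⟨x, hxM⟩ with hσ
    have hxσ : InClass B M σ x := ⟨hxM, rfl⟩
    have hiff : ∀ y, InClass B M σ y ↔ InClass B L δ (y + s • u) ∧ B y u = 0 ∧ B y u' = 0 := by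
      intro y
      rw [inClass_iff_sub_mem hxσ hMle, inClass_iff_sub_mem hx hle, hM, mem_subLattice,
        add_sub_add_right_eq_sub, map_sub, LinearMap.sub_apply, LinearMap.sub_apply, hxu, hxu',
        sub_zero, sub_zero]
    have hcond : ∀ (σ' : Disc B M) (t : ℝ),
        (t ∈ Set.Ico (0 : ℝ) 1 ∧ InClass B L δ (repr B M σ' + t • u)) ↔
          σ' = σ ∧ t = Int.fract s := by
      intro σ' t
      rw [key _ _ (hrepr σ')]
      have h1 : InClass B L δ (repr B M σ' + s • u) ↔ σ' = σ := by
        have h2 := hiff (repr B M σ')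
        simp only [hrepr, hrepr', and_true] at h2
        rw [← h2]
        constructor
        · rintro ⟨_, h3⟩
          obtain ⟨_, h4⟩ := inClass_repr (B := B) σ'
          exact h4.symm.trans h3
        · rintro rfl
          exact inClass_repr _
      rw [h1]
      constructor
      · rintro ⟨ht, h3, j, hj⟩
        refine ⟨h3, ?_⟩
        rw [Int.fract_eq_iff.mpr ⟨ht.1, ht.2, -j, ?_⟩]
        rw [hj]
        push_cast
        ring
      · rintro ⟨h3, rfl⟩
        refine ⟨⟨Int.fract_nonneg s, Int.fract_lt_one s⟩, h3, -⌊s⌋, ?_⟩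
        rw [Int.fract]
        push_cast
        ring
    rw [inflate]
    simp only [hcond]
    rw [finsum_eq_single _ σ fun σ' hσ' => by simp [hσ'], finsum_eq_single _ (Int.fract s)
      fun t ht => by simp [ht]]
    rw [finsum_eq_if, if_pos ⟨rfl, rfl⟩, mul_comm]
    congr 1
    · rw [Int.fract]
      have : (-((k : ℂ) * ((s - ⌊s⌋ : ℝ) : ℂ))) = -((k : ℂ) * (s : ℂ)) + ((k * ⌊s⌋ : ℤ) : ℂ) := by
        push_cast
        ring
      rw [this, e_add, e_int, mul_one]
    · exact (Equiv.subtypeEquivRight hiff).tsum_eq fun y => F y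
  · have hcond : ∀ (σ' : Disc B M) (t : ℝ),
        ¬(t ∈ Set.Ico (0 : ℝ) 1 ∧ InClass B L δ (repr B M σ' + t • u)) := fun σ' t ht =>
      h ⟨repr B M σ', ((key _ _ (hrepr σ')).mp ht.2).1, hrepr' σ', hrepr σ'⟩
    rw [inflate]
    simp only [hcond]
    have : IsEmpty {x : V // InClass B L δ (x + s • u) ∧ B x u = 0 ∧ B x u' = 0} :=
      ⟨fun x => h ⟨x, x.2⟩⟩
    rw [tsum_empty, mul_zero]
    simp

end SubLattice
end JacobiTheta
end

noncomputable section

namespace JacobiTheta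

open UpperHalfPlane

/-! ### Fourier coefficients in terms of the theta function of the sublattice -/

section Identification

variable {V : Type*} [AddCommGroup V] [Module ℝ V] {p n : ℕ}

/-- The comparison of exponents for (x, u) = 0, with J = 1/Im τ, K the inverse of the squared length
of the positive part of u, and a, b the pairings of that part with x and η. Expanding the square
yields the projections to w and w^⊥, the phase of μ and the factor in k² + 4ik Im(z) b. -/
theorem subPoly_exponent_identity {I T T' Z Z' y J y₂ K π pxx nxx pxe nxe nee a b k : ℂ}
    (hI : I * I = -1) (hT : T' = T - 2 * I * y) (hZ : Z' = Z - 2 * I * y₂) (hy : y * J = 1) :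
    -2 * π * nee * (y₂ ^ 2 * J) + π * I * (T * pxx - T' * nxx + 2 * Z * pxe - 2 * Z' * nxe)
        + -π * (J * K / 2) * (-k + I * (I * 0 * T' - 2 * y * (a + y₂ * J * b))) ^ 2
      = 2 * π * I * ((k ^ 2 + 4 * I * k * y₂ * b) * (I * J * K / 4))
        + (4 * π * (-(nee - b ^ 2 * K) / 2) * y₂ ^ 2 * J
        + 2 * π * I * ((pxx - a ^ 2 * K) / 2 * T + -(nxx - a ^ 2 * K) / 2 * T'
          + Z * (pxe - a * b * K) + Z' * -(nxe - a * b * K) - k * (a * K))) := by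
  subst hT hZ
  grind

/-- One factor √y of y^(n/2) cancels against Poisson summation along u. This accounts for the drop
from n to n - 1 and for the constant 1/√(2Q); n ≠ 0 is needed for the truncated subtraction. -/
theorem rpow_half_div_sqrt {y Q : ℝ} (hy : 0 < y) (hQ : 0 < Q) (hn : n ≠ 0) :
    ((y ^ ((n : ℝ) / 2) : ℝ) : ℂ) * (1 / ((2 * y * Q : ℝ) : ℂ) ^ (1 / 2 : ℂ))
      = ((1 / Real.sqrt (2 * Q) : ℝ) : ℂ) * ((y ^ (((n - 1 : ℕ) : ℝ) / 2) : ℝ) : ℂ) := by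
  have hA : 0 ≤ 2 * y * Q := by positivity
  have h1 : ((2 * y * Q : ℝ) : ℂ) ^ (1 / 2 : ℂ) = ((Real.sqrt y * Real.sqrt (2 * Q) : ℝ) : ℂ) := by
    rw [← Real.sqrt_mul hy.le, show y * (2 * Q) = 2 * y * Q by ring, Real.sqrt_eq_rpow,
      Complex.ofReal_cpow hA]
    norm_num
  have h2 : y ^ ((n : ℝ) / 2) = y ^ (((n - 1 : ℕ) : ℝ) / 2) * Real.sqrt y := by
    rw [Real.sqrt_eq_rpow, ← Real.rpow_add hy, Nat.cast_pred (Nat.pos_of_ne_zero hn)]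
    congr 1
    ring
  rw [h1, ← Complex.ofReal_one, ← Complex.ofReal_div, ← Complex.ofReal_mul, ← Complex.ofReal_mul,
    h2]
  congr 1
  have := (Real.sqrt_pos.mpr hy).ne'
  field_simp

variable (B : LinearMap.BilinForm ℝ V) (g₀ : V ≃ₗ[ℝ] (Fin p → ℝ) × (Fin n → ℝ)) (g : V ≃ₗ[ℝ] V)
  (u : V)

/-- The terms of the theta function of the sublattice. -/
def subTerm (P : MvPolynomial (Fin p) ℂ) (η : V) (τ : ℍ) (z : ℂ) (α x : V) : ℂ :=
  ((τ.im ^ (((n - 1 : ℕ) : ℝ) / 2) : ℝ) : ℂ)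
    * Real.exp (4 * Real.pi * quad B (wNegProj B g₀ g u η) * z.im ^ 2 / τ.im)
    * (evalReal (heatPoly τ.im P) (g₀ (subIsometry B g₀ g u (x + (z.im / τ.im) • η + 0))).1
      * e ((quad B (wPosProj B g₀ g u (x + 0)) : ℂ) * τ
        + (quad B (wNegProj B g₀ g u (x + 0)) : ℂ) * (starRingEnd ℂ) (τ : ℂ)
        + z * (B (x + 0) (wPosProj B g₀ g u η) : ℂ)
        + (starRingEnd ℂ) z * (B (x + 0) (wNegProj B g₀ g u η) : ℂ)
        - (B (x + (1 / 2 : ℝ) • 0) α : ℂ)))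

theorem thetaM_eq_tsum (L : Submodule ℤ V) (u' : V) (P : MvPolynomial (Fin p) ℂ) (η : V) (τ : ℍ)
    (z : ℂ) (α : V) : thetaM B L g₀ g u u' P η τ z α 0
      = fun σ => ∑' x : {x : V // InClass B (subLattice B L u u') σ x},
          subTerm B g₀ g u P η τ z α x := by
  funext σ
  exact tsum_mul_left.symm

variable {B g₀ g u}

/-- For x orthogonal to u and u', the term after Poisson summation with dual variable -k is, for
each h, a term of the theta function of M with α = kμ, times the exponential factor of the Poincaré
series. -/
theorem subTerm_eq (hB : IsIsometryToStd B (g.trans g₀)) (hu : u ≠ 0) (huu : B u u = 0) {η : V}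
    (hηu : B η u = 0) {deg : ℕ} {P : MvPolynomial (Fin p) ℂ} (hP : P.IsHomogeneous deg) (h : ℕ)
    (τ : ℍ) (z : ℂ) (k : ℕ) {u' x : V} (hx : B x u = 0) (hx' : B x u' = 0) :
    ((τ.im ^ ((n : ℝ) / 2) * Real.exp (-2 * Real.pi * (∑ j, (g.trans g₀ η).2 j ^ 2)
        * (z.im ^ 2 / τ.im)) : ℝ) : ℂ)
      * (1 / ((2 * τ.im * posForm (g.trans g₀) u u : ℝ) : ℂ) ^ (1 / 2 : ℂ)
        * dualKernel (g.trans g₀) η τ z u x (-k)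
        * evalReal (heatLin deg τ.im (subPolyLin (g.trans g₀ u).1 h P))
          (g.trans g₀ (x + (z.im / τ.im) • η)).1)
      = ((1 / Real.sqrt (2 * posForm (g.trans g₀) u u) : ℝ) : ℂ)
        * (e (-(((k : ℂ) ^ 2 + 4 * Complex.I * k * (z.im : ℂ) * (posForm (g.trans g₀) u η : ℂ))
            / (4 * Complex.I * (τ.im : ℂ) * (posForm (g.trans g₀) u u : ℂ))))
          * subTerm B g₀ g u (subIsometryPoly g₀ g u P h) η τ z ((k : ℝ) • muVec B g₀ g u u') x) := by
  set φ := g.trans g₀ with hφ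
  have hQ := posForm_pos hB hu huu
  -- An isotropic vector u ≠ 0 has a nonzero negative part.
  have hn : n ≠ 0 := by
    rintro rfl
    rw [← negForm_self_eq hB huu, negForm_apply, Finset.univ_eq_empty, Finset.sum_empty] at hQ
    exact hQ.false
  have hpoly : evalReal (heatPoly τ.im (subIsometryPoly g₀ g u P h))
      (g₀ (subIsometry B g₀ g u (x + (z.im / τ.im) • η + 0))).1
      = evalReal (heatLin deg τ.im (subPolyLin (φ u).1 h P)) (φ (x + (z.im / τ.im) • η)).1 := by
    have hξ : B (x + (z.im / τ.im) • η) u = 0 := by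
      rw [map_add, map_smul, LinearMap.add_apply, LinearMap.smul_apply, hx, hηu, smul_zero,
        add_zero]
    have hs : subIsometryPoly g₀ g u P h = subPoly P (φ u).1 h := by
      have h1 := congrArg Prod.fst (trans_posProj (g₀ := g₀) (g := g) u)
      change (g₀ (g (posProj g₀ g u))).1 = (φ u).1 at h1
      rw [subIsometryPoly, h1]
    rw [hs, heatPoly_eq_heatLin _ (subPoly_isHomogeneous hP _ h) (Nat.sub_le deg h), add_zero,
      subIsometry_apply hB huu hξ]
    refine Eq.trans ?_ (evalReal_subPoly_sub_smul hP le_rfl τ.im (v := (φ u).1) hQ.ne' h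
      (φ (x + (z.im / τ.im) • η)).1
      (posForm φ u (x + (z.im / τ.im) • η) / posForm φ u u))
    congr 1
    rw [← Prod.smul_fst, ← map_smul, ← Prod.fst_sub, ← map_sub]
    rfl
  rw [subTerm, hpoly, dualKernel, gaussTerm_zero]
  generalize evalReal (heatLin deg τ.im (subPolyLin (φ u).1 h P))
    (φ (x + (z.im / τ.im) • η)).1 = E
  have hc := rpow_half_div_sqrt (n := n) τ.im_pos hQ hn
  have hexp : ((Real.exp (-2 * Real.pi * (∑ j, (φ η).2 j ^ 2) * (z.im ^ 2 / τ.im)) : ℝ) : ℂ)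
      * (Complex.exp (Real.pi * Complex.I * (τ * posForm φ x x
        - (starRingEnd ℂ) (τ : ℂ) * negForm φ x x
        + 2 * z * posForm φ x η - 2 * (starRingEnd ℂ) z * negForm φ x η))
      * Complex.exp (-Real.pi / (2 * τ.im * posForm φ u u : ℝ)
        * ((-k : ℝ) + Complex.I * lineCoeff φ η τ z u x) ^ 2))
      = e (-(((k : ℂ) ^ 2 + 4 * Complex.I * k * (z.im : ℂ) * (posForm φ u η : ℂ))
            / (4 * Complex.I * (τ.im : ℂ) * (posForm φ u u : ℂ))))
        * (Real.exp (4 * Real.pi * quad B (wNegProj B g₀ g u η) * z.im ^ 2 / τ.im)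
        * e ((quad B (wPosProj B g₀ g u (x + 0)) : ℂ) * τ
        + (quad B (wNegProj B g₀ g u (x + 0)) : ℂ) * (starRingEnd ℂ) (τ : ℂ)
        + z * (B (x + 0) (wPosProj B g₀ g u η) : ℂ)
        + (starRingEnd ℂ) z * (B (x + 0) (wNegProj B g₀ g u η) : ℂ)
        - (B (x + (1 / 2 : ℝ) • 0) ((k : ℝ) • muVec B g₀ g u u') : ℂ))) := by
    have hxη : B η u = 0 := hηu
    have hnx : negForm φ u x = posForm φ u x := negForm_eq_posForm_of_orthogonal hB hx
    have hnη : negForm φ u η = posForm φ u η := negForm_eq_posForm_of_orthogonal hB hηu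
    have hnee : ∑ j, (φ η).2 j ^ 2 = negForm φ η η := by
      rw [negForm_apply]
      simp only [sq]
    have hsubp : ∀ v w : V, posForm φ (v - (posForm φ u v / posForm φ u u) • u)
        (w - (posForm φ u w / posForm φ u u) • u)
        = posForm φ v w - posForm φ u v * posForm φ u w / posForm φ u u := by
      intro v w
      simp only [map_sub, map_smul, LinearMap.sub_apply, LinearMap.smul_apply, smul_eq_mul]
      rw [posForm_comm φ v u]
      field_simp
      ring
    have hsubn : ∀ v w : V, negForm φ u v = posForm φ u v → negForm φ u w = posForm φ u w →
        negForm φ (v - (posForm φ u v / posForm φ u u) • u)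
        (w - (posForm φ u w / posForm φ u u) • u)
        = negForm φ v w - posForm φ u v * posForm φ u w / posForm φ u u := by
      intro v w hv hw
      simp only [map_sub, map_smul, LinearMap.sub_apply, LinearMap.smul_apply, smul_eq_mul]
      rw [negForm_comm φ v u, hv, hw, negForm_self_eq hB huu]
      field_simp
      ring
    have h1 : quad B (wNegProj B g₀ g u η)
        = -(negForm φ η η - posForm φ u η ^ 2 / posForm φ u u) / 2 := by
      rw [wNegProj_apply_of_orthogonal hB huu hηu, quad_negProj hB, hsubn _ _ hnη hnη, sq]
    have h2 : quad B (wNegProj B g₀ g u x)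
        = -(negForm φ x x - posForm φ u x ^ 2 / posForm φ u u) / 2 := by
      rw [wNegProj_apply_of_orthogonal hB huu hx, quad_negProj hB, hsubn _ _ hnx hnx, sq]
    have h3 : quad B (wPosProj B g₀ g u x)
        = (posForm φ x x - posForm φ u x ^ 2 / posForm φ u u) / 2 := by
      rw [wPosProj_apply hB, quad_posProj hB, hsubp, sq]
    have h4 : B x (wPosProj B g₀ g u η)
        = posForm φ x η - posForm φ u x * posForm φ u η / posForm φ u u := by
      rw [wPosProj_apply hB, bilin_posProj hB, map_sub, map_smul, smul_eq_mul, posForm_comm φ x u]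
      ring
    have h5 : B x (wNegProj B g₀ g u η)
        = -(negForm φ x η - posForm φ u x * posForm φ u η / posForm φ u u) := by
      rw [wNegProj_apply_of_orthogonal hB huu hηu, bilin_negProj hB, map_sub, map_smul, smul_eq_mul,
        negForm_comm φ x u, hnx]
      ring
    have h6 : B x ((k : ℝ) • muVec B g₀ g u u') = k * (posForm φ u x / posForm φ u u) := by
      rw [map_smul, bilin_muVec hB huu hx hx', smul_eq_mul]
    rw [smul_zero, add_zero, h1, h2, h3, h4, h5, h6, hnee, lineCoeff, hnx, sub_self, map_add,
      map_smul, smul_eq_mul, e, e, Complex.ofReal_exp, Complex.ofReal_exp, ← Complex.exp_add,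
      ← Complex.exp_add, ← Complex.exp_add, ← Complex.exp_add]
    congr 1
    have hy0 : (τ.im : ℂ) ≠ 0 := by exact_mod_cast τ.im_ne_zero
    have hQ0 : (posForm φ u u : ℂ) ≠ 0 := by exact_mod_cast hQ.ne'
    have key := subPoly_exponent_identity (pxx := posForm φ x x) (nxx := negForm φ x x)
      (pxe := posForm φ x η) (nxe := negForm φ x η) (nee := negForm φ η η) (a := posForm φ u x)
      (b := posForm φ u η) (k := k) (π := Real.pi) (T := τ) (Z := z)
      Complex.I_mul_I (conj_eq (τ : ℂ)) (conj_eq z) (J := (τ.im : ℂ)⁻¹)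
      (K := (posForm φ u u : ℂ)⁻¹) (mul_inv_cancel₀ hy0)
    have hden : -(((k : ℂ) ^ 2 + 4 * Complex.I * k * (z.im : ℂ) * (posForm φ u η : ℂ))
            / (4 * Complex.I * (τ.im : ℂ) * (posForm φ u u : ℂ)))
        = ((k : ℂ) ^ 2 + 4 * Complex.I * k * (z.im : ℂ) * (posForm φ u η : ℂ))
          * (Complex.I * (τ.im : ℂ)⁻¹ * (posForm φ u u : ℂ)⁻¹ / 4) := by
      rw [div_eq_mul_inv, mul_inv, mul_inv, mul_inv, Complex.inv_I]
      ring
    rw [hden]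
    refine Eq.trans ?_ (key.trans ?_)
    · push_cast
      rw [UpperHalfPlane.coe_im]
      ring
    · push_cast
      ring
  rw [Complex.ofReal_mul]
  have hmul := congrArg₂ (fun a b => a * b * E) hc hexp
  linear_combination hmul

end Identification
end JacobiTheta
end

noncomputable section

namespace JacobiTheta

open UpperHalfPlane

/-! ### The coefficients with index (0, -k) as inflated theta functions of M. -/

section FourierIdentification

variable {V : Type*} [AddCommGroup V] [Module ℝ V] {p n : ℕ} {B : LinearMap.BilinForm ℝ V}

/-- Summability for each h separately allows the finite sum over h to be exchanged with the sum over
vectors. -/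
theorem summable_dualKernel_subPoly {φ : V ≃ₗ[ℝ] (Fin p → ℝ) × (Fin n → ℝ)}
    (hB : IsIsometryToStd B φ) {L : Submodule ℤ V} (hL : IsFullLattice L)
    (hLe : IsEvenLattice B L) {u u' η : V} (huL : u ∈ L) (hu : u ≠ 0) (huu : B u u = 0)
    (hηu : B η u = 0) (huu' : B u u' = 1) {k : ℕ} {P : MvPolynomial (Fin p) ℂ}
    (hP : P.IsHomogeneous k) (τ : ℍ) (z : ℂ) (h : ℕ) (δ : Disc B L) (m : ℤ) :
    Summable fun x : {x : V // InClass B L δ (x + B (repr B L δ) u' • u) ∧ B x u = 0 ∧ B x u' = 0} =>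
      dualKernel φ η τ z u x m * evalReal (heatLin k τ.im (subPolyLin (φ u).1 h P))
        (φ (x + (z.im / τ.im) • η)).1 := by
  set s := B (repr B L δ) u' with hs
  have hle : L ≤ dualLattice B L := fun x hx => mem_dualLattice_of_mem hB hLe hx
  have h₀ : InClass B L δ (repr B L δ) := inClass_repr δ
  obtain ⟨C, K, -, -, hle'⟩ := exists_norm_evalReal_subPoly_le hB hu huu hP τ.im h
  set x₀ := repr B L δ - s • u with hx₀
  have hsum := summable_dualKernel_mul τ z hB hL hu huu hηu huu' x₀ (C := C) (K := K)
    (f := fun x _ => evalReal (heatLin k τ.im (subPolyLin (φ u).1 h P))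
      (φ (x + (z.im / τ.im) • η)).1) fun x d => hle' _ d
  let ι : {x : V // InClass B L δ (x + s • u) ∧ B x u = 0 ∧ B x u' = 0} → L := fun x =>
    ⟨x + s • u - repr B L δ + m • u,
      L.add_mem ((inClass_iff_sub_mem h₀ hle).mp x.2.1) (L.smul_mem _ huL)⟩
  have hι : ∀ x, ((ι x : L) : V) = x + s • u - repr B L δ + (m : ℝ) • u := fun x => by
    rw [Int.cast_smul_eq_zsmul]
  have hιu' : ∀ x, B (ι x) u' = m := by
    intro x
    rw [hι]
    simp only [map_add, map_sub, map_smul, LinearMap.add_apply, LinearMap.sub_apply,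
      LinearMap.smul_apply, huu', x.2.2.2, ← hs, smul_eq_mul]
    ring
  have hinj : Function.Injective ι := by
    intro x y hxy
    have h1 := hι x
    rw [hxy, hι] at h1
    exact Subtype.ext (by simpa using h1.symm)
  refine Summable.of_norm ((hsum.comp_injective hinj).congr fun x => ?_)
  have h1 : x₀ + ((ι x : V) - (m : ℝ) • u) = x := by
    rw [hι, hx₀]
    abel
  rw [Function.comp_apply, hιu', h1, norm_mul]

variable {g₀ : V ≃ₗ[ℝ] (Fin p → ℝ) × (Fin n → ℝ)} {g : V ≃ₗ[ℝ] V} {u : V}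

/-- Index (0, -k) restricts the sum to vectors orthogonal to u. Translation by su makes them
orthogonal to u' as well, and the phase e(-ks) that this costs is the one in `inflate_tsum`; the
terms then agree by `subTerm_eq`. -/
theorem dualCoeff_eq_inflate (hB : IsIsometryToStd B (g.trans g₀)) {L : Submodule ℤ V}
    (hL : IsFullLattice L) (hLe : IsEvenLattice B L) {u' η : V} (huL : u ∈ L) (hu : u ≠ 0)
    (huu : B u u = 0) (hηu : B η u = 0) (hu'L : u' ∈ dualLattice B L) (huu' : B u u' = 1)
    {deg : ℕ} {P : MvPolynomial (Fin p) ℂ} (hP : P.IsHomogeneous deg) (τ : ℍ) (z : ℂ) (k : ℕ) :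
    dualCoeff B L (g.trans g₀) η u u' deg P τ z ![0, -(k : ℤ)]
      = ((1 / Real.sqrt (2 * B (posProj g₀ g u) (posProj g₀ g u)) : ℝ) : ℂ)
        • ∑ h ∈ Finset.range (deg + 1), ((k : ℂ) ^ h / (-2 * Complex.I * (τ.im : ℂ)) ^ h
          * e (-(((k : ℂ) ^ 2 + 4 * Complex.I * k * (z.im : ℂ) * (B η (posProj g₀ g u) : ℂ))
            / (4 * Complex.I * (τ.im : ℂ) * (B (posProj g₀ g u) (posProj g₀ g u) : ℂ)))))
          • inflate B L (subLattice B L u u') u k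
            (thetaM B L g₀ g u u' (subIsometryPoly g₀ g u P h) η τ z
              ((k : ℝ) • muVec B g₀ g u u') 0) := by
  funext δ
  rw [bilin_posProj_posProj hB, bilin_posProj hB, posForm_comm _ η u]
  set φ := g.trans g₀ with hφ
  set s := B (repr B L δ) u' with hs
  set c₀ : ℂ := ((1 / Real.sqrt (2 * posForm φ u u) : ℝ) : ℂ) with hc₀
  set E : ℂ := e (-(((k : ℂ) ^ 2 + 4 * Complex.I * k * (z.im : ℂ) * (posForm φ u η : ℂ))
    / (4 * Complex.I * (τ.im : ℂ) * (posForm φ u u : ℂ)))) with hE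
  let X := {x : V // InClass B L δ (x + s • u) ∧ B x u = 0 ∧ B x u' = 0}
  -- The translation by su, with s = (δ, u'), matches vectors orthogonal to u and u' with the points
  -- selected on the lines.
  let Ψ : X ≃ {x : V // (InClass B L δ x ∧ B (x - repr B L δ) u' = 0)
      ∧ B x u = ((![0, -(k : ℤ)] : Fin 2 → ℤ) 0 : ℤ)} :=
    { toFun := fun x => ⟨x + s • u, ⟨x.2.1, by
        rw [map_sub, map_add, map_smul, LinearMap.sub_apply, LinearMap.add_apply,
          LinearMap.smul_apply, huu', x.2.2.2, ← hs]
        simp⟩, by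
        rw [map_add, map_smul, LinearMap.add_apply, LinearMap.smul_apply, huu, x.2.2.1]
        simp⟩
      invFun := fun x => ⟨x - s • u, by rw [sub_add_cancel]; exact x.2.1.1, by
        rw [map_sub, map_smul, LinearMap.sub_apply, LinearMap.smul_apply, huu, x.2.2]
        simp, by
        have := x.2.1.2
        rw [map_sub, LinearMap.sub_apply, ← hs] at this
        rw [map_sub, map_smul, LinearMap.sub_apply, LinearMap.smul_apply, huu', smul_eq_mul,
          mul_one, this]⟩
      left_inv := fun x => by simp
      right_inv := fun x => Subtype.ext (sub_add_cancel _ _) }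
  set pref : ℂ := ((τ.im ^ ((n : ℝ) / 2) * Real.exp (-2 * Real.pi * (∑ j, (φ η).2 j ^ 2)
        * (z.im ^ 2 / τ.im)) : ℝ) : ℂ) with hpref
  set A : ℂ := 1 / ((2 * τ.im * posForm φ u u : ℝ) : ℂ) ^ (1 / 2 : ℂ) with hA
  set f : ℕ → X → ℂ := fun h x => dualKernel φ η τ z u x (-k)
    * evalReal (heatLin deg τ.im (subPolyLin (φ u).1 h P)) (φ (x + (z.im / τ.im) • η)).1 with hf
  have hfs : ∀ h, Summable (f h) := fun h => by
    have := summable_dualKernel_subPoly hB hL hLe huL hu huu hηu huu' hP τ z h δ (-k)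
    simpa only [Int.cast_neg, Int.cast_natCast] using this
  have hterm : ∀ h (x : X), pref * (A * f h x) = c₀ * (E * subTerm B g₀ g u
      (subIsometryPoly g₀ g u P h) η τ z ((k : ℝ) • muVec B g₀ g u u') x) := by
    intro h x
    rw [← subTerm_eq hB hu huu hηu hP h τ z k x.2.2.1 x.2.2.2, hf, mul_assoc A]
  have hL1 : ∀ x : X, dualTerm B φ η τ z u deg P (Ψ x) ((![0, -(k : ℤ)] : Fin 2 → ℤ) 1 : ℤ)
      = e (-((k : ℂ) * s)) * (A * ∑ h ∈ Finset.range (deg + 1),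
        ((k : ℂ) ^ h / (-2 * Complex.I * (τ.im : ℂ)) ^ h) * f h x) := by
    intro x
    have h1 : (((![0, -(k : ℤ)] : Fin 2 → ℤ) 1 : ℤ) : ℝ) = -k := by simp
    -- For (x, u) = 0 and d = -k the variable cτ̄ - d equals k, and i/(2y) = 1/(-2iy).
    have hν : ∀ h, (Complex.I * nuVar B τ u x (-k) / (2 * τ.im)) ^ h
        = (k : ℂ) ^ h / (-2 * Complex.I * (τ.im : ℂ)) ^ h := by
      intro h
      rw [← div_pow, nuVar, x.2.2.1]
      congr 1
      have hy0 : (τ.im : ℂ) ≠ 0 := by exact_mod_cast τ.im_ne_zero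
      have hI := Complex.I_mul_I
      rw [div_eq_div_iff (by simp [hy0]) (by simp [hy0])]
      push_cast
      linear_combination (-2 * k * τ.im) * hI
    rw [h1]
    change dualTerm B φ η τ z u deg P (x + s • u) (-k) = _
    rw [dualTerm_add_smul τ z hB hu huu hηu hP, dualTerm, dualPoly, ← hA, mul_assoc A,
      Finset.mul_sum (Finset.range (deg + 1))]
    congr 1
    · congr 1
      push_cast
      ring
    · congr 1
      refine Finset.sum_congr rfl fun h _ => ?_
      rw [hν, hf]
      ring
  have hR1 : ∀ h, (inflate B L (subLattice B L u u') u k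
      (thetaM B L g₀ g u u' (subIsometryPoly g₀ g u P h) η τ z ((k : ℝ) • muVec B g₀ g u u') 0)) δ
      = e (-((k : ℂ) * s)) * ∑' x : X, subTerm B g₀ g u (subIsometryPoly g₀ g u P h) η τ z
        ((k : ℝ) • muVec B g₀ g u u') x := by
    intro h
    rw [thetaM_eq_tsum, inflate_tsum hB hL hLe huL huu hu'L huu']
    simp only [Int.cast_natCast]
    rfl
  rw [dualCoeff, ← Ψ.tsum_eq]
  simp only [hL1]
  rw [tsum_mul_left, tsum_mul_left, Summable.tsum_finsetSum fun h _ => (hfs h).mul_left _,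
    Pi.smul_apply, Finset.sum_apply, smul_eq_mul, Finset.mul_sum (Finset.range (deg + 1)),
    Finset.mul_sum (Finset.range (deg + 1)), Finset.mul_sum (Finset.range (deg + 1)),
    Finset.mul_sum (Finset.range (deg + 1))]
  refine Finset.sum_congr rfl fun h _ => ?_
  rw [Pi.smul_apply, smul_eq_mul, hR1, tsum_mul_left]
  have h2 : pref * (A * ∑' x, f h x) = c₀ * (E * ∑' x : X, subTerm B g₀ g u
      (subIsometryPoly g₀ g u P h) η τ z ((k : ℝ) • muVec B g₀ g u u') x) := by
    rw [← tsum_mul_left, ← tsum_mul_left, ← tsum_mul_left, ← tsum_mul_left]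
    exact tsum_congr (hterm h)
  linear_combination (e (-((k : ℂ) * s)) * ((k : ℂ) ^ h / (-2 * Complex.I * (τ.im : ℂ)) ^ h)) * h2

end FourierIdentification
end JacobiTheta
end

noncomputable section

namespace JacobiTheta

open UpperHalfPlane

/-! ### Cosets of translations and lattice points -/

section Cosets

theorem mul_inv_mem_GammaInfty {γ γ' : SL(2, ℤ)} (h0 : γ 1 0 = γ' 1 0) (h1 : γ 1 1 = γ' 1 1) :
    γ' * γ⁻¹ ∈ GammaInfty := by
  -- The exponent is the upper right entry of γ'γ⁻¹.
  refine Subgroup.mem_zpowers_iff.mpr ⟨γ' 0 1 * γ 0 0 - γ' 0 0 * γ 0 1, ?_⟩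
  have hd : γ 0 0 * γ 1 1 - γ 0 1 * γ 1 0 = 1 := by
    have := γ.det_coe
    rwa [Matrix.det_fin_two] at this
  have hd' : γ' 0 0 * γ 1 1 - γ' 0 1 * γ 1 0 = 1 := by
    have := γ'.det_coe
    rw [Matrix.det_fin_two] at this
    rwa [h0, h1]
  rw [eq_mul_inv_iff_mul_eq]
  apply Subtype.ext
  rw [Matrix.SpecialLinearGroup.coe_mul, ModularGroup.coe_T_zpow]
  ext i j
  fin_cases i <;> fin_cases j
  · simp [Matrix.mul_apply]
    linear_combination γ' 0 0 * hd - γ 0 0 * hd'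
  · simp [Matrix.mul_apply]
    linear_combination γ' 0 1 * hd - γ 0 1 * hd'
  · simpa [Matrix.mul_apply] using h0
  · simpa [Matrix.mul_apply] using h1

theorem bottom_row_mul_of_mem_GammaInfty {h : SL(2, ℤ)} (hh : h ∈ GammaInfty) (γ : SL(2, ℤ)) :
    (h * γ) 1 0 = γ 1 0 ∧ (h * γ) 1 1 = γ 1 1 := by
  obtain ⟨m, rfl⟩ := Subgroup.mem_zpowers_iff.mp hh
  constructor <;>
  · rw [Matrix.SpecialLinearGroup.coe_mul, ModularGroup.coe_T_zpow]
    simp [Matrix.mul_apply]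

/-- The lattice point `(kc, -kd)` for a matrix with bottom row `(c, d)`. -/
def bottomRowPoint (γ : SL(2, ℤ)) (k : ℕ) : Fin 2 → ℤ := ![k * γ 1 0, -(k * γ 1 1)]

theorem bottomRowPoint_ne_zero (γ : SL(2, ℤ)) (k : ℕ+) : bottomRowPoint γ k ≠ 0 := by
  intro h
  have hk : ((k : ℕ) : ℤ) ≠ 0 := by exact_mod_cast k.ne_zero
  have h0 : ((k : ℕ) : ℤ) * γ 1 0 = 0 := congrFun h 0
  have h1 : -(((k : ℕ) : ℤ) * γ 1 1) = 0 := congrFun h 1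
  rw [neg_eq_zero] at h1
  have hd := γ.det_coe
  rw [Matrix.det_fin_two, (mul_eq_zero.mp h0).resolve_left hk,
    (mul_eq_zero.mp h1).resolve_left hk] at hd
  simp at hd

theorem gcd_bottomRow (γ : SL(2, ℤ)) : Int.gcd (γ 1 0) (γ 1 1) = 1 :=
  Int.isCoprime_iff_gcd_eq_one.mp (ModularGroup.bottom_row_coprime γ)

/-- Pairs of a coset of the translations and a positive integer correspond to nonzero lattice
points. -/
theorem bijective_bottomRowPoint {R : Set SL(2, ℤ)}
    (hR : Subgroup.IsComplement (GammaInfty : Set SL(2, ℤ)) R) :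
    Function.Bijective fun x : R × ℕ+ =>
      (⟨bottomRowPoint x.1 x.2, by simpa using bottomRowPoint_ne_zero x.1 x.2⟩ :
        {m : Fin 2 → ℤ // m ∉ ({0} : Finset (Fin 2 → ℤ))}) := by
  constructor
  · rintro ⟨γ, k⟩ ⟨γ', k'⟩ h
    have h := Subtype.ext_iff.mp h
    have h0 : ((k : ℕ) : ℤ) * (γ : SL(2, ℤ)) 1 0 = (k' : ℕ) * (γ' : SL(2, ℤ)) 1 0 := congrFun h 0
    have h1 : ((k : ℕ) : ℤ) * (γ : SL(2, ℤ)) 1 1 = (k' : ℕ) * (γ' : SL(2, ℤ)) 1 1 :=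
      neg_injective (congrFun h 1)
    -- The integer k is the greatest common divisor of the two coordinates, as a bottom row is
    -- coprime.
    have hk : (k : ℕ) = k' := by
      have e1 := Int.gcd_mul_left (k : ℕ) ((γ : SL(2, ℤ)) 1 0) ((γ : SL(2, ℤ)) 1 1)
      have e2 := Int.gcd_mul_left (k' : ℕ) ((γ' : SL(2, ℤ)) 1 0) ((γ' : SL(2, ℤ)) 1 1)
      rw [gcd_bottomRow, mul_one, Int.natAbs_natCast] at e1 e2
      rw [← e1, ← e2, h0, h1]
    have hk0 : ((k : ℕ) : ℤ) ≠ 0 := by exact_mod_cast k.ne_zero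
    rw [← hk] at h0 h1
    have hmem := mul_inv_mem_GammaInfty (mul_left_cancel₀ hk0 h0) (mul_left_cancel₀ hk0 h1)
    have huniq := (hR.existsUnique (γ' : SL(2, ℤ))).unique
      (y₁ := (⟨_, hmem⟩, γ)) (y₂ := (⟨1, GammaInfty.one_mem⟩, γ')) (by simp) (by simp)
    exact Prod.ext (congrArg Prod.snd huniq) (PNat.eq hk)
  · rintro ⟨m, hm⟩
    have hm0 : m ≠ 0 := by simpa using hm
    have hgcd : 0 < Int.gcd (m 0) (m 1) := by
      rw [Nat.pos_iff_ne_zero, Ne, Int.gcd_eq_zero_iff]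
      rintro ⟨h0, h1⟩
      exact hm0 (funext fun i => by fin_cases i <;> assumption)
    set d := Int.gcd (m 0) (m 1) with hd
    obtain ⟨c, hc⟩ : (d : ℤ) ∣ m 0 := Int.gcd_dvd_left ..
    obtain ⟨c', hc'⟩ : (d : ℤ) ∣ m 1 := Int.gcd_dvd_right ..
    have hcop : IsCoprime c (-c') := by
      rw [IsCoprime.neg_right_iff, Int.isCoprime_iff_gcd_eq_one]
      have := Int.gcd_mul_left d c c'
      rw [← hc, ← hc', ← hd, Int.natAbs_natCast] at this
      exact Nat.eq_of_mul_eq_mul_left hgcd (by rw [← this, mul_one])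
    obtain ⟨γ, -, hγ⟩ := ModularGroup.bottom_row_surj (R := ℤ) (a := ![c, -c']) hcop
    have hγ0 : γ 1 0 = c := congrFun hγ 0
    have hγ1 : γ 1 1 = -c' := congrFun hγ 1
    -- Replacing γ by the representative of its coset does not change the bottom row.
    obtain ⟨⟨⟨t, ht⟩, ρ⟩, htρ, -⟩ := hR.existsUnique γ
    have hrow := bottom_row_mul_of_mem_GammaInfty ht (ρ : SL(2, ℤ))
    change t * (ρ : SL(2, ℤ)) = γ at htρ
    rw [htρ, hγ0, hγ1] at hrow
    refine ⟨(ρ, ⟨d, hgcd⟩), Subtype.ext (funext fun i => ?_)⟩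
    fin_cases i
    · change (d : ℤ) * (ρ : SL(2, ℤ)) 1 0 = m 0
      rw [← hrow.1, ← hc]
    · change -((d : ℤ) * (ρ : SL(2, ℤ)) 1 1) = m 1
      rw [← hrow.2, hc']
      ring

end Cosets

/-! ### The Poincaré series -/

section Poincare

variable {V : Type*} [AddCommGroup V] [Module ℝ V] {p n : ℕ} {B : LinearMap.BilinForm ℝ V}
variable {g₀ : V ≃ₗ[ℝ] (Fin p → ℝ) × (Fin n → ℝ)} {g : V ≃ₗ[ℝ] V} {u : V}

/-- The lift uses the principal square root, and integral powers of it are principal powers of cτ +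
d with half-integral exponent; so no branch correction arises. -/
theorem thetaFactor_stdLift_inv {U : Type*} (deg : ℕ) (q : ℂ) (γ : SL(2, ℤ)) (τ : ℍ) (z : ℂ)
    (α β : U) :
    (thetaFactor (2 * (deg : ℤ) + p - n) q (Mp2Z.stdLift γ) (τ, z, α, β))⁻¹
      = e (-(q * ((γ 1 0 : ℤ) : ℂ) * z ^ 2 / autFactor γ τ))
        * autFactor γ τ ^ (-(deg : ℂ) + ((n : ℂ) - (p : ℂ)) / 2) := by
  have h1 : autFactor γ τ ^ (-(deg : ℂ) + ((n : ℂ) - (p : ℂ)) / 2)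
      = ((autFactor γ τ ^ (1 / 2 : ℂ)) ^ (2 * (deg : ℤ) + p - n))⁻¹ := by
    rw [← zpow_neg, ← Complex.cpow_mul_int]
    congr 1
    push_cast
    ring
  have h2 : ∀ t, (e t)⁻¹ = e (-t) := fun t => by
    rw [e, e, ← Complex.exp_neg]
    congr 1
    ring
  rw [thetaFactor, mul_inv, h2, h1, mul_comm]
  congr 2
  change -(q * ((γ 1 0 : ℤ) * z ^ 2 / autFactor γ τ)) = _
  ring

/-- The inverse form of `dualCoeff_smul`: the matrix with bottom row (c, d) carries the index (0,
-k) to (kc, -kd), so this coefficient at τ is obtained from the one with index (0, -k) at γτ by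
removing the automorphy factor and applying ρ_L⁻¹. -/
theorem smul_poincareSummand (hB : IsIsometryToStd B (g.trans g₀)) {L : Submodule ℤ V}
    (hL : IsFullLattice L) (hLe : IsEvenLattice B L) {u' η : V} (huL : u ∈ L) (hu : u ≠ 0)
    (huu : B u u = 0) (hηu : B η u = 0) (hu'L : u' ∈ dualLattice B L) (huu' : B u u' = 1)
    {deg : ℕ} {P : MvPolynomial (Fin p) ℂ} (hP : P.IsHomogeneous deg) (τ : ℍ) (z : ℂ)
    (γ : SL(2, ℤ)) (k : ℕ) :
    ((1 / Real.sqrt (2 * B (posProj g₀ g u) (posProj g₀ g u)) : ℝ) : ℂ)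
        • poincareSummand B L g₀ g u u' deg P η τ z γ k
      = dualCoeff B L (g.trans g₀) η u u' deg P τ z (bottomRowPoint γ k) := by
  set x := Mp2Z.stdLift γ with hx
  set J := thetaFactor (2 * (deg : ℤ) + p - n) (quad B η) x (τ, z, (0 : V), (0 : V)) with hJ
  have hJ0 : J ≠ 0 := thetaFactor_ne_zero _ _ _ _
  have h1 := dualCoeff_smul τ z hB hL hLe huL hu huu hηu hu'L huu' hP x ![0, -(k : ℤ)]
  have hm : ![x.mat 0 0 * (![0, -(k : ℤ)] : Fin 2 → ℤ) 0
        - x.mat 1 0 * (![0, -(k : ℤ)] : Fin 2 → ℤ) 1,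
      -(x.mat 0 1 * (![0, -(k : ℤ)] : Fin 2 → ℤ) 0)
        + x.mat 1 1 * (![0, -(k : ℤ)] : Fin 2 → ℤ) 1] = bottomRowPoint γ k := by
    change ![γ 0 0 * (0 : ℤ) - γ 1 0 * (-(k : ℤ)), -(γ 0 1 * (0 : ℤ)) + γ 1 1 * (-(k : ℤ))] = _
    rw [bottomRowPoint]
    funext i
    fin_cases i
    · change γ 0 0 * (0 : ℤ) - γ 1 0 * (-(k : ℤ)) = k * γ 1 0
      ring
    · change -(γ 0 1 * (0 : ℤ)) + γ 1 1 * (-(k : ℤ)) = -(k * γ 1 1)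
      ring
  rw [hm, ← hJ] at h1
  have h2 : weilRep B L p n x⁻¹ (dualCoeff B L (g.trans g₀) η u u' deg P (x.mat • τ)
      (z / autFactor x.mat τ) ![0, -(k : ℤ)])
      = J • dualCoeff B L (g.trans g₀) η u u' deg P τ z (bottomRowPoint γ k) := by
    rw [h1, map_smul, ← Module.End.mul_apply, ← map_mul, inv_mul_cancel, map_one,
      Module.End.one_apply]
  have h3 : dualCoeff B L (g.trans g₀) η u u' deg P τ z (bottomRowPoint γ k)
      = J⁻¹ • weilRep B L p n x⁻¹ (dualCoeff B L (g.trans g₀) η u u' deg P (x.mat • τ)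
        (z / autFactor x.mat τ) ![0, -(k : ℤ)]) := by
    rw [h2, inv_smul_smul₀ hJ0]
  rw [h3, dualCoeff_eq_inflate hB hL hLe huL hu huu hηu hu'L huu' hP, map_smul, smul_comm J⁻¹,
    poincareSummand, map_sum, Finset.smul_sum (r := J⁻¹)]
  congr 1
  refine Finset.sum_congr rfl fun h _ => ?_
  rw [map_smul, smul_smul, hJ, thetaFactor_stdLift_inv]
  congr 1
  change _ = e (-((quad B η : ℂ) * ((γ 1 0 : ℤ) : ℂ) * z ^ 2 / autFactor γ τ))
    * autFactor γ τ ^ (-(deg : ℂ) + ((n : ℂ) - (p : ℂ)) / 2)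
    * ((k : ℂ) ^ h / (-2 * Complex.I * ((γ • τ).im : ℂ)) ^ h
      * e (-(((k : ℂ) ^ 2
              + 4 * Complex.I * k * ((z / autFactor γ τ).im : ℂ) * (B η (posProj g₀ g u) : ℂ))
            / (4 * Complex.I * ((γ • τ).im : ℂ)
                * (B (posProj g₀ g u) (posProj g₀ g u) : ℂ)))))
  ring

end Poincare
end JacobiTheta
end

/-! ### Assembly of the Poincaré series. -/

theorem mainTheorem9 {V : Type*} [AddCommGroup V] [Module ℝ V]
    (B : LinearMap.BilinForm ℝ V) (L : Submodule ℤ V)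
    (hL : JacobiTheta.IsFullLattice L) (hLeven : JacobiTheta.IsEvenLattice B L)
    {p n : ℕ} (g₀ : V ≃ₗ[ℝ] (Fin p → ℝ) × (Fin n → ℝ)) (hg₀ : JacobiTheta.IsIsometryToStd B g₀)
    (g : V ≃ₗ[ℝ] V) (hg : ∀ x y, B (g x) (g y) = B x y)
    (deg : ℕ) (P : MvPolynomial (Fin p) ℂ) (hP : P.IsHomogeneous deg)
    (η : V) (hη : η ∈ JacobiTheta.dualLattice B L)
    (u : V) (hu : u ∈ L) (huprim : ∀ v ∈ L, ∀ m : ℤ, u = m • v → m = 1 ∨ m = -1)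
    (huiso : B u u = 0)
    (u' : V) (hu' : u' ∈ JacobiTheta.dualLattice B L) (huu' : B u u' = 1)
    (hηu : B η u = 0)
    (R : Set (Matrix.SpecialLinearGroup (Fin 2) ℤ))
    (hR : Subgroup.IsComplement
      (JacobiTheta.GammaInfty : Set (Matrix.SpecialLinearGroup (Fin 2) ℤ)) R)
    (τ : UpperHalfPlane) (z : ℂ) :
    HasSum
      (fun x : R × ℕ+ =>
        ((1 / Real.sqrt (2 * B (JacobiTheta.posProj g₀ g u) (JacobiTheta.posProj g₀ g u)) : ℝ) : ℂ)
          • JacobiTheta.poincareSummand B L g₀ g u u' deg P η τ z x.1 x.2)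
      (JacobiTheta.thetaL B L g₀ g P η τ z 0 0
        - ((1 / Real.sqrt (2 * B (JacobiTheta.posProj g₀ g u) (JacobiTheta.posProj g₀ g u)) : ℝ) : ℂ)
          • JacobiTheta.inflate B L (JacobiTheta.subLattice B L u u') u 0
              (JacobiTheta.thetaM B L g₀ g u u' (JacobiTheta.subIsometryPoly g₀ g u P 0)
                η τ z 0 0)) := by
  have hB : JacobiTheta.IsIsometryToStd B (g.trans g₀) := hg₀.trans hg
  have hu0 : u ≠ 0 := by
    rintro rfl
    rw [map_zero, LinearMap.zero_apply] at huu'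
    exact zero_ne_one huu'
  have hsum : HasSum (JacobiTheta.dualCoeff B L (g.trans g₀) η u u' deg P τ z)
      (JacobiTheta.thetaL B L g₀ g P η τ z 0 0) := by
    -- At r = s = 0 all characters are 1 and the theta function is the sum of all its Fourier
    -- coefficients.
    have h := JacobiTheta.hasSum_dualCoeff τ z hB hL hLeven hu hu0 huiso hηu hu' huu' hP 0 0
    rw [zero_smul, ← JacobiTheta.thetaL_eq_thetaVec hB L hP] at h
    refine h.congr_fun fun m => ?_
    simp [JacobiTheta.e]
  have hzero := JacobiTheta.dualCoeff_eq_inflate hB hL hLeven hu hu0 huiso hηu hu' huu' hP τ z 0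
  -- For the index zero the factor k^h with k = 0 leaves only h = 0, and the exponential factor is
  -- 1.
  rw [Finset.sum_eq_single_of_mem 0 (by simp) fun h _ hh => by simp [hh]] at hzero
  have hm : (![0, -((0 : ℕ) : ℤ)] : Fin 2 → ℤ) = 0 := by
    funext i
    fin_cases i <;> simp
  rw [hm, Nat.cast_zero, Nat.cast_zero, Nat.cast_zero, zero_smul] at hzero
  simp only [pow_zero, div_one, one_mul, mul_zero, zero_mul, add_zero, ne_eq, OfNat.ofNat_ne_zero,
    not_false_eq_true, zero_pow, zero_div, neg_zero, JacobiTheta.e, Complex.exp_zero, one_smul]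
    at hzero
  -- Removing the index zero leaves the sum over nonzero points, which is then reindexed by cosets
  -- and positive integers.
  have hcompl := (Finset.hasSum_compl_iff (f := JacobiTheta.dualCoeff B L (g.trans g₀) η u u' deg P
    τ z) {(0 : Fin 2 → ℤ)} (a := JacobiTheta.thetaL B L g₀ g P η τ z 0 0
      - JacobiTheta.dualCoeff B L (g.trans g₀) η u u' deg P τ z 0)).mpr (by simpa using hsum)
  rw [hzero] at hcompl
  have hfin := (Equiv.ofBijective _ (JacobiTheta.bijective_bottomRowPoint hR)).hasSum_iff.mpr hcompl
  refine hfin.congr_fun fun x => ?_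
  exact JacobiTheta.smul_poincareSummand hB hL hLeven hu hu0 huiso hηu hu' huu' hP τ z x.1 x.2
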